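/- Call $h\in[-\infty,+\infty]$ a $\Sigma_1$ (lower-computable) number if $h=\sup_n q_n$ for some computable sequence $(q_n)_{n\ge 0}$ of rationals; in particular $+\infty$ is $\Sigma_1$. Let $(B_n)_{n\ge 0}$ be the standard computable enumeration of the balls of $[0,1]$ (usual metric) with centre in $\mathbb{Q}\cap[0,1]$ and positive rational radius. A map $f:[0,1]\to[0,1]$ is computable if there is an algorithm which, given $m$, enumerates a set $I_m\subset\mathbb{N}$ such that $f^{-1}(B_m)=\bigcup_{n\in I_m}B_n$ (such a map is continuous). Its topological entropy is $$h(f)=\sup_{\mathcal U}\ \inf_{n\ge 1}\frac{\log_2 N_n(f,\mathcal U)}{n}\in[0,+\infty],$$ where $\mathcal U$ ranges over the finite open covers of $[0,1]$ and $N_n(f,\mathcal U)$ is the minimal cardinality of a subcover of $\bigvee_{k=0}^{n-1}f^{-k}(\mathcal U)$. **Theorem.** The topological entropies of the computable maps $f:[0,1]\to[0,1]$ are exactly the non-negative $\Sigma_1$ numbers: for every $h\in[-\infty,+\infty]$, there is a computable map $f:[0,1]\to[0,1]$ with $h(f)=h$ if and only if $h\ge 0$ and $h$ is $\Sigma_1$.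 In particular, a real number is the topological entropy of a computable map of $[0,1]$ if and only if it is non-negative and $\Sigma_1$. -/

import Mathlib

open Set

noncomputable section

namespace CompEntropy

/-! ### Rational numbers as data for algorithms -/

/-- The numbering of the rationals used by algorithms: the number `⟨a, ⟨b, c⟩⟩` stands for the
rational `(a - b) / (c + 1)`. Every rational has a number, and numerator and denominator can be
computed from it. -/
def ratOfNat (n : ℕ) : ℚ :=
  ((n.unpair.1 : ℚ) - (n.unpair.2.unpair.1 : ℚ)) / ((n.unpair.2.unpair.2 : ℚ) + 1)

/-- The numbering of the positive rationals: `⟨a, b⟩` stands for `(a + 1) / (b + 1)`. -/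
def posRatOfNat (n : ℕ) : ℚ :=
  ((n.unpair.1 : ℚ) + 1) / ((n.unpair.2 : ℚ) + 1)

/-- A sequence of rationals is computable if some algorithm outputs, on input `n`, a number
of the `n`-th term. -/
def IsComputableRatSeq (q : ℕ → ℚ) : Prop :=
  ∃ g : ℕ → ℕ, Computable g ∧ ∀ n, q n = ratOfNat (g n)

/-- `Σ₁` (lower-computable) extended reals: suprema of computable sequences of rationals.
The value `+∞` is allowed, and `+∞` is `Σ₁`. -/
def IsLowerComputable (h : EReal) : Prop :=
  ∃ q : ℕ → ℚ, IsComputableRatSeq q ∧ h = ⨆ n, (((q n : ℚ) : ℝ) : EReal)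

/-! ### Computable metric spaces and computable maps -/

/-- A computable metric structure on `X`: a dense sequence of ideal points whose mutual distances
are uniformly computable. -/
structure ComputableMetric (X : Type*) [MetricSpace X] where
  /-- the sequence of ideal points -/
  point : ℕ → X
  dense : DenseRange point
  dist_computable : ∃ d : ℕ × ℕ × ℕ → ℕ, Computable d ∧
    ∀ i j n : ℕ, |dist (point i) (point j) - ((ratOfNat (d (i, j, n)) : ℚ) : ℝ)| ≤ 1 / 2 ^ n

/-- The enumeration of the ideal balls: open balls centred at ideal points, with positive rational
radii. -/
def ComputableMetric.idealBall {X : Type*} [MetricSpace X] (S : ComputableMetric X) (n : ℕ) :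
    Set X :=
  Metric.ball (S.point n.unpair.1) ((posRatOfNat n.unpair.2 : ℚ) : ℝ)

/-- A map is computable if there is an algorithm that, given `m`, enumerates a set `I m` of
indices such that the preimage of the `m`-th ideal ball is the union of the ideal balls with index
in `I m`. -/
def IsComputableMap {X Y : Type*} [MetricSpace X] [MetricSpace Y]
    (S : ComputableMetric X) (T : ComputableMetric Y) (f : X → Y) : Prop :=
  ∃ I : ℕ → Set ℕ, REPred (fun p : ℕ × ℕ => p.2 ∈ I p.1) ∧
    ∀ m, f ⁻¹' T.idealBall m = ⋃ n ∈ I m, S.idealBall n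

/-! ### The computable metric structure of the unit interval -/

/-- The enumeration of `ℚ ∩ [0, 1]`: `⟨a, b⟩` stands for `min a (b + 1) / (b + 1)`. -/
def unitRat (i : ℕ) : unitInterval :=
  ⟨((min i.unpair.1 (i.unpair.2 + 1) : ℕ) : ℝ) / ((i.unpair.2 + 1 : ℕ) : ℝ), by
    refine ⟨by positivity, ?_⟩
    rw [div_le_one (by positivity)]
    exact_mod_cast min_le_right _ _⟩

theorem denseRange_unitRat : DenseRange unitRat := by
  rw [Metric.denseRange_iff]
  intro x r hr
  obtain ⟨b, hb⟩ := exists_nat_one_div_lt hr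
  have hpos : (0 : ℝ) < (b : ℝ) + 1 := by positivity
  have hx0 : (0 : ℝ) ≤ x := x.2.1
  have hx1 : (x : ℝ) ≤ 1 := x.2.2
  have h0 : 0 ≤ (x : ℝ) * ((b : ℝ) + 1) := by positivity
  refine ⟨Nat.pair ⌊(x : ℝ) * ((b : ℝ) + 1)⌋₊ b, ?_⟩
  have hle : ⌊(x : ℝ) * ((b : ℝ) + 1)⌋₊ ≤ b + 1 := by
    apply Nat.floor_le_of_le
    push_cast
    nlinarith
  have h1 := Nat.floor_le h0
  have h2 := Nat.lt_floor_add_one ((x : ℝ) * ((b : ℝ) + 1))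
  refine lt_of_le_of_lt ?_ hb
  rw [Subtype.dist_eq, Real.dist_eq]
  simp only [unitRat, Nat.unpair_pair, min_eq_left hle]
  push_cast
  have e : (x : ℝ) - (⌊(x : ℝ) * ((b : ℝ) + 1)⌋₊ : ℝ) / ((b : ℝ) + 1)
      = ((x : ℝ) * ((b : ℝ) + 1) - (⌊(x : ℝ) * ((b : ℝ) + 1)⌋₊ : ℝ)) / ((b : ℝ) + 1) := by
    field_simp
  rw [e, abs_div, abs_of_pos hpos, abs_of_nonneg (by linarith)]
  gcongr
  linarith

/-- A number of the rational `|unitRat i - unitRat j|`. -/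
def unitDist (p : ℕ × ℕ × ℕ) : ℕ :=
  let a := min p.1.unpair.1 (p.1.unpair.2 + 1) * (p.2.1.unpair.2 + 1)
  let c := min p.2.1.unpair.1 (p.2.1.unpair.2 + 1) * (p.1.unpair.2 + 1)
  Nat.pair ((a - c) + (c - a))
    (Nat.pair 0 ((p.1.unpair.2 + 1) * (p.2.1.unpair.2 + 1) - 1))

theorem computable_unitDist : Computable unitDist := by
  have hi1 : Primrec fun p : ℕ × ℕ × ℕ => p.1.unpair.1 :=
    Primrec.fst.comp (Primrec.unpair.comp Primrec.fst)
  have hi2 : Primrec fun p : ℕ × ℕ × ℕ => p.1.unpair.2 + 1 :=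
    Primrec.succ.comp (Primrec.snd.comp (Primrec.unpair.comp Primrec.fst))
  have hj : Primrec fun p : ℕ × ℕ × ℕ => p.2.1.unpair :=
    Primrec.unpair.comp (Primrec.fst.comp Primrec.snd)
  have hj1 : Primrec fun p : ℕ × ℕ × ℕ => p.2.1.unpair.1 := Primrec.fst.comp hj
  have hj2 : Primrec fun p : ℕ × ℕ × ℕ => p.2.1.unpair.2 + 1 :=
    Primrec.succ.comp (Primrec.snd.comp hj)
  have ha := Primrec.nat_mul.comp (Primrec.nat_min.comp hi1 hi2) hj2
  have hc := Primrec.nat_mul.comp (Primrec.nat_min.comp hj1 hj2) hi2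
  exact (Primrec₂.natPair.comp
    (Primrec.nat_add.comp (Primrec.nat_sub.comp ha hc) (Primrec.nat_sub.comp hc ha))
    (Primrec₂.natPair.comp (Primrec.const 0)
      (Primrec.nat_sub.comp (Primrec.nat_mul.comp hi2 hj2) (Primrec.const 1)))).to_comp

theorem ratOfNat_unitDist (i j n : ℕ) :
    ((ratOfNat (unitDist (i, j, n)) : ℚ) : ℝ) = dist (unitRat i) (unitRat j) := by
  rw [Subtype.dist_eq, Real.dist_eq]
  simp only [ratOfNat, unitDist, unitRat, Nat.unpair_pair]
  set a := min i.unpair.1 (i.unpair.2 + 1)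
  set c := min j.unpair.1 (j.unpair.2 + 1)
  set b := i.unpair.2
  set d := j.unpair.2
  have hb : (0 : ℝ) < (b : ℝ) + 1 := by positivity
  have hd : (0 : ℝ) < (d : ℝ) + 1 := by positivity
  have hden : (((b + 1) * (d + 1) - 1 : ℕ) : ℝ) + 1 = ((b : ℝ) + 1) * ((d : ℝ) + 1) := by
    have : 1 ≤ (b + 1) * (d + 1) := Nat.one_le_iff_ne_zero.2 (by positivity)
    rw [Nat.cast_sub this]
    push_cast
    ring
  have hnum : ((a * (d + 1) - c * (b + 1) + (c * (b + 1) - a * (d + 1)) : ℕ) : ℝ)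
      = |(a : ℝ) * ((d : ℝ) + 1) - (c : ℝ) * ((b : ℝ) + 1)| := by
    rcases le_total (a * (d + 1)) (c * (b + 1)) with h | h
    · have h' : (a : ℝ) * ((d : ℝ) + 1) ≤ (c : ℝ) * ((b : ℝ) + 1) := by exact_mod_cast h
      rw [Nat.sub_eq_zero_of_le h, zero_add, Nat.cast_sub h, abs_of_nonpos (by linarith)]
      push_cast
      ring
    · have h' : (c : ℝ) * ((b : ℝ) + 1) ≤ (a : ℝ) * ((d : ℝ) + 1) := by exact_mod_cast h
      rw [Nat.sub_eq_zero_of_le h, add_zero, Nat.cast_sub h, abs_of_nonneg (by linarith)]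
      push_cast
      ring
  have e : (a : ℝ) / ((b + 1 : ℕ) : ℝ) - (c : ℝ) / ((d + 1 : ℕ) : ℝ)
      = ((a : ℝ) * ((d : ℝ) + 1) - (c : ℝ) * ((b : ℝ) + 1)) / (((b : ℝ) + 1) * ((d : ℝ) + 1)) := by
    push_cast
    field_simp
  rw [e, abs_div, abs_of_pos (mul_pos hb hd), ← hnum, ← hden]
  simp

/-- The unit interval with its usual metric, the ideal points being `ℚ ∩ [0, 1]`. -/
def unitIntervalMetric : ComputableMetric unitInterval where
  point := unitRat
  dense := denseRange_unitRat
  dist_computable := ⟨unitDist, computable_unitDist, fun i j n => by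
    rw [ratOfNat_unitDist, sub_self, abs_zero]
    positivity⟩

/-! ### Topological entropy through open covers -/

section Entropy

variable {X : Type*}

/-- The join `⋁_{k < n} f⁻ᵏ(𝒰)`. -/
def iterJoin (f : X → X) (𝒰 : Set (Set X)) (n : ℕ) : Set (Set X) :=
  {W | ∃ c : Fin n → Set X, (∀ k, c k ∈ 𝒰) ∧ W = ⋂ k : Fin n, f^[(k : ℕ)] ⁻¹' c k}

/-- The minimal cardinality of a finite subcollection of `𝒱` that covers `K`. -/
def minCoverCard (K : Set X) (𝒱 : Set (Set X)) : ℕ :=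
  sInf {m | ∃ F : Finset (Set X), (F : Set (Set X)) ⊆ 𝒱 ∧ K ⊆ ⋃₀ (F : Set (Set X)) ∧ F.card = m}

/-- The entropy `inf_{n ≥ 1} (log₂ Nₙ(K, f, 𝒰)) / n` of `f` on `K` relative to the cover `𝒰`, where
`Nₙ(K, f, 𝒰)` is the minimal cardinality of a subcover of `⋁_{k < n} f⁻ᵏ(𝒰)`. -/
def entropyOfCover (K : Set X) (f : X → X) (𝒰 : Set (Set X)) : ℝ :=
  ⨅ n : ℕ, Real.logb 2 (minCoverCard K (iterJoin f 𝒰 (n + 1)) : ℝ) / ((n : ℝ) + 1)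

/-- The topological entropy of `f` on `K`: the supremum, possibly `+∞`, of its entropies relative
to the finite covers of `K` by open sets. -/
def topEntropy [TopologicalSpace X] (K : Set X) (f : X → X) : EReal :=
  ⨆ (𝒰 : Set (Set X)) (_ : 𝒰.Finite ∧ (∀ U ∈ 𝒰, IsOpen U) ∧ K ⊆ ⋃₀ 𝒰),
    ((entropyOfCover K f 𝒰 : ℝ) : EReal)

end Entropy

end CompEntropy

end

/-! Lower computability of the entropy rests on Misiurewicz's theorem: for a continuous interval map
`f`, the entropy is the supremum of `log₂ s / N` over the strict `s`-horseshoes of `f^[N]`.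
Strictness makes being a horseshoe an open condition (`isOpen_setOf_isHorseshoe`), so the endpoints
may be taken rational. For computable `f` the finitely many strict inequalities are then
semidecidable (`rePred_isHorseshoe`), and enumerating rational horseshoes gives a computable
sequence of rationals with supremum the entropy.

Misiurewicz's theorem (`exists_isHorseshoe`) is obtained by counting itineraries through a partition
of `[0, 1]` into small intervals. The image of an interval meets a run of cells. It contains every
cell that it crosses, so the future after a crossed cell depends on that cell alone; at most two
uncrossed end cells remain. Without crossed letters there are thus at most `2 ^ n` itineraries.
Crossed letters are then allowed one at a time, cutting words at the first or the last crossing of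
the new letter (`wordCount_insert_le`, `wordCount_insert_le'`): if the returns to each cell number
at most `μ ^ n` for some `μ ≥ 2`, all itineraries number at most a polynomial times `μ ^ n`
(`wordCount_growth`). Passing to an iterate of `f` makes the bound `μ ≥ 2` harmless. Hence large
entropy forces many returns to a single cell, and these are carried by disjoint subintervals of the
cell, each stretched across it (`exists_disjoint_intervals`): a horseshoe.

For the converse, a zigzag with `2 ^ p` full branches has `j` successive square roots up to
rescaling, which brings the entropy down to `p / 2 ^ j`; the auxiliary pieces are expanding
transients and contribute only polynomial factors (`root_grows`). Copies of such maps, with fixed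
endpoints, are placed on the intervals `[1 / (n + 2), 1 / (n + 1)]`. The cells are invariant and all
but finitely many are invisible at a given scale, so the supremum of the individual rates bounds the
entropy of the glued map (`topEntropy_towerMap_le`). Alternate branches of a zigzag give disjoint
covering intervals and the lower bound `(p - 1) / 2 ^ j` (`le_topEntropy_towerMap`). The loss
vanishes for large `j`, and every non-negative lower-computable number is approached by a computable
sequence of such dyadics (`exists_computable_dyadic`). An explicit modulus of continuity makes the
glued map computable (`isComputableMap_of_modulus`). -/

namespace CompEntropy

/-! ### Open covers and lower bounds for entropy -/

section Covers

variable {X : Type*}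

/-- Each piece can be enlarged to a member of `𝒱`. The pieces produced later, by itineraries or by
closeness of orbits, are neither open nor members of a join, so refinement is the convenient form.
-/
theorem minCoverCard_le {K : Set X} {𝒱 : Set (Set X)} (F : Finset (Set X))
    (hK : K ⊆ ⋃₀ (F : Set (Set X))) (hF : ∀ S ∈ F, ∃ W ∈ 𝒱, S ⊆ W) :
    minCoverCard K 𝒱 ≤ F.card := by
  classical
  choose! w hw hsub using hF
  refine le_trans (b := (F.image w).card) ?_ Finset.card_image_le
  refine Nat.sInf_le ⟨F.image w, ?_, ?_, rfl⟩
  · intro W hW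
    obtain ⟨S, hS, rfl⟩ := Finset.mem_image.1 (Finset.mem_coe.1 hW)
    exact hw S hS
  · intro x hx
    obtain ⟨S, hS, hxS⟩ := hK hx
    exact ⟨w S, Finset.mem_coe.2 (Finset.mem_image_of_mem w hS), hsub S hS hxS⟩

/-- Distinct points need distinct members of a subcover. A finite subcover has to exist, since
otherwise the infimum takes its default value `0`. -/
theorem card_le_minCoverCard {ι : Type*} [Fintype ι] {K : Set X} {𝒱 : Set (Set X)}
    (h𝒱 : 𝒱.Finite) (hK : K ⊆ ⋃₀ 𝒱) (p : ι → X) (hp : ∀ i, p i ∈ K)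
    (hsep : ∀ W ∈ 𝒱, ∀ i j, p i ∈ W → p j ∈ W → i = j) :
    Fintype.card ι ≤ minCoverCard K 𝒱 := by
  refine le_csInf ⟨_, h𝒱.toFinset, by simp, by simpa using hK, rfl⟩ ?_
  rintro m ⟨F, hF, hKF, rfl⟩
  choose W hW hpW using fun i => hKF (hp i)
  rw [← Finset.card_univ]
  refine Finset.card_le_card_of_injOn W (fun i _ => hW i) fun i _ j _ hij => ?_
  exact hsep _ (hF (hW i)) i j (hpW i) (by rw [hij]; exact hpW j)

theorem finite_iterJoin (f : X → X) {𝒰 : Set (Set X)} (h𝒰 : 𝒰.Finite) (n : ℕ) :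
    (iterJoin f 𝒰 n).Finite := by
  refine ((Set.Finite.pi' fun _ : Fin n => h𝒰).image
    fun c => ⋂ k : Fin n, f^[(k : ℕ)] ⁻¹' c k).subset ?_
  rintro W ⟨c, hc, rfl⟩
  exact ⟨c, hc, rfl⟩

theorem univ_subset_sUnion_iterJoin (f : X → X) {𝒰 : Set (Set X)} (h𝒰 : univ ⊆ ⋃₀ 𝒰) (n : ℕ) :
    univ ⊆ ⋃₀ iterJoin f 𝒰 n := by
  intro x _
  choose c hc hxc using fun k : Fin n => h𝒰 (mem_univ (f^[(k : ℕ)] x))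
  exact ⟨_, ⟨c, hc, rfl⟩, mem_iInter.2 fun k => hxc k⟩

theorem isOpen_of_mem_iterJoin [TopologicalSpace X] {f : X → X} (hf : Continuous f)
    {𝒰 : Set (Set X)} (h𝒰 : ∀ U ∈ 𝒰, IsOpen U) {n : ℕ} {W : Set X} (hW : W ∈ iterJoin f 𝒰 n) :
    IsOpen W := by
  obtain ⟨c, hc, rfl⟩ := hW
  exact isOpen_iInter_of_finite fun k => (h𝒰 _ (hc k)).preimage (hf.iterate _)

theorem minCoverCard_iterJoin_pos [Nonempty X] (f : X → X) {𝒰 : Set (Set X)} (hfin : 𝒰.Finite)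
    (h𝒰 : univ ⊆ ⋃₀ 𝒰) (n : ℕ) : 1 ≤ minCoverCard univ (iterJoin f 𝒰 n) := by
  have := card_le_minCoverCard (ι := Unit) (finite_iterJoin f hfin n)
    (univ_subset_sUnion_iterJoin f h𝒰 n) (fun _ => Classical.arbitrary X) (fun _ => mem_univ _)
    (fun _ _ _ _ _ _ => rfl)
  simpa using this

theorem bddBelow_entropyOfCover (K : Set X) (f : X → X) (𝒰 : Set (Set X)) :
    BddBelow (range fun n : ℕ =>
      Real.logb 2 (minCoverCard K (iterJoin f 𝒰 (n + 1)) : ℝ) / ((n : ℝ) + 1)) := by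
  refine ⟨0, ?_⟩
  rintro _ ⟨n, rfl⟩
  refine div_nonneg ?_ (by positivity)
  rcases Nat.eq_zero_or_pos (minCoverCard K (iterJoin f 𝒰 (n + 1))) with h | h
  · simp [h]
  · exact Real.logb_nonneg one_lt_two (by exact_mod_cast h)

theorem entropyOfCover_nonneg (K : Set X) (f : X → X) (𝒰 : Set (Set X)) :
    0 ≤ entropyOfCover K f 𝒰 := by
  refine le_ciInf fun n => div_nonneg ?_ (by positivity)
  rcases Nat.eq_zero_or_pos (minCoverCard K (iterJoin f 𝒰 (n + 1))) with h | h
  · simp [h]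
  · exact Real.logb_nonneg one_lt_two (by exact_mod_cast h)

theorem topEntropy_nonneg [TopologicalSpace X] (K : Set X) (f : X → X) : 0 ≤ topEntropy K f := by
  refine le_trans ?_ (le_iSup₂ (f := fun (𝒰 : Set (Set X))
    (_ : 𝒰.Finite ∧ (∀ U ∈ 𝒰, IsOpen U) ∧ K ⊆ ⋃₀ 𝒰) => ((entropyOfCover K f 𝒰 : ℝ) : EReal))
    {univ} ⟨finite_singleton _, by simp, by simp⟩)
  exact_mod_cast entropyOfCover_nonneg K f {univ}

/-- The points of a family of sets that cover one another under `f^[n]` realize all words. -/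
theorem exists_itinerary {f : X → X} {n s : ℕ} {K : Fin s → Set X} (hne : ∀ i, (K i).Nonempty)
    (hcov : ∀ i j, K j ⊆ f^[n] '' K i) (k : ℕ) (w : ℕ → Fin s) :
    ∃ x ∈ K (w 0), ∀ l < k, f^[n * l] x ∈ K (w l) := by
  induction k generalizing w with
  | zero => exact ⟨_, (hne (w 0)).some_mem, fun l hl => absurd hl (Nat.not_lt_zero l)⟩
  | succ k ih =>
    -- The point is built backwards from the end of the word. Only finite words occur, so no
    -- compactness is needed.
    obtain ⟨y, hy, hyw⟩ := ih fun l => w (l + 1)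
    obtain ⟨x, hx, rfl⟩ := hcov (w 0) (w 1) hy
    refine ⟨x, hx, fun l hl => ?_⟩
    cases l with
    | zero => simpa using hx
    | succ l =>
      have := hyw l (by omega)
      rwa [← Function.iterate_add_apply] at this

/-- Finitely many disjoint closed sets, each of which covers all of them under `f^[n]`, bound the
entropy from below. -/
theorem le_topEntropy_of_covering [TopologicalSpace X] {f : X → X} {n s : ℕ} (hn : 1 ≤ n)
    {K : Fin s → Set X} (hclosed : ∀ i, IsClosed (K i)) (hne : ∀ i, (K i).Nonempty)
    (hdisj : Pairwise fun i j => Disjoint (K i) (K j)) (hcov : ∀ i j, K j ⊆ f^[n] '' K i) :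
    ((Real.logb 2 s / n : ℝ) : EReal) ≤ topEntropy univ f := by
  rcases Nat.eq_zero_or_pos s with rfl | hs
  · simpa using topEntropy_nonneg univ f
  -- Each `V i` is open and meets no `K j` other than `K i`, so the member of this cover containing
  -- a point of some `K j` determines `j`.
  let V : Fin s → Set X := fun i => ⋂ j : {j : Fin s // j ≠ i}, (K j)ᶜ
  have hV : ∀ i j x, x ∈ K j → x ∈ V i → j = i := by
    intro i j x hx hxV
    by_contra hji
    exact mem_iInter.1 hxV ⟨j, hji⟩ hx
  have hcover : univ ⊆ ⋃₀ range V := by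
    intro x _
    by_cases hx : ∃ i, x ∈ K i
    · obtain ⟨i, hi⟩ := hx
      exact ⟨V i, mem_range_self i, mem_iInter.2 fun j hj =>
        disjoint_left.1 (hdisj j.2) hj hi⟩
    · push Not at hx
      exact ⟨V ⟨0, hs⟩, mem_range_self _, mem_iInter.2 fun j => hx j⟩
  refine le_trans ?_ (le_iSup₂ (f := fun (𝒰 : Set (Set X))
    (_ : 𝒰.Finite ∧ (∀ U ∈ 𝒰, IsOpen U) ∧ univ ⊆ ⋃₀ 𝒰) =>
      ((entropyOfCover univ f 𝒰 : ℝ) : EReal))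
    (range V) ⟨finite_range V, ?_, hcover⟩)
  swap
  · rintro _ ⟨i, rfl⟩
    exact isOpen_iInter_of_finite fun j => (hclosed _).isOpen_compl
  rw [EReal.coe_le_coe_iff]
  refine le_ciInf fun t => ?_
  -- The number of multiples of `n` among the times `0, …, t`. The `s ^ k` words read at these times
  -- are separated by the join, and `t + 1 ≤ k * n` converts this into the rate `log₂ s / n`.
  let k := t / n + 1
  have hkt : ∀ l < k, n * l < t + 1 := by
    intro l hl
    have h1 : l ≤ t / n := Nat.lt_succ_iff.1 hl
    have h2 : n * l ≤ t := (Nat.mul_le_mul_left n h1).trans (Nat.mul_div_le t n)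
    omega
  have ext : ∀ w : Fin k → Fin s, ∃ x : X, ∀ l : Fin k, f^[n * (l : ℕ)] x ∈ K (w l) := by
    intro w
    obtain ⟨x, -, hx⟩ := exists_itinerary hne hcov k
      (fun l => if h : l < k then w ⟨l, h⟩ else ⟨0, hs⟩)
    refine ⟨x, fun l => ?_⟩
    simpa using hx l l.2
  choose p hp using ext
  have hcard := card_le_minCoverCard (finite_iterJoin f (finite_range V) (t + 1))
    (univ_subset_sUnion_iterJoin f hcover (t + 1)) p (fun _ => mem_univ _) ?_
  swap
  · rintro W ⟨c, hc, rfl⟩ w w' hw hw'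
    funext l
    obtain ⟨i, hi⟩ := hc ⟨n * l, hkt l l.2⟩
    have h1 := mem_iInter.1 hw ⟨n * l, hkt l l.2⟩
    have h2 := mem_iInter.1 hw' ⟨n * l, hkt l l.2⟩
    rw [← hi] at h1 h2
    rw [hV i _ _ (hp w l) h1, hV i _ _ (hp w' l) h2]
  rw [Fintype.card_fun, Fintype.card_fin, Fintype.card_fin] at hcard
  have hs' : (0 : ℝ) < s := by exact_mod_cast hs
  have hlog : 0 ≤ Real.logb 2 s := Real.logb_nonneg one_lt_two (by exact_mod_cast hs)
  have h1 : (k : ℝ) * Real.logb 2 s ≤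
      Real.logb 2 (minCoverCard univ (iterJoin f (range V) (t + 1)) : ℝ) := by
    rw [← Real.logb_pow]
    exact Real.logb_le_logb_of_le one_lt_two (by positivity) (by exact_mod_cast hcard)
  have h2 : ((t : ℝ) + 1) ≤ k * n := by
    have : t + 1 ≤ k * n := by
      have := Nat.lt_div_mul_add (a := t) hn
      simp only [k, add_mul, one_mul]
      omega
    exact_mod_cast this
  have hn' : (0 : ℝ) < n := by exact_mod_cast hn
  rw [div_le_div_iff₀ hn' (by positivity)]
  nlinarith [mul_le_mul_of_nonneg_left h2 hlog, mul_le_mul_of_nonneg_right h1 hn'.le]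

end Covers

/-! ### Counting itineraries by their crossed letters -/

section Itineraries

variable {X : Type*} {m : ℕ}

/-- A set crosses the cell `b` if it meets a cell below `b` and a cell above `b`. -/
def Crosses (c : X → Fin m) (T : Set X) (b : Fin m) : Prop :=
  (∃ x ∈ T, c x < b) ∧ ∃ x ∈ T, b < c x

open Classical in
/-- The part of `T` in the cell `b`, taken to be the whole cell if `T` crosses it. -/
noncomputable def cellPart (c : X → Fin m) (T : Set X) (b : Fin m) : Set X :=
  if Crosses c T b then c ⁻¹' {b} else T ∩ c ⁻¹' {b}

open Classical in
/-- Whether the letter `b` may follow: crossed letters have to lie in `Q`. -/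
noncomputable def admits (c : X → Fin m) (Q : Finset (Fin m)) (T : Set X) (b : Fin m) : ℕ :=
  if Crosses c T b then (if b ∈ Q then 1 else 0)
  else if (T ∩ c ⁻¹' {b}).Nonempty then 1 else 0

/-- The number of itineraries of length `n` of `g` from `D` whose crossed letters lie in `Q`. -/
noncomputable def wordCount (c : X → Fin m) (g : X → X) (Q : Finset (Fin m)) : ℕ → Set X → ℕ
  | 0, _ => 1
  | n + 1, D => ∑ b, admits c Q (g '' D) b * wordCount c g Q n (cellPart c (g '' D) b)

open Classical in
/-- The number of itineraries of length `n + 1` of `g` from `D` whose last letter is `a`, crossed. -/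
noncomputable def returnCount (c : X → Fin m) (g : X → X) (a : Fin m) : ℕ → Set X → ℕ
  | 0, D => if Crosses c (g '' D) a then 1 else 0
  | n + 1, D =>
    ∑ b, admits c Finset.univ (g '' D) b * returnCount c g a n (cellPart c (g '' D) b)

/-- A letter that is met but not crossed has all of `T` weakly on one side of it, so it is the least
or the greatest letter met by `T`. -/
theorem sum_admits_empty_le (c : X → Fin m) (T : Set X) : ∑ b, admits c ∅ T b ≤ 2 := by
  classical
  have key : ∀ b, admits c ∅ T b ≤
      (if (T ∩ c ⁻¹' {b}).Nonempty ∧ ∀ x ∈ T, b ≤ c x then 1 else 0) +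
        (if (T ∩ c ⁻¹' {b}).Nonempty ∧ ∀ x ∈ T, c x ≤ b then 1 else 0) := by
    intro b
    unfold admits
    by_cases hc : Crosses c T b
    · simp [hc]
    by_cases hn : (T ∩ c ⁻¹' {b}).Nonempty
    · have : (∀ x ∈ T, b ≤ c x) ∨ ∀ x ∈ T, c x ≤ b := by
        by_contra! h
        exact hc h
      rcases this with h | h
      · rw [if_neg hc, if_pos hn, if_pos ⟨hn, h⟩]; omega
      · rw [if_neg hc, if_pos hn, if_pos (c := _ ∧ ∀ x ∈ T, c x ≤ b) ⟨hn, h⟩]; omega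
    · simp [hc, hn]
  refine (Finset.sum_le_sum fun b _ => key b).trans ?_
  rw [Finset.sum_add_distrib, Finset.sum_boole, Finset.sum_boole]
  have h1 : (Finset.univ.filter fun b => (T ∩ c ⁻¹' {b}).Nonempty ∧ ∀ x ∈ T, b ≤ c x).card ≤ 1 := by
    rw [Finset.card_le_one]
    intro a ha b hb
    simp only [Finset.mem_filter] at ha hb
    obtain ⟨-, ⟨x, hx, hxa⟩, ha⟩ := ha
    obtain ⟨-, ⟨y, hy, hyb⟩, hb⟩ := hb
    exact le_antisymm ((ha y hy).trans_eq hyb) ((hb x hx).trans_eq hxa)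
  have h2 : (Finset.univ.filter fun b => (T ∩ c ⁻¹' {b}).Nonempty ∧ ∀ x ∈ T, c x ≤ b).card ≤ 1 := by
    rw [Finset.card_le_one]
    intro a ha b hb
    simp only [Finset.mem_filter] at ha hb
    obtain ⟨-, ⟨x, hx, hxa⟩, ha⟩ := ha
    obtain ⟨-, ⟨y, hy, hyb⟩, hb⟩ := hb
    exact le_antisymm (hxa.symm.trans_le (hb x hx)) (hyb.symm.trans_le (ha y hy))
  simpa using add_le_add h1 h2

theorem wordCount_empty_le (c : X → Fin m) (g : X → X) (n : ℕ) (D : Set X) :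
    wordCount c g ∅ n D ≤ 2 ^ n := by
  induction n generalizing D with
  | zero => simp [wordCount]
  | succ n ih =>
    calc wordCount c g ∅ (n + 1) D
        ≤ ∑ b, admits c ∅ (g '' D) b * 2 ^ n :=
          Finset.sum_le_sum fun b _ => Nat.mul_le_mul_left _ (ih _)
      _ = (∑ b, admits c ∅ (g '' D) b) * 2 ^ n := by rw [Finset.sum_mul]
      _ ≤ 2 * 2 ^ n := Nat.mul_le_mul_right _ (sum_admits_empty_le c _)
      _ = 2 ^ (n + 1) := by ring

theorem admits_mono (c : X → Fin m) {Q Q' : Finset (Fin m)} (h : Q ⊆ Q') (T : Set X) (b : Fin m) :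
    admits c Q T b ≤ admits c Q' T b := by
  unfold admits
  by_cases hc : Crosses c T b
  · by_cases hb : b ∈ Q
    · simp [hc, hb, h hb]
    · simp [hc, hb]
  · simp [hc]

-- Only the crossed occurrence of `a` is new. It continues from the full cell of `a`, whatever `T`
-- was: this loss of memory is what lets words be cut at `a`.
open Classical in
theorem sum_admits_insert_le (c : X → Fin m) (a : Fin m) (Q : Finset (Fin m)) (T : Set X)
    (φ : Set X → ℕ) :
    ∑ b, admits c (insert a Q) T b * φ (cellPart c T b) ≤
      ∑ b, admits c Q T b * φ (cellPart c T b) +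
        (if Crosses c T a then 1 else 0) * φ (c ⁻¹' {a}) := by
  have key : ∀ b, admits c (insert a Q) T b * φ (cellPart c T b) ≤
      admits c Q T b * φ (cellPart c T b) +
        if a = b then (if Crosses c T a then 1 else 0) * φ (c ⁻¹' {a}) else 0 := by
    intro b
    by_cases hc : Crosses c T b
    · by_cases hab : a = b
      · subst hab
        by_cases ha : a ∈ Q <;> simp [admits, cellPart, hc, ha]
      · have : b ≠ a := Ne.symm hab
        simp [admits, hc, hab, this]
    · simp [admits, hc]
  refine (Finset.sum_le_sum fun b _ => key b).trans ?_
  rw [Finset.sum_add_distrib, Finset.sum_ite_eq]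
  simp

/-- First-passage decomposition: up to the first crossing of `a` the crossed letters lie in `Q`, and
after it the word restarts from the whole cell of `a`. -/
theorem wordCount_insert_le (c : X → Fin m) (g : X → X) (a : Fin m) (Q : Finset (Fin m)) (n : ℕ)
    (D : Set X) :
    wordCount c g (insert a Q) n D ≤ wordCount c g Q n D +
      ∑ i ∈ Finset.range n,
        wordCount c g Q i D * wordCount c g (insert a Q) (n - 1 - i) (c ⁻¹' {a}) := by
  classical
  induction n generalizing D with
  | zero => simp [wordCount]
  | succ n ih =>
    rw [Finset.sum_range_succ']
    set w := fun k => wordCount c g (insert a Q) k (c ⁻¹' {a}) with hw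
    have h1 := sum_admits_insert_le c a Q (g '' D) (wordCount c g (insert a Q) n)
    have h2 : ∑ b, admits c Q (g '' D) b * wordCount c g (insert a Q) n (cellPart c (g '' D) b) ≤
        ∑ b, admits c Q (g '' D) b * (wordCount c g Q n (cellPart c (g '' D) b) +
          ∑ i ∈ Finset.range n, wordCount c g Q i (cellPart c (g '' D) b) * w (n - 1 - i)) :=
      Finset.sum_le_sum fun b _ => Nat.mul_le_mul_left _ (ih _)
    have h3 : ∑ b, admits c Q (g '' D) b * (wordCount c g Q n (cellPart c (g '' D) b) +
          ∑ i ∈ Finset.range n, wordCount c g Q i (cellPart c (g '' D) b) * w (n - 1 - i)) =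
        wordCount c g Q (n + 1) D +
          ∑ i ∈ Finset.range n, wordCount c g Q (i + 1) D * w (n - 1 - i) := by
      simp only [mul_add, Finset.sum_add_distrib, Finset.mul_sum, wordCount, Finset.sum_mul]
      congr 1
      rw [Finset.sum_comm]
      simp only [mul_assoc]
    -- The empty prefix, counted once, accounts for words whose first letter is the crossed `a`.
    have h4 : (if Crosses c (g '' D) a then 1 else 0) * w n ≤ wordCount c g Q 0 D * w n := by
      refine Nat.mul_le_mul_right _ ?_
      split_ifs <;> simp [wordCount]
    have h5 : ∀ i, n + 1 - 1 - (i + 1) = n - 1 - i := by intro i; omega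
    simp only [h5]
    simp only [Nat.add_sub_cancel, Nat.sub_zero]
    change wordCount c g (insert a Q) (n + 1) D ≤ wordCount c g Q (n + 1) D +
      (∑ i ∈ Finset.range n, wordCount c g Q (i + 1) D * w (n - 1 - i) + wordCount c g Q 0 D * w n)
    rw [h3] at h2
    change wordCount c g (insert a Q) (n + 1) D ≤ _ at h1
    change _ ≤ _ + _ * w n at h1
    linarith

/-- Last-passage decomposition: after the last crossing of `a` the crossed letters lie in `Q`. The
part before it is merely some word ending in a crossing of `a`. -/
theorem wordCount_insert_le' (c : X → Fin m) (g : X → X) (a : Fin m) (Q : Finset (Fin m)) (n : ℕ)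
    (D : Set X) :
    wordCount c g (insert a Q) n D ≤ wordCount c g Q n D +
      ∑ i ∈ Finset.range n, returnCount c g a i D * wordCount c g Q (n - 1 - i) (c ⁻¹' {a}) := by
  classical
  induction n generalizing D with
  | zero => simp [wordCount]
  | succ n ih =>
    rw [Finset.sum_range_succ']
    set w := fun k => wordCount c g Q k (c ⁻¹' {a}) with hw
    have h1 : wordCount c g (insert a Q) (n + 1) D ≤
        ∑ b, admits c (insert a Q) (g '' D) b * (wordCount c g Q n (cellPart c (g '' D) b) +
          ∑ i ∈ Finset.range n, returnCount c g a i (cellPart c (g '' D) b) * w (n - 1 - i)) :=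
      Finset.sum_le_sum fun b _ => Nat.mul_le_mul_left _ (ih _)
    have h2 : ∑ b, admits c (insert a Q) (g '' D) b *
          (wordCount c g Q n (cellPart c (g '' D) b) +
          ∑ i ∈ Finset.range n, returnCount c g a i (cellPart c (g '' D) b) * w (n - 1 - i)) =
        ∑ b, admits c (insert a Q) (g '' D) b * wordCount c g Q n (cellPart c (g '' D) b) +
          ∑ b, admits c (insert a Q) (g '' D) b *
            ∑ i ∈ Finset.range n, returnCount c g a i (cellPart c (g '' D) b) * w (n - 1 - i) := by
      simp only [mul_add, Finset.sum_add_distrib]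
    have h3 := sum_admits_insert_le c a Q (g '' D) (wordCount c g Q n)
    have h4 : ∑ b, admits c (insert a Q) (g '' D) b *
            ∑ i ∈ Finset.range n, returnCount c g a i (cellPart c (g '' D) b) * w (n - 1 - i) ≤
        ∑ b, admits c Finset.univ (g '' D) b *
            ∑ i ∈ Finset.range n, returnCount c g a i (cellPart c (g '' D) b) * w (n - 1 - i) :=
      Finset.sum_le_sum fun b _ =>
        Nat.mul_le_mul_right _ (admits_mono c (Finset.subset_univ _) _ _)
    have h5 : ∑ b, admits c Finset.univ (g '' D) b *
            ∑ i ∈ Finset.range n, returnCount c g a i (cellPart c (g '' D) b) * w (n - 1 - i) =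
        ∑ i ∈ Finset.range n, returnCount c g a (i + 1) D * w (n - 1 - i) := by
      simp only [Finset.mul_sum, returnCount, Finset.sum_mul]
      rw [Finset.sum_comm]
      simp only [mul_assoc]
    have h6 : ∀ i, n + 1 - 1 - (i + 1) = n - 1 - i := by intro i; omega
    simp only [h6]
    simp only [Nat.add_sub_cancel, Nat.sub_zero]
    change wordCount c g (insert a Q) (n + 1) D ≤ wordCount c g Q (n + 1) D +
      (∑ i ∈ Finset.range n, returnCount c g a (i + 1) D * w (n - 1 - i) +
        returnCount c g a 0 D * w n)
    change _ ≤ wordCount c g Q (n + 1) D + returnCount c g a 0 D * w n at h3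
    linarith

/-- The crossed letters are added one by one, each addition raising only the degree of the
polynomial factor. The condition `2 ≤ μ` serves the base case, where up to two uncrossed letters are
available at each step. -/
theorem wordCount_growth (c : X → Fin m) (g : X → X) {μ : ℝ} (hμ : 2 ≤ μ)
    (hret : ∀ a n, (returnCount c g a n (c ⁻¹' {a}) : ℝ) ≤ μ ^ (n + 1)) (Q : Finset (Fin m)) :
    ∃ C : ℝ, 0 ≤ C ∧ ∃ d : ℕ, ∀ n D, (wordCount c g Q n D : ℝ) ≤ C * (n + 1) ^ d * μ ^ n := by
  have hμ1 : 1 ≤ μ := by linarith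
  have hμ0 : 0 ≤ μ := by linarith
  induction Q using Finset.induction_on with
  | empty =>
    refine ⟨1, zero_le_one, 0, fun n D => ?_⟩
    have h1 : (wordCount c g ∅ n D : ℝ) ≤ 2 ^ n := by exact_mod_cast wordCount_empty_le c g n D
    simpa using h1.trans (pow_le_pow_left₀ zero_le_two hμ n)
  | insert a Q _ ih =>
    obtain ⟨C, hC, d, h⟩ := ih
    -- The return bound concerns only words starting in the cell of `a`. Those are treated first, by
    -- last passage; arbitrary starting sets then follow by first passage.
    have hself : ∀ n, (wordCount c g (insert a Q) n (c ⁻¹' {a}) : ℝ) ≤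
        C * (n + 1) ^ (d + 1) * μ ^ n := by
      intro n
      have h1 : (wordCount c g (insert a Q) n (c ⁻¹' {a}) : ℝ) ≤ wordCount c g Q n (c ⁻¹' {a}) +
          ∑ i ∈ Finset.range n, (returnCount c g a i (c ⁻¹' {a}) : ℝ) *
            wordCount c g Q (n - 1 - i) (c ⁻¹' {a}) := by
        exact_mod_cast wordCount_insert_le' c g a Q n (c ⁻¹' {a})
      have h2 : ∑ i ∈ Finset.range n, (returnCount c g a i (c ⁻¹' {a}) : ℝ) *
            wordCount c g Q (n - 1 - i) (c ⁻¹' {a}) ≤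
          ∑ _i ∈ Finset.range n, C * ((n : ℝ) + 1) ^ d * μ ^ n := by
        refine Finset.sum_le_sum fun i hi => ?_
        have hi' := Finset.mem_range.1 hi
        calc (returnCount c g a i (c ⁻¹' {a}) : ℝ) * wordCount c g Q (n - 1 - i) (c ⁻¹' {a})
            ≤ μ ^ (i + 1) * (C * (((n - 1 - i : ℕ) : ℝ) + 1) ^ d * μ ^ (n - 1 - i)) :=
              mul_le_mul (hret a i) (h _ _) (Nat.cast_nonneg _) (by positivity)
          _ = C * (((n - 1 - i : ℕ) : ℝ) + 1) ^ d * μ ^ (i + 1 + (n - 1 - i)) := by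
              rw [pow_add]; ring
          _ = C * (((n - 1 - i : ℕ) : ℝ) + 1) ^ d * μ ^ n := by
              congr 2; omega
          _ ≤ C * ((n : ℝ) + 1) ^ d * μ ^ n := by
              gcongr; omega
      rw [Finset.sum_const, Finset.card_range, nsmul_eq_mul] at h2
      have h3 := h n (c ⁻¹' {a})
      calc _ ≤ C * (n + 1) ^ d * μ ^ n + n * (C * ((n : ℝ) + 1) ^ d * μ ^ n) := by linarith
        _ = _ := by rw [pow_succ]; ring
    -- The product of a factor of degree `d` and one of degree `d + 1`, summed over fewer than `n +
    -- 1` cutting times, has degree `2 * d + 2`.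
    refine ⟨C + C * C, by positivity, 2 * d + 2, fun n D => ?_⟩
    have h1 : (wordCount c g (insert a Q) n D : ℝ) ≤ wordCount c g Q n D +
        ∑ i ∈ Finset.range n, (wordCount c g Q i D : ℝ) *
          wordCount c g (insert a Q) (n - 1 - i) (c ⁻¹' {a}) := by
      exact_mod_cast wordCount_insert_le c g a Q n D
    have h2 : ∑ i ∈ Finset.range n, (wordCount c g Q i D : ℝ) *
          wordCount c g (insert a Q) (n - 1 - i) (c ⁻¹' {a}) ≤
        ∑ _i ∈ Finset.range n, C * C * ((n : ℝ) + 1) ^ (2 * d + 1) * μ ^ n := by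
      refine Finset.sum_le_sum fun i hi => ?_
      have hi' := Finset.mem_range.1 hi
      calc (wordCount c g Q i D : ℝ) * wordCount c g (insert a Q) (n - 1 - i) (c ⁻¹' {a})
          ≤ (C * ((i : ℝ) + 1) ^ d * μ ^ i) *
              (C * (((n - 1 - i : ℕ) : ℝ) + 1) ^ (d + 1) * μ ^ (n - 1 - i)) :=
            mul_le_mul (h _ _) (hself _) (Nat.cast_nonneg _) (by positivity)
        _ ≤ (C * ((n : ℝ) + 1) ^ d * μ ^ i) * (C * ((n : ℝ) + 1) ^ (d + 1) * μ ^ (n - 1 - i)) := by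
            gcongr
            omega
        _ = C * C * ((n : ℝ) + 1) ^ (2 * d + 1) * μ ^ (i + (n - 1 - i)) := by
            rw [pow_add, show 2 * d + 1 = d + (d + 1) by ring, pow_add]; ring
        _ ≤ C * C * ((n : ℝ) + 1) ^ (2 * d + 1) * μ ^ n := by
            gcongr
            omega
    rw [Finset.sum_const, Finset.card_range, nsmul_eq_mul] at h2
    have hn1 : (1 : ℝ) ≤ n + 1 := by linarith [Nat.cast_nonneg (α := ℝ) n]
    have h3 : C * ((n : ℝ) + 1) ^ d * μ ^ n ≤ C * ((n : ℝ) + 1) ^ (2 * d + 2) * μ ^ n := by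
      gcongr
      omega
    have h4 : n * (C * C * ((n : ℝ) + 1) ^ (2 * d + 1) * μ ^ n) ≤
        C * C * ((n : ℝ) + 1) ^ (2 * d + 2) * μ ^ n := by
      calc n * (C * C * ((n : ℝ) + 1) ^ (2 * d + 1) * μ ^ n)
          ≤ (n + 1) * (C * C * ((n : ℝ) + 1) ^ (2 * d + 1) * μ ^ n) := by
            gcongr; linarith
        _ = _ := by rw [pow_succ _ (2 * d + 1)]; ring
    have h5 := h n D
    calc _ ≤ C * ((n : ℝ) + 1) ^ (2 * d + 2) * μ ^ n +
          C * C * ((n : ℝ) + 1) ^ (2 * d + 2) * μ ^ n := by linarith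
      _ = _ := by ring

end Itineraries

/-! ### Itineraries of intervals under continuous maps -/

section Intervals

variable {m : ℕ} {c : unitInterval → Fin m} {g : unitInterval → unitInterval}

theorem admits_le_one {X : Type*} (c : X → Fin m) (Q : Finset (Fin m)) (T : Set X) (b : Fin m) :
    admits c Q T b ≤ 1 := by
  unfold admits
  split_ifs <;> simp

theorem admits_univ_ne_zero {X : Type*} (c : X → Fin m) {T : Set X} {b : Fin m}
    (h : (T ∩ c ⁻¹' {b}).Nonempty) : admits c Finset.univ T b ≠ 0 := by
  unfold admits
  rw [if_pos (Finset.mem_univ b), if_pos h]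
  simp

theorem ordConnected_cell (hc : Monotone c) (b : Fin m) : (c ⁻¹' {b}).OrdConnected :=
  ordConnected_singleton.preimage_mono hc

theorem ordConnected_image (hg : Continuous g) {D : Set unitInterval} (hD : D.OrdConnected) :
    (g '' D).OrdConnected :=
  (hD.isPreconnected.image g hg.continuousOn).ordConnected

theorem cell_subset_of_crosses (hc : Monotone c) {T : Set unitInterval} (hT : T.OrdConnected)
    {b : Fin m} (h : Crosses c T b) : c ⁻¹' {b} ⊆ T := by
  obtain ⟨⟨x, hx, hxb⟩, y, hy, hby⟩ := h
  rintro z rfl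
  exact hT.out hx hy ⟨(hc.reflect_lt hxb).le, (hc.reflect_lt hby).le⟩

/-- An interval contains every cell that it crosses. So for intervals the replacement by the whole
cell changes nothing, and the combinatorial counts describe actual orbits. -/
theorem cellPart_eq (hc : Monotone c) {T : Set unitInterval} (hT : T.OrdConnected) (b : Fin m) :
    cellPart c T b = T ∩ c ⁻¹' {b} := by
  unfold cellPart
  split_ifs with h
  · exact (inter_eq_right.2 (cell_subset_of_crosses hc hT h)).symm
  · rfl

theorem ordConnected_cellPart (hc : Monotone c) {T : Set unitInterval} (hT : T.OrdConnected)
    (b : Fin m) : (cellPart c T b).OrdConnected := by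
  rw [cellPart_eq hc hT]
  exact hT.inter (ordConnected_cell hc b)

/-- Itineraries of length `n` cut an interval into at most `wordCount` pieces. -/
theorem exists_cover_card_le_wordCount (hc : Monotone c) (hg : Continuous g) (n : ℕ)
    (D : Set unitInterval) (hD : D.OrdConnected) :
    ∃ F : Finset (Set unitInterval), F.card ≤ wordCount c g Finset.univ n D ∧
      D ⊆ ⋃₀ (F : Set (Set unitInterval)) ∧
      ∀ S ∈ F, ∀ k, 1 ≤ k → k ≤ n → ∃ b, ∀ x ∈ S, c (g^[k] x) = b := by
  classical
  induction n generalizing D with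
  | zero => exact ⟨{D}, by simp [wordCount], by simp, fun S _ k h1 h2 => by omega⟩
  | succ n ih =>
    have hT := ordConnected_image hg hD
    choose F hcard hcov hF using fun b => ih _ (ordConnected_cellPart hc hT b)
    -- Letters that are not admitted are dropped: no point of `D` needs them, and their pieces would
    -- not be paid for in `wordCount`.
    refine ⟨(Finset.univ.filter fun b => admits c Finset.univ (g '' D) b ≠ 0).biUnion fun b =>
      (F b).image fun S => {x | g x ∈ S ∧ c (g x) = b}, ?_, ?_, ?_⟩
    · refine Finset.card_biUnion_le.trans ?_
      refine (Finset.sum_le_sum fun b _ => Finset.card_image_le).trans ?_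
      rw [wordCount, ← Finset.sum_filter_add_sum_filter_not (Finset.univ)
        (fun b => admits c Finset.univ (g '' D) b ≠ 0) (fun b => admits c Finset.univ (g '' D) b *
          wordCount c g Finset.univ n (cellPart c (g '' D) b))]
      refine le_add_right (Finset.sum_le_sum fun b hb => ?_)
      have hb' := (Finset.mem_filter.1 hb).2
      exact (hcard b).trans (Nat.le_mul_of_pos_left _ (Nat.pos_of_ne_zero hb'))
    · intro x hx
      have hmem : g x ∈ g '' D ∩ c ⁻¹' {c (g x)} := ⟨mem_image_of_mem g hx, rfl⟩
      have hmem' := hmem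
      rw [← cellPart_eq hc hT] at hmem'
      obtain ⟨S, hS, hxS⟩ := hcov _ hmem'
      refine ⟨_, Finset.mem_coe.2 (Finset.mem_biUnion.2 ⟨c (g x), Finset.mem_filter.2
        ⟨Finset.mem_univ _, ?_⟩, Finset.mem_image_of_mem _ hS⟩), hxS, rfl⟩
      exact admits_univ_ne_zero c ⟨_, hmem⟩
    · intro S hS k hk1 hkn
      obtain ⟨b, -, hS⟩ := Finset.mem_biUnion.1 hS
      obtain ⟨S', hS', rfl⟩ := Finset.mem_image.1 hS
      obtain ⟨k, rfl⟩ := Nat.exists_eq_add_of_le' hk1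
      rcases Nat.eq_zero_or_pos k with rfl | hk
      · exact ⟨b, fun x hx => hx.2⟩
      · obtain ⟨b', hb'⟩ := hF b S' hS' k hk (by omega)
        exact ⟨b', fun x hx => by rw [Function.iterate_succ_apply]; exact hb' _ hx.1⟩

/-- Two points of the image of an interval are the images of the endpoints of a subinterval that
stays between them. -/
theorem exists_uIcc_image_subset (hg : Continuous g) {D : Set unitInterval} (hD : D.OrdConnected)
    {u v : unitInterval} (hu : u ∈ g '' D) (hv : v ∈ g '' D) :
    ∃ x ∈ D, ∃ y ∈ D, g x = u ∧ g y = v ∧ g '' uIcc x y ⊆ uIcc u v := by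
  obtain ⟨a, ha, rfl⟩ := hu
  obtain ⟨b, hb, rfl⟩ := hv
  -- Among all pairs with the prescribed images a closest one is chosen; a minimum exists by
  -- compactness.
  have hcompact : IsCompact {p : unitInterval × unitInterval |
      (p.1 ∈ uIcc a b ∧ p.2 ∈ uIcc a b) ∧ g p.1 = g a ∧ g p.2 = g b} := by
    refine IsClosed.isCompact ?_
    refine ((isCompact_uIcc.isClosed.preimage continuous_fst).inter
      (isCompact_uIcc.isClosed.preimage continuous_snd)).inter ?_
    exact (isClosed_eq (hg.comp continuous_fst) continuous_const).inter
      (isClosed_eq (hg.comp continuous_snd) continuous_const)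
  obtain ⟨⟨x, y⟩, ⟨⟨hx, hy⟩, hgx, hgy⟩, hmin⟩ := hcompact.exists_isMinOn
    ⟨(a, b), ⟨left_mem_uIcc, right_mem_uIcc⟩, rfl, rfl⟩
    (f := fun p => dist p.1 p.2) continuous_dist.continuousOn
  have hsub : uIcc a b ⊆ D := hD.uIcc_subset ha hb
  have hIVT : ∀ p q t, t ∈ uIcc (g p) (g q) → ∃ w ∈ uIcc p q, g w = t := fun p q t ht =>
    intermediate_value_uIcc hg.continuousOn ht
  have hdist : ∀ p ∈ uIcc a b, ∀ q ∈ uIcc a b, g p = g a → g q = g b → dist x y ≤ dist p q :=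
    fun p hp q hq h1 h2 => hmin (a := (p, q)) ⟨⟨hp, hq⟩, h1, h2⟩
  have hlt : ∀ p q w z : unitInterval, z ∈ uIcc p q → z ≠ q → w ∈ uIcc p z →
      dist p w < dist p q := by
    intro p q w z hz hzq hw
    have hne : (z : ℝ) ≠ q := fun h => hzq (Subtype.ext h)
    rw [Subtype.dist_eq, Subtype.dist_eq, Real.dist_eq, Real.dist_eq]
    rcases mem_uIcc.1 hz with h | h <;> rcases mem_uIcc.1 hw with h' | h' <;>
    · have h1 : (_ : ℝ) ≤ _ := h.1
      have h2 : (_ : ℝ) ≤ _ := h.2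
      have h3 : (_ : ℝ) ≤ _ := h'.1
      have h4 : (_ : ℝ) ≤ _ := h'.2
      rw [abs_lt]
      rcases abs_cases ((p : ℝ) - q) with h5 | h5 <;> rcases lt_or_gt_of_ne hne with h6 | h6 <;>
        constructor <;> linarith
  refine ⟨x, hsub hx, y, hsub hy, hgx, hgy, ?_⟩
  rintro _ ⟨z, hz, rfl⟩
  have hzab : z ∈ uIcc a b := uIcc_subset_uIcc hx hy hz
  by_contra hout
  rcases le_total (g a) (g b) with hab | hab
  · rw [uIcc_of_le hab, mem_Icc, not_and_or, not_le, not_le] at hout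
    rcases hout with hlow | hhigh
    · obtain ⟨w, hw, hgw⟩ := hIVT y z (g a) (by
        rw [hgy]; exact mem_uIcc.2 (Or.inr ⟨hlow.le, hab⟩))
      have h1 := hdist w (uIcc_subset_uIcc hy hzab hw) y hy hgw hgy
      have h2 := hlt y x w z (by rwa [uIcc_comm]) (by rintro rfl; exact hlow.ne hgx) hw
      rw [dist_comm y w, dist_comm y x] at h2
      exact absurd h1 (not_le.2 h2)
    · obtain ⟨w, hw, hgw⟩ := hIVT x z (g b) (by
        rw [hgx]; exact mem_uIcc.2 (Or.inl ⟨hab, hhigh.le⟩))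
      have h1 := hdist x hx w (uIcc_subset_uIcc hx hzab hw) hgx hgw
      have h2 := hlt x y w z hz (by rintro rfl; exact hhigh.ne' hgy) hw
      exact absurd h1 (not_le.2 h2)
  · rw [uIcc_of_ge hab, mem_Icc, not_and_or, not_le, not_le] at hout
    rcases hout with hlow | hhigh
    · obtain ⟨w, hw, hgw⟩ := hIVT x z (g b) (by
        rw [hgx]; exact mem_uIcc.2 (Or.inr ⟨hlow.le, hab⟩))
      have h1 := hdist x hx w (uIcc_subset_uIcc hx hzab hw) hgx hgw
      have h2 := hlt x y w z hz (by rintro rfl; exact hlow.ne hgy) hw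
      exact absurd h1 (not_le.2 h2)
    · obtain ⟨w, hw, hgw⟩ := hIVT y z (g a) (by
        rw [hgy]; exact mem_uIcc.2 (Or.inl ⟨hab, hhigh.le⟩))
      have h1 := hdist w (uIcc_subset_uIcc hy hzab hw) y hy hgw hgy
      have h2 := hlt y x w z (by rwa [uIcc_comm]) (by rintro rfl; exact hhigh.ne' hgx) hw
      rw [dist_comm y w, dist_comm y x] at h2
      exact absurd h1 (not_le.2 h2)

/-- Returning itineraries are carried by disjoint closed intervals. -/
theorem exists_disjoint_intervals (hc : Monotone c) (hg : Continuous g) (a : Fin m) (n : ℕ)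
    (D : Set unitInterval) (hD : D.OrdConnected) :
    ∃ P : Finset (unitInterval × unitInterval), P.card = returnCount c g a n D ∧
      (∀ p ∈ P, uIcc p.1 p.2 ⊆ D ∧ c (g^[n + 1] p.1) < a ∧ a < c (g^[n + 1] p.2)) ∧
      (P : Set (unitInterval × unitInterval)).PairwiseDisjoint fun p => uIcc p.1 p.2 := by
  classical
  have hT := ordConnected_image hg hD
  induction n generalizing D with
  | zero =>
    by_cases h : Crosses c (g '' D) a
    · obtain ⟨⟨_, ⟨x, hx, rfl⟩, hxa⟩, _, ⟨y, hy, rfl⟩, hay⟩ := h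
      refine ⟨{(x, y)}, ?_, ?_, by simp⟩
      · rw [returnCount, if_pos ⟨⟨_, ⟨x, hx, rfl⟩, hxa⟩, _, ⟨y, hy, rfl⟩, hay⟩]
        simp
      · intro p hp
        rw [Finset.mem_singleton] at hp
        subst hp
        exact ⟨hD.uIcc_subset hx hy, hxa, hay⟩
    · exact ⟨∅, by simp [returnCount, h], by simp, by simp⟩
  | succ n ih =>
    choose P hcard hP hdisj using fun b =>
      ih _ (ordConnected_cellPart hc hT b) (ordConnected_image hg (ordConnected_cellPart hc hT b))
    have hpart : ∀ b, ∀ p ∈ P b, uIcc p.1 p.2 ⊆ g '' D ∩ c ⁻¹' {b} := fun b p hp => by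
      rw [← cellPart_eq hc hT]; exact (hP b p hp).1
    let A := Finset.univ.filter fun b => admits c Finset.univ (g '' D) b ≠ 0
    have hdisjQ : ∀ b ∈ A, ∀ b' ∈ A, ∀ p ∈ P b, ∀ p' ∈ P b', p ≠ p' →
        Disjoint (uIcc p.1 p.2) (uIcc p'.1 p'.2) := by
      intro b _ b' _ p hp p' hp' hne
      by_cases hbb : b = b'
      · subst hbb
        exact hdisj b hp hp' hne
      · rw [disjoint_left]
        intro z hz hz'
        exact hbb ((hpart b p hp hz).2.symm.trans (hpart b' p' hp' hz').2)
    -- Each interval is lifted through `g` to one in `D` whose image stays inside it. Disjointness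
    -- therefore passes to the lifts, and distinct intervals have distinct lifts because `g`
    -- recovers the endpoints.
    have hex : ∀ p : unitInterval × unitInterval, (∃ b, p ∈ P b) → ∃ q : unitInterval × unitInterval,
        q.1 ∈ D ∧ q.2 ∈ D ∧ g q.1 = p.1 ∧ g q.2 = p.2 ∧ g '' uIcc q.1 q.2 ⊆ uIcc p.1 p.2 := by
      rintro p ⟨b, hp⟩
      obtain ⟨x, hx, y, hy, h1, h2, h3⟩ := exists_uIcc_image_subset hg hD
        (hpart b p hp left_mem_uIcc).1 (hpart b p hp right_mem_uIcc).1
      exact ⟨(x, y), hx, hy, h1, h2, h3⟩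
    choose! ρ hρ using hex
    have hmemQ : ∀ p ∈ A.biUnion P, ∃ b ∈ A, p ∈ P b := fun p hp => by
      obtain ⟨b, hb, hp⟩ := Finset.mem_biUnion.1 hp
      exact ⟨b, hb, hp⟩
    refine ⟨(A.biUnion P).image ρ, ?_, ?_, ?_⟩
    · rw [Finset.card_image_of_injOn, Finset.card_biUnion]
      · rw [returnCount]
        refine (Finset.sum_congr rfl fun b hb => ?_).trans (Finset.sum_filter_of_ne
          (p := fun b => admits c Finset.univ (g '' D) b ≠ 0) fun b _ hb => left_ne_zero_of_mul hb)
        have h1 : admits c Finset.univ (g '' D) b = 1 :=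
          le_antisymm (admits_le_one _ _ _ _)
            (Nat.one_le_iff_ne_zero.2 (Finset.mem_filter.1 hb).2)
        rw [h1, one_mul, hcard]
      · intro b hb b' hb' hbb
        rw [Function.onFun, Finset.disjoint_left]
        intro p hp hp'
        exact hbb ((hpart b p hp left_mem_uIcc).2.symm.trans (hpart b' p hp' left_mem_uIcc).2)
      · intro p hp q hq hpq
        obtain ⟨b, -, hp⟩ := hmemQ p hp
        obtain ⟨b', -, hq⟩ := hmemQ q hq
        obtain ⟨-, -, h1, h2, -⟩ := hρ p ⟨b, hp⟩
        obtain ⟨-, -, h3, h4, -⟩ := hρ q ⟨b', hq⟩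
        rw [hpq] at h1 h2
        exact Prod.ext (h1.symm.trans h3) (h2.symm.trans h4)
    · intro q hq
      obtain ⟨p, hp, rfl⟩ := Finset.mem_image.1 hq
      obtain ⟨b, -, hp⟩ := hmemQ p hp
      obtain ⟨h1, h2, h3, h4, -⟩ := hρ p ⟨b, hp⟩
      refine ⟨hD.uIcc_subset h1 h2, ?_, ?_⟩
      · rw [Function.iterate_succ_apply, h3]; exact (hP b p hp).2.1
      · rw [Function.iterate_succ_apply, h4]; exact (hP b p hp).2.2
    · intro q hq q' hq' hne
      obtain ⟨p, hp, rfl⟩ := Finset.mem_image.1 (Finset.mem_coe.1 hq)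
      obtain ⟨p', hp', rfl⟩ := Finset.mem_image.1 (Finset.mem_coe.1 hq')
      obtain ⟨b, hb, hp⟩ := hmemQ p hp
      obtain ⟨b', hb', hp'⟩ := hmemQ p' hp'
      have hpp : p ≠ p' := fun h => hne (by rw [h])
      have := hdisjQ b hb b' hb' p hp p' hp' hpp
      rw [Function.onFun, disjoint_left]
      intro z hz hz'
      exact disjoint_left.1 this ((hρ p ⟨b, hp⟩).2.2.2.2 (mem_image_of_mem g hz))
        ((hρ p' ⟨b', hp'⟩).2.2.2.2 (mem_image_of_mem g hz'))

end Intervals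

/-! ### Misiurewicz's theorem -/

section Horseshoe

/-- Every point of `unitInterval` lies in a cell of a partition into small intervals. -/
theorem exists_monotone_partition {𝒱 : Set (Set unitInterval)} (hopen : ∀ V ∈ 𝒱, IsOpen V)
    (hcov : univ ⊆ ⋃₀ 𝒱) :
    ∃ (m : ℕ) (c : unitInterval → Fin m), Monotone c ∧ ∀ b, ∃ V ∈ 𝒱, c ⁻¹' {b} ⊆ V := by
  obtain ⟨δ, hδ, hball⟩ := lebesgue_number_lemma_of_metric_sUnion isCompact_univ hopen hcov
  obtain ⟨m, hm⟩ := exists_nat_gt (1 / δ)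
  have hm0 : (0 : ℝ) < m := lt_trans (by positivity) hm
  have hlt : ∀ x : unitInterval, ⌊(m : ℝ) * x⌋₊ < m + 1 := by
    intro x
    refine Nat.lt_succ_of_le (Nat.floor_le_of_le ?_)
    exact mul_le_of_le_one_right hm0.le x.2.2
  -- There are `m + 1` cells because the floor takes the value `m` at `x = 1`. Points of one cell
  -- are less than `1 / m < δ` apart.
  refine ⟨m + 1, fun x => ⟨⌊(m : ℝ) * x⌋₊, hlt x⟩, fun x y hxy => ?_, fun b => ?_⟩
  · exact Nat.floor_le_floor (mul_le_mul_of_nonneg_left (by exact_mod_cast hxy) hm0.le)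
  · rcases ((fun x : unitInterval => (⟨⌊(m : ℝ) * x⌋₊, hlt x⟩ : Fin (m + 1))) ⁻¹'
      {b}).eq_empty_or_nonempty with h | ⟨x, hx⟩
    · obtain ⟨V, hV, -⟩ := hcov (mem_univ (0 : unitInterval))
      exact ⟨V, hV, by rw [h]; exact empty_subset _⟩
    · obtain ⟨V, hV, hxV⟩ := hball x (mem_univ x)
      refine ⟨V, hV, fun y hy => hxV ?_⟩
      have h : ⌊(m : ℝ) * y⌋₊ = ⌊(m : ℝ) * x⌋₊ := congrArg Fin.val (hy.trans hx.symm)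
      rw [Metric.mem_ball, Subtype.dist_eq, Real.dist_eq]
      have h1 := Nat.floor_le (mul_nonneg hm0.le x.2.1)
      have h2 := Nat.floor_le (mul_nonneg hm0.le y.2.1)
      have h3 := Nat.lt_floor_add_one ((m : ℝ) * x)
      have h4 := Nat.lt_floor_add_one ((m : ℝ) * y)
      rw [h] at h2 h4
      have h5 : |(m : ℝ) * ((y : ℝ) - x)| < 1 := by
        rw [abs_lt]; constructor <;> linarith
      rw [abs_mul, abs_of_pos hm0] at h5
      have h6 : 1 < m * δ := (div_lt_iff₀ hδ).1 hm
      exact lt_of_mul_lt_mul_left (h5.trans h6) hm0.le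

/-- A strict horseshoe: pairs of points spanning disjoint intervals, each of which is stretched by
`f^[N]` strictly over all of them. -/
def IsHorseshoe (f : unitInterval → unitInterval) (N : ℕ) {s : ℕ}
    (p : Fin s → unitInterval × unitInterval) : Prop :=
  ∀ i j, (i = j ∨ max (p i).1 (p i).2 < min (p j).1 (p j).2 ∨
      max (p j).1 (p j).2 < min (p i).1 (p i).2) ∧
    f^[N] (p i).1 < min (p j).1 (p j).2 ∧ max (p j).1 (p j).2 < f^[N] (p i).2

theorem max_lt_min_or_of_disjoint {a b a' b' : unitInterval}
    (h : Disjoint (uIcc a b) (uIcc a' b')) : max a b < min a' b' ∨ max a' b' < min a b := by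
  by_contra! hcon
  refine disjoint_left.1 h (mem_Icc.2 ⟨le_max_left (min a b) (min a' b'), ?_⟩)
    (mem_Icc.2 ⟨le_max_right _ _, ?_⟩)
  · exact max_le min_le_max hcon.1
  · exact max_le hcon.2 min_le_max

theorem disjoint_uIcc_of_max_lt_min {a b a' b' : unitInterval} (h : max a b < min a' b') :
    Disjoint (uIcc a b) (uIcc a' b') :=
  disjoint_left.2 fun _ hx hx' => absurd (hx.2.trans_lt h) (not_lt.2 hx'.1)

variable {f : unitInterval → unitInterval}

/-- One letter fixes the cover elements for a block of `k` consecutive times. The letters at times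
`1, …, n` of `f^[k]` are counted by `wordCount`, and the factor `m` accounts for the letter at time
`0`. -/
theorem minCoverCard_iterJoin_le (hf : Continuous f) {𝒰 : Set (Set unitInterval)} {k m : ℕ}
    (hk : 1 ≤ k) {c : unitInterval → Fin m} (hc : Monotone c)
    (hcell : ∀ b, ∃ V ∈ iterJoin f 𝒰 k, c ⁻¹' {b} ⊆ V) (n : ℕ) :
    minCoverCard univ (iterJoin f 𝒰 (k * (n + 1))) ≤
      wordCount c f^[k] Finset.univ n univ * m := by
  classical
  obtain ⟨F, hcard, hcov, hF⟩ := exists_cover_card_le_wordCount hc (hf.iterate k) n univ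
    ordConnected_univ
  refine (minCoverCard_le ((F ×ˢ Finset.univ).image fun p => p.1 ∩ c ⁻¹' {p.2}) ?_ ?_).trans
    (Finset.card_image_le.trans ?_)
  · intro x hx
    obtain ⟨S, hS, hxS⟩ := hcov hx
    exact ⟨_, Finset.mem_coe.2 (Finset.mem_image_of_mem _
      (Finset.mk_mem_product hS (Finset.mem_univ (c x)))), hxS, rfl⟩
  · intro S hS
    obtain ⟨⟨S, b⟩, hSb, rfl⟩ := Finset.mem_image.1 hS
    have hS' := (Finset.mem_product.1 hSb).1
    have hb : ∀ l ≤ n, ∃ b', ∀ x ∈ S ∩ c ⁻¹' {b}, c (f^[k] ^[l] x) = b' := by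
      intro l hl
      rcases Nat.eq_zero_or_pos l with rfl | hl0
      · exact ⟨b, fun x hx => hx.2⟩
      · obtain ⟨b', hb'⟩ := hF S hS' l hl0 hl
        exact ⟨b', fun x hx => hb' x hx.1⟩
    have : Nonempty (Fin m) := ⟨b⟩
    choose! β hβ using hb
    choose V hV hsub using hcell
    choose U hU hUV using fun b => hV b
    -- Time `t` is the position `t % k` inside the block number `t / k`.
    refine ⟨_, ⟨fun t => U (β (t / k)) ⟨t % k, Nat.mod_lt _ hk⟩, fun t => hU _ _, rfl⟩, ?_⟩
    intro x hx
    refine mem_iInter.2 fun t => ?_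
    have ht : (t : ℕ) / k ≤ n := Nat.lt_succ_iff.1 (Nat.div_lt_of_lt_mul t.2)
    have h1 : f^[k] ^[(t : ℕ) / k] x ∈ V (β (t / k)) := hsub _ (hβ _ ht x hx)
    rw [hUV] at h1
    have h2 := mem_iInter.1 h1 ⟨t % k, Nat.mod_lt _ hk⟩
    rw [mem_preimage] at h2 ⊢
    rw [← Function.iterate_mul, ← Function.iterate_add_apply, Nat.mod_add_div] at h2
    exact h2
  · rw [Finset.card_product, Finset.card_univ, Fintype.card_fin]
    exact Nat.mul_le_mul_right _ hcard

theorem rpow_le_minCoverCard (f : unitInterval → unitInterval) {𝒰 : Set (Set unitInterval)}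
    (hfin : 𝒰.Finite) (h𝒰 : univ ⊆ ⋃₀ 𝒰) {M : ℕ} (hM : 1 ≤ M) :
    (2 : ℝ) ^ (entropyOfCover univ f 𝒰 * M) ≤ minCoverCard univ (iterJoin f 𝒰 M) := by
  obtain ⟨t, rfl⟩ := Nat.exists_eq_add_of_le' hM
  have h1 : entropyOfCover univ f 𝒰 ≤
      Real.logb 2 (minCoverCard univ (iterJoin f 𝒰 (t + 1)) : ℝ) / ((t : ℝ) + 1) :=
    ciInf_le (bddBelow_entropyOfCover univ f 𝒰) t
  have hpos : (0 : ℝ) < minCoverCard univ (iterJoin f 𝒰 (t + 1)) := by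
    exact_mod_cast minCoverCard_iterJoin_pos f hfin h𝒰 (t + 1)
  rw [le_div_iff₀ (by positivity)] at h1
  rw [← Real.le_logb_iff_rpow_le one_lt_two hpos]
  push_cast
  exact h1

/-- **Misiurewicz's theorem**: the entropy of a continuous interval map is carried by its
horseshoes. -/
theorem exists_isHorseshoe (hf : Continuous f) {𝒰 : Set (Set unitInterval)} (hfin : 𝒰.Finite)
    (hopen : ∀ U ∈ 𝒰, IsOpen U) (h𝒰 : univ ⊆ ⋃₀ 𝒰) {a : ℝ} (ha : 0 ≤ a)
    (h : a < entropyOfCover univ f 𝒰) :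
    ∃ (N s : ℕ) (p : Fin s → unitInterval × unitInterval), 1 ≤ N ∧ IsHorseshoe f N p ∧
      a * N < Real.logb 2 s := by
  set H := entropyOfCover univ f 𝒰 with hH
  obtain ⟨a', haa', ha'H⟩ := exists_between h
  have ha' : 0 < a' := ha.trans_lt haa'
  -- The choice `k * a' > 1` makes `μ = 2 ^ (k * a')` at least `2`, as the count of itineraries
  -- requires.
  obtain ⟨k, hk⟩ := exists_nat_gt (1 / a')
  have hk0 : (0 : ℝ) < k := lt_trans (by positivity) hk
  have hk1 : 1 ≤ k := by exact_mod_cast hk0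
  rw [div_lt_iff₀ ha'] at hk
  set μ : ℝ := 2 ^ (k * a') with hμ
  have hμ2 : 2 ≤ μ := by
    calc (2 : ℝ) = 2 ^ (1 : ℝ) := (Real.rpow_one 2).symm
      _ ≤ μ := Real.rpow_le_rpow_of_exponent_le one_le_two hk.le
  have hμ0 : 0 < μ := by linarith
  obtain ⟨m, c, hc, hcell⟩ := exists_monotone_partition
    (fun V hV => isOpen_of_mem_iterJoin hf hopen hV) (univ_subset_sUnion_iterJoin f h𝒰 k)
  have key : ∃ b n, μ ^ (n + 1) < (returnCount c f^[k] b n (c ⁻¹' {b}) : ℝ) := by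
    by_contra! hret
    obtain ⟨C, hC, d, hgrow⟩ := wordCount_growth c f^[k] hμ2 hret Finset.univ
    -- The covers grow at least like `2 ^ (k * H * n)`, the itineraries at most like a polynomial
    -- times `μ ^ n`. As `r > 1`, the powers of `r` cannot stay below a polynomial.
    set r : ℝ := 2 ^ (k * H) / μ with hr
    have hr1 : 1 < r := by
      rw [hr, one_lt_div hμ0]
      exact Real.rpow_lt_rpow_of_exponent_lt one_lt_two (mul_lt_mul_of_pos_left ha'H hk0)
    have hbound : ∀ n : ℕ, r ^ (n + 1) ≤ C * m * ((n + 1 : ℕ) : ℝ) ^ d := by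
      intro n
      have h1 := rpow_le_minCoverCard f hfin h𝒰 (M := k * (n + 1)) (Nat.mul_pos hk1 n.succ_pos)
      have h2 : (minCoverCard univ (iterJoin f 𝒰 (k * (n + 1))) : ℝ) ≤
          wordCount c f^[k] Finset.univ n univ * m := by
        exact_mod_cast minCoverCard_iterJoin_le hf hk1 hc hcell n
      have h3 := hgrow n univ
      have h4 : (2 : ℝ) ^ (H * ((k * (n + 1) : ℕ) : ℝ)) = (2 ^ (k * H)) ^ (n + 1) := by
        rw [← Real.rpow_natCast, ← Real.rpow_mul zero_le_two]
        push_cast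
        ring_nf
      rw [h4] at h1
      rw [hr, div_pow, div_le_iff₀ (by positivity)]
      calc _ ≤ (wordCount c f^[k] Finset.univ n univ : ℝ) * m := h1.trans h2
        _ ≤ C * (n + 1) ^ d * μ ^ n * m := by gcongr
        _ ≤ C * (n + 1) ^ d * μ ^ (n + 1) * m := by
          gcongr
          · linarith
          · omega
        _ = _ := by push_cast; ring
    have hlim := ((tendsto_pow_const_div_const_pow_of_one_lt d hr1).const_mul (C * m)).comp
      (Filter.tendsto_add_atTop_nat 1)
    rw [mul_zero] at hlim
    obtain ⟨n, hn⟩ := (hlim.eventually (gt_mem_nhds one_pos)).exists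
    have h1 := hbound n
    have h2 : 0 < r ^ (n + 1) := by positivity
    simp only [Function.comp] at hn
    rw [← mul_div_assoc, div_lt_one h2] at hn
    exact absurd h1 (not_le.2 hn)
  obtain ⟨b, n, hbn⟩ := key
  -- All these intervals lie in the cell of `b`, while the endpoints of each are sent to cells
  -- strictly below and strictly above it. Monotonicity of `c` turns this into the strict
  -- inequalities of a horseshoe.
  obtain ⟨P, hcard, hP, hdisj⟩ := exists_disjoint_intervals hc (hf.iterate k) b n (c ⁻¹' {b})
    (ordConnected_cell hc b)
  let e := P.equivFin.symm
  refine ⟨k * (n + 1), P.card, fun i => e i, Nat.mul_pos hk1 n.succ_pos,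
    fun i j => ⟨?_, ?_, ?_⟩, ?_⟩
  · by_cases hij : i = j
    · exact Or.inl hij
    · exact Or.inr (max_lt_min_or_of_disjoint
        (hdisj (e i).2 (e j).2 fun hh => hij (e.injective (Subtype.ext hh))))
  · rw [Function.iterate_mul]
    have h1 := (hP (e i) (e i).2).2.1
    refine lt_min (hc.reflect_lt ?_) (hc.reflect_lt ?_)
    · rwa [(hP (e j) (e j).2).1 left_mem_uIcc]
    · rwa [(hP (e j) (e j).2).1 right_mem_uIcc]
  · rw [Function.iterate_mul]
    have h1 := (hP (e i) (e i).2).2.2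
    refine max_lt (hc.reflect_lt ?_) (hc.reflect_lt ?_)
    · rwa [(hP (e j) (e j).2).1 left_mem_uIcc]
    · rwa [(hP (e j) (e j).2).1 right_mem_uIcc]
  · rw [← hcard] at hbn
    have h1 : Real.logb 2 (μ ^ (n + 1)) < Real.logb 2 P.card :=
      Real.logb_lt_logb one_lt_two (by positivity) hbn
    rw [Real.logb_pow, hμ, Real.logb_rpow two_pos one_lt_two.ne'] at h1
    refine lt_of_le_of_lt ?_ h1
    push_cast
    have : (0 : ℝ) ≤ k * (n + 1) := by positivity
    nlinarith [mul_le_mul_of_nonneg_right haa'.le this]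

theorem IsHorseshoe.le_topEntropy (hf : Continuous f) {N s : ℕ} (hN : 1 ≤ N)
    {p : Fin s → unitInterval × unitInterval} (h : IsHorseshoe f N p) :
    ((Real.logb 2 s / N : ℝ) : EReal) ≤ topEntropy univ f := by
  refine le_topEntropy_of_covering hN (K := fun i => uIcc (p i).1 (p i).2)
    (fun i => isCompact_uIcc.isClosed) (fun i => nonempty_uIcc) ?_ ?_
  · intro i j hij
    rcases (h i j).1 with h1 | h1 | h1
    · exact absurd h1 hij
    · exact disjoint_uIcc_of_max_lt_min h1
    · exact (disjoint_uIcc_of_max_lt_min h1).symm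
  · intro i j x hx
    refine intermediate_value_uIcc (hf.iterate N).continuousOn (mem_uIcc.2 (Or.inl ⟨?_, ?_⟩))
    · exact (h i j).2.1.le.trans hx.1
    · exact hx.2.trans (h i j).2.2.le

/-- Only strict inequalities between continuous functions of the endpoints are involved. This is
what permits moving a horseshoe to rational endpoints. -/
theorem isOpen_setOf_isHorseshoe (hf : Continuous f) (N s : ℕ) :
    IsOpen {p : Fin s → unitInterval × unitInterval | IsHorseshoe f N p} := by
  have hN := hf.iterate N
  have h1 : ∀ i : Fin s, Continuous fun p : Fin s → unitInterval × unitInterval => (p i).1 :=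
    fun i => by fun_prop
  have h2 : ∀ i : Fin s, Continuous fun p : Fin s → unitInterval × unitInterval => (p i).2 :=
    fun i => by fun_prop
  simp only [IsHorseshoe, ofPred_forall]
  refine isOpen_iInter_of_finite fun i => isOpen_iInter_of_finite fun j => ?_
  refine IsOpen.and ?_ (IsOpen.and ?_ ?_)
  · rw [ofPred_or, ofPred_or]
    exact isOpen_const.union ((isOpen_lt ((h1 i).max (h2 i)) ((h1 j).min (h2 j))).union
      (isOpen_lt ((h1 j).max (h2 j)) ((h1 i).min (h2 i))))
  · exact isOpen_lt (hN.comp (h1 i)) ((h1 j).min (h2 j))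
  · exact isOpen_lt ((h1 j).max (h2 j)) (hN.comp (h2 i))

theorem IsHorseshoe.exists_unitRat (hf : Continuous f) {N s : ℕ}
    {p : Fin s → unitInterval × unitInterval} (h : IsHorseshoe f N p) :
    ∃ k : Fin s → ℕ × ℕ, IsHorseshoe f N fun i => (unitRat (k i).1, unitRat (k i).2) := by
  have hd : DenseRange (Pi.map fun (_ : Fin s) (k : ℕ × ℕ) => Prod.map unitRat unitRat k) :=
    DenseRange.piMap fun _ => denseRange_unitRat.prodMap denseRange_unitRat
  obtain ⟨k, hk⟩ := hd.exists_mem_open (isOpen_setOf_isHorseshoe hf N s) ⟨p, h⟩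
  exact ⟨k, hk⟩

end Horseshoe

/-! ### Closure properties of semidecidable and decidable predicates -/

section Semidecidable

variable {α β : Type*} [Primcodable α] [Primcodable β]

theorem rePred_of_computable {p : α → Prop} {b : α × ℕ → Bool} (hb : Computable b)
    (h : ∀ a, p a ↔ ∃ k, b (a, k) = true) : REPred p := by
  have h1 : Partrec fun a => Nat.rfind fun k => Part.some (b (a, k)) :=
    Partrec.rfind hb.partrec
  refine h1.dom_re.of_eq fun a => ?_
  refine (Nat.rfind_dom'.trans ?_).trans (h a).symm
  constructor
  · rintro ⟨k, hk, -⟩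
    exact ⟨k, (Part.mem_some_iff.1 hk).symm⟩
  · rintro ⟨k, hk⟩
    exact ⟨k, Part.mem_some_iff.2 hk.symm, fun _ => trivial⟩

/-- Stage-wise approximation of a semidecidable predicate. -/
theorem exists_stages {p : α → Prop} (hp : REPred p) :
    ∃ b : α × ℕ → Bool, Computable b ∧ (∀ a k l, k ≤ l → b (a, k) = true → b (a, l) = true) ∧
      ∀ a, p a ↔ ∃ k, b (a, k) = true := by
  obtain ⟨c, hc⟩ := Nat.Partrec.Code.exists_code.1 hp
  -- The stage is the step bound of the bounded evaluator, which makes the approximation monotone.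
  refine ⟨fun q => (c.evaln q.2 (Encodable.encode q.1)).isSome, ?_, ?_, ?_⟩
  · have h1 : Primrec fun q : α × ℕ => c.evaln q.2 (Encodable.encode q.1) :=
      Nat.Partrec.Code.primrec_evaln.comp ((Primrec.snd.pair (Primrec.const c)).pair
        (Primrec.encode.comp Primrec.fst))
    exact (Primrec.option_isSome.comp h1).to_comp
  · intro a k l hkl h
    obtain ⟨x, hx⟩ := Option.isSome_iff_exists.1 h
    exact Option.isSome_iff_exists.2 ⟨x, Nat.Partrec.Code.evaln_mono hkl hx⟩
  · intro a
    have h1 : p a ↔ (c.eval (Encodable.encode a)).Dom := by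
      rw [hc]
      simp [Part.assert]
    rw [h1, Part.dom_iff_mem]
    simp only [Nat.Partrec.Code.evaln_complete, Option.isSome_iff_exists]
    exact exists_comm

theorem rePred_comp {p : β → Prop} (hp : REPred p) {f : α → β} (hf : Computable f) :
    REPred fun a => p (f a) :=
  Partrec.comp hp hf

theorem rePred_and {p q : α → Prop} (hp : REPred p) (hq : REPred q) :
    REPred fun a => p a ∧ q a := by
  obtain ⟨b, hb, hbm, hbp⟩ := exists_stages hp
  obtain ⟨d, hd, hdm, hdq⟩ := exists_stages hq
  refine rePred_of_computable (b := fun x => b x && d x) (Primrec.and.to_comp.comp hb hd) fun a => ?_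
  simp only [Bool.and_eq_true]
  rw [hbp, hdq]
  constructor
  · rintro ⟨⟨k, hk⟩, l, hl⟩
    exact ⟨max k l, hbm _ _ _ (le_max_left _ _) hk, hdm _ _ _ (le_max_right _ _) hl⟩
  · rintro ⟨k, hk, hk'⟩
    exact ⟨⟨k, hk⟩, k, hk'⟩

/-- Dovetailing: a single search runs over codes of pairs of a witness and a stage, and codes that
decode to no witness are rejected. -/
theorem rePred_exists {p : α × β → Prop} (hp : REPred p) : REPred fun a => ∃ x, p (a, x) := by
  obtain ⟨b, hb, -, hbp⟩ := exists_stages hp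
  have h1 : Computable fun y : (α × ℕ) × β => b ((y.1.1, y.2), y.1.2.unpair.2) :=
    hb.comp (((Computable.fst.comp Computable.fst).pair Computable.snd).pair
      (Computable.snd.comp (Computable.unpair.comp (Computable.snd.comp Computable.fst))))
  have h2 : Computable fun y : α × ℕ => (Encodable.decode (α := β) y.2.unpair.1) :=
    Computable.decode.comp (Computable.fst.comp (Computable.unpair.comp Computable.snd))
  have h3 : Computable fun y : α × ℕ => ((Encodable.decode (α := β) y.2.unpair.1).map
      fun x => b ((y.1, x), y.2.unpair.2)).getD false :=
    Computable.option_getD (Computable.option_map h2 h1.to₂) (Computable.const false)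
  refine rePred_of_computable h3 fun a => ?_
  constructor
  · rintro ⟨x, hx⟩
    obtain ⟨k, hk⟩ := (hbp _).1 hx
    refine ⟨Nat.pair (Encodable.encode x) k, ?_⟩
    simpa using hk
  · rintro ⟨k, hk⟩
    cases h : Encodable.decode (α := β) k.unpair.1 with
    | none => rw [h] at hk; simp at hk
    | some x => rw [h] at hk; exact ⟨x, (hbp _).2 ⟨_, hk⟩⟩

/-- By monotonicity, finitely many confirmations all hold at the largest of their stages, where they
can be checked by a bounded loop. -/
theorem rePred_forall_lt {p : α × ℕ → Prop} (hp : REPred p) {n : α → ℕ} (hn : Computable n) :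
    REPred fun a => ∀ i < n a, p (a, i) := by
  obtain ⟨b, hb, hbm, hbp⟩ := exists_stages hp
  have h1 : Computable fun y : (α × ℕ) × (ℕ × Bool) => y.2.2 && b ((y.1.1, y.2.1), y.1.2) :=
    Primrec.and.to_comp.comp (Computable.snd.comp Computable.snd)
      (hb.comp (((Computable.fst.comp Computable.fst).pair
        (Computable.fst.comp Computable.snd)).pair (Computable.snd.comp Computable.fst)))
  have h2 : ∀ y : α × ℕ, ∀ N, (Nat.rec true (fun i v => v && b ((y.1, i), y.2)) N : Bool) = true ↔
      ∀ i < N, b ((y.1, i), y.2) = true := by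
    intro y N
    induction N with
    | zero => simp
    | succ N ih => simp only [Bool.and_eq_true, ih, Nat.forall_lt_succ_right]
  refine rePred_of_computable (b := fun y => Nat.rec true (fun i v => v && b ((y.1, i), y.2)) (n y.1))
    (Computable.nat_rec (hn.comp Computable.fst) (Computable.const true) h1.to₂) fun a => ?_
  constructor
  · intro h
    choose! k hk using fun i hi => (hbp _).1 (h i hi)
    refine ⟨(Finset.range (n a)).sup k, (h2 (a, _) _).2 fun i hi => hbm _ _ _ ?_ (hk i hi)⟩
    exact Finset.le_sup (f := k) (Finset.mem_range.2 hi)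
  · rintro ⟨k, hk⟩ i hi
    exact (hbp _).2 ⟨k, (h2 (a, k) _).1 hk i hi⟩

theorem computablePred_comp {p : β → Prop} (hp : ComputablePred p) {f : α → β}
    (hf : Computable f) : ComputablePred fun a => p (f a) := by
  obtain ⟨b, hb, rfl⟩ := ComputablePred.computable_iff.1 hp
  exact ComputablePred.computable_iff.2 ⟨_, hb.comp hf, rfl⟩

theorem computablePred_and {p q : α → Prop} (hp : ComputablePred p) (hq : ComputablePred q) :
    ComputablePred fun a => p a ∧ q a := by
  obtain ⟨b, hb, rfl⟩ := ComputablePred.computable_iff.1 hp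
  obtain ⟨d, hd, rfl⟩ := ComputablePred.computable_iff.1 hq
  exact ComputablePred.computable_iff.2 ⟨_, Primrec.and.to_comp.comp hb hd, by simp⟩

theorem computablePred_or {p q : α → Prop} (hp : ComputablePred p) (hq : ComputablePred q) :
    ComputablePred fun a => p a ∨ q a := by
  obtain ⟨b, hb, rfl⟩ := ComputablePred.computable_iff.1 hp
  obtain ⟨d, hd, rfl⟩ := ComputablePred.computable_iff.1 hq
  exact ComputablePred.computable_iff.2 ⟨_, Primrec.or.to_comp.comp hb hd, by simp⟩

theorem computablePred_nat_lt {m n : α → ℕ} (hm : Computable m) (hn : Computable n) :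
    ComputablePred fun a => m a < n a :=
  ⟨fun _ => inferInstance, (Primrec.nat_lt.decide.to_comp.comp hm hn :)⟩

theorem computablePred_nat_le {m n : α → ℕ} (hm : Computable m) (hn : Computable n) :
    ComputablePred fun a => m a ≤ n a :=
  ⟨fun _ => inferInstance, (Primrec.nat_le.decide.to_comp.comp hm hn :)⟩

theorem computable_ite {p : α → Prop} [DecidablePred p] (hp : ComputablePred p) {f g : α → β}
    (hf : Computable f) (hg : Computable g) : Computable fun a => if p a then f a else g a := by
  obtain ⟨b, hb, h⟩ := ComputablePred.computable_iff.1 hp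
  refine (Computable.cond hb hf hg).of_eq fun a => ?_
  have h1 : p a ↔ b a = true := by rw [h]
  by_cases h2 : p a
  · rw [if_pos h2, h1.1 h2, cond_true]
  · have h3 : b a = false := by rw [← Bool.not_eq_true]; exact fun h => h2 (h1.2 h)
    rw [if_neg h2, h3, cond_false]

end Semidecidable

/-! ### Computable arithmetic of natural numbers -/

section NatArithmetic

variable {α : Type*} [Primcodable α] {m n : α → ℕ}

theorem computable_add (hm : Computable m) (hn : Computable n) : Computable fun a => m a + n a :=
  Primrec.nat_add.to_comp.comp hm hn

theorem computable_sub (hm : Computable m) (hn : Computable n) : Computable fun a => m a - n a :=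
  Primrec.nat_sub.to_comp.comp hm hn

theorem computable_mul (hm : Computable m) (hn : Computable n) : Computable fun a => m a * n a :=
  Primrec.nat_mul.to_comp.comp hm hn

theorem computable_div (hm : Computable m) (hn : Computable n) : Computable fun a => m a / n a :=
  Primrec.nat_div.to_comp.comp hm hn

theorem computable_min (hm : Computable m) (hn : Computable n) :
    Computable fun a => min (m a) (n a) :=
  Primrec.nat_min.to_comp.comp hm hn

theorem computable_pow (hm : Computable m) (hn : Computable n) : Computable fun a => m a ^ n a := by
  have h : Primrec₂ fun x y : ℕ => x ^ y :=
    Primrec₂.unpaired'.1 Nat.Primrec.pow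
  exact h.to_comp.comp hm hn

theorem computable_unpair_fst (hm : Computable m) : Computable fun a => (m a).unpair.1 :=
  Computable.fst.comp (Computable.unpair.comp hm)

theorem computable_unpair_snd (hm : Computable m) : Computable fun a => (m a).unpair.2 :=
  Computable.snd.comp (Computable.unpair.comp hm)

theorem computable_natPair (hm : Computable m) (hn : Computable n) :
    Computable fun a => Nat.pair (m a) (n a) :=
  Primrec₂.natPair.to_comp.comp hm hn

end NatArithmetic

/-! ### Computable families of rationals -/

section RatComputable

variable {α β : Type*} [Primcodable α] [Primcodable β]

/-- A family of reals is rational-computable if its members are rationals whose numbers are output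
by an algorithm. -/
def RatComputable (r : α → ℝ) : Prop :=
  ∃ g : α → ℕ, Computable g ∧ ∀ a, r a = ((ratOfNat (g a) : ℚ) : ℝ)

/-- In this form operations and comparisons become arithmetic of natural numbers, with no reduced
fractions and no signs. -/
theorem ratComputable_iff {r : α → ℝ} :
    RatComputable r ↔ ∃ A B C : α → ℕ, Computable A ∧ Computable B ∧ Computable C ∧
      ∀ a, r a = ((A a : ℝ) - B a) / ((C a : ℝ) + 1) := by
  constructor
  · rintro ⟨g, hg, h⟩
    refine ⟨_, _, _, computable_unpair_fst hg, computable_unpair_fst (computable_unpair_snd hg),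
      computable_unpair_snd (computable_unpair_snd hg), fun a => ?_⟩
    rw [h, ratOfNat]
    push_cast
    rfl
  · rintro ⟨A, B, C, hA, hB, hC, h⟩
    refine ⟨_, computable_natPair hA (computable_natPair hB hC), fun a => ?_⟩
    rw [h, ratOfNat]
    simp

theorem RatComputable.of_eq {r s : α → ℝ} (hr : RatComputable r) (h : ∀ a, r a = s a) :
    RatComputable s :=
  (funext h : r = s) ▸ hr

theorem RatComputable.comp {r : β → ℝ} (hr : RatComputable r) {f : α → β} (hf : Computable f) :
    RatComputable fun a => r (f a) := by
  obtain ⟨g, hg, h⟩ := hr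
  exact ⟨_, hg.comp hf, fun a => h (f a)⟩

theorem ratComputable_natCast {n : α → ℕ} (hn : Computable n) :
    RatComputable fun a => (n a : ℝ) :=
  ratComputable_iff.2 ⟨n, fun _ => 0, fun _ => 0, hn, Computable.const 0, Computable.const 0,
    fun a => by simp⟩

theorem ratComputable_nat (n : ℕ) : RatComputable fun _ : α => (n : ℝ) :=
  ratComputable_natCast (Computable.const n)

theorem ratComputable_one : RatComputable fun _ : α => (1 : ℝ) := by
  simpa using ratComputable_nat (α := α) 1

theorem ratComputable_ofNat (n : ℕ) [n.AtLeastTwo] :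
    RatComputable fun _ : α => (OfNat.ofNat n : ℝ) :=
  ratComputable_nat (OfNat.ofNat n)

theorem RatComputable.add {r s : α → ℝ} (hr : RatComputable r) (hs : RatComputable s) :
    RatComputable fun a => r a + s a := by
  obtain ⟨A, B, C, hA, hB, hC, h⟩ := ratComputable_iff.1 hr
  obtain ⟨A', B', C', hA', hB', hC', h'⟩ := ratComputable_iff.1 hs
  have hC1 := Computable.succ.comp hC
  have hC1' := Computable.succ.comp hC'
  refine ratComputable_iff.2 ⟨_, _, _, computable_add (computable_mul hA hC1')
    (computable_mul hA' hC1), computable_add (computable_mul hB hC1') (computable_mul hB' hC1),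
    computable_sub (computable_mul hC1 hC1') (Computable.const 1), fun a => ?_⟩
  have h1 : ((((C a).succ * (C' a).succ - 1 : ℕ) : ℝ)) + 1 = ((C a : ℝ) + 1) * ((C' a : ℝ) + 1) := by
    rw [Nat.cast_sub (Nat.mul_pos (Nat.succ_pos _) (Nat.succ_pos _))]
    push_cast
    ring
  rw [h1, h, h']
  push_cast
  field_simp
  ring

theorem RatComputable.neg {r : α → ℝ} (hr : RatComputable r) : RatComputable fun a => -r a := by
  obtain ⟨A, B, C, hA, hB, hC, h⟩ := ratComputable_iff.1 hr
  exact ratComputable_iff.2 ⟨B, A, C, hB, hA, hC, fun a => by rw [h]; ring⟩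

theorem RatComputable.sub {r s : α → ℝ} (hr : RatComputable r) (hs : RatComputable s) :
    RatComputable fun a => r a - s a :=
  (hr.add hs.neg).of_eq fun _ => (sub_eq_add_neg _ _).symm

theorem RatComputable.mul {r s : α → ℝ} (hr : RatComputable r) (hs : RatComputable s) :
    RatComputable fun a => r a * s a := by
  obtain ⟨A, B, C, hA, hB, hC, h⟩ := ratComputable_iff.1 hr
  obtain ⟨A', B', C', hA', hB', hC', h'⟩ := ratComputable_iff.1 hs
  have hC1 := Computable.succ.comp hC
  have hC1' := Computable.succ.comp hC'
  refine ratComputable_iff.2 ⟨_, _, _, computable_add (computable_mul hA hA')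
    (computable_mul hB hB'), computable_add (computable_mul hA hB') (computable_mul hB hA'),
    computable_sub (computable_mul hC1 hC1') (Computable.const 1), fun a => ?_⟩
  have h1 : ((((C a).succ * (C' a).succ - 1 : ℕ) : ℝ)) + 1 = ((C a : ℝ) + 1) * ((C' a : ℝ) + 1) := by
    rw [Nat.cast_sub (Nat.mul_pos (Nat.succ_pos _) (Nat.succ_pos _))]
    push_cast
    ring
  rw [h1, h, h']
  push_cast
  field_simp
  ring

theorem RatComputable.inv {r : α → ℝ} (hr : RatComputable r) (h0 : ∀ a, 0 ≤ r a) :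
    RatComputable fun a => (r a)⁻¹ := by
  obtain ⟨A, B, C, hA, hB, hC, h⟩ := ratComputable_iff.1 hr
  have hAB := computable_sub hA hB
  -- The factor `min 1 (A - B)` is `1` when `r a > 0` and `0` when `r a = 0`, in accordance with
  -- `0⁻¹ = 0`.
  refine ratComputable_iff.2 ⟨_, _, _, computable_mul (Computable.succ.comp hC)
    (computable_min (Computable.const 1) hAB), Computable.const 0,
    computable_sub hAB (Computable.const 1), fun a => ?_⟩
  have h2 := h0 a
  have hpos : (0 : ℝ) < (C a : ℝ) + 1 := by positivity
  rw [h] at h2 ⊢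
  have h3 : (B a : ℝ) ≤ A a := by
    rw [div_nonneg_iff] at h2
    rcases h2 with h2 | h2 <;> linarith
  have h4 : B a ≤ A a := by exact_mod_cast h3
  rcases h4.eq_or_lt with h5 | h5
  · simp [h5]
  · have h6 : 1 ≤ A a - B a := by omega
    rw [min_eq_left h6, Nat.cast_sub h6, Nat.cast_sub h4]
    push_cast
    rw [inv_div]
    ring_nf

theorem RatComputable.div {r s : α → ℝ} (hr : RatComputable r) (hs : RatComputable s)
    (h0 : ∀ a, 0 ≤ s a) : RatComputable fun a => r a / s a :=
  (hr.mul (hs.inv h0)).of_eq fun _ => (div_eq_mul_inv _ _).symm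

/-- Truncated subtraction and integer division give the floor; both sides are `0` on negative
values. -/
theorem RatComputable.nat_floor {r : α → ℝ} (hr : RatComputable r) :
    Computable fun a => ⌊r a⌋₊ := by
  obtain ⟨A, B, C, hA, hB, hC, h⟩ := ratComputable_iff.1 hr
  refine (computable_div (computable_sub hA hB) (Computable.succ.comp hC)).of_eq fun a => ?_
  rw [h]
  rcases le_total (B a) (A a) with h1 | h1
  · rw [← Nat.cast_sub h1, ← Nat.cast_succ, Nat.floor_div_natCast, Nat.floor_natCast]
  · rw [Nat.sub_eq_zero_of_le h1, Nat.zero_div, eq_comm, Nat.floor_eq_zero]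
    have h2 : (A a : ℝ) ≤ B a := by exact_mod_cast h1
    exact (div_nonpos_of_nonpos_of_nonneg (by linarith) (by positivity)).trans_lt one_pos

theorem RatComputable.lt {r s : α → ℝ} (hr : RatComputable r) (hs : RatComputable s) :
    ComputablePred fun a => r a < s a := by
  obtain ⟨A, B, C, hA, hB, hC, h⟩ := ratComputable_iff.1 hr
  obtain ⟨A', B', C', hA', hB', hC', h'⟩ := ratComputable_iff.1 hs
  have hC1 := Computable.succ.comp hC
  have hC1' := Computable.succ.comp hC'
  refine (computablePred_nat_lt
    (computable_add (computable_mul hA hC1') (computable_mul hB' hC1))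
    (computable_add (computable_mul hA' hC1) (computable_mul hB hC1'))).of_eq fun a => ?_
  rw [h, h', div_lt_div_iff₀ (by positivity) (by positivity), ← Nat.cast_lt (α := ℝ)]
  push_cast
  constructor <;> intro _ <;> linarith

theorem RatComputable.le {r s : α → ℝ} (hr : RatComputable r) (hs : RatComputable s) :
    ComputablePred fun a => r a ≤ s a :=
  (hs.lt hr).not.of_eq fun _ => not_lt

theorem RatComputable.ite {p : α → Prop} [DecidablePred p] (hp : ComputablePred p) {r s : α → ℝ}
    (hr : RatComputable r) (hs : RatComputable s) :
    RatComputable fun a => if p a then r a else s a := by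
  obtain ⟨f, hf, h⟩ := hr
  obtain ⟨g, hg, h'⟩ := hs
  refine ⟨_, computable_ite hp hf hg, fun a => ?_⟩
  dsimp only
  split_ifs
  · exact h a
  · exact h' a

theorem RatComputable.max {r s : α → ℝ} (hr : RatComputable r) (hs : RatComputable s) :
    RatComputable fun a => max (r a) (s a) := by
  classical
  exact (RatComputable.ite (hr.le hs) hs hr).of_eq fun _ => (max_def _ _).symm

theorem RatComputable.abs {r : α → ℝ} (hr : RatComputable r) : RatComputable fun a => |r a| :=
  hr.max hr.neg

theorem ratComputable_code {g : α → ℕ} (hg : Computable g) :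
    RatComputable fun a => ((ratOfNat (g a) : ℚ) : ℝ) :=
  ⟨g, hg, fun _ => rfl⟩

/-- The recursion runs on codes of rationals, so the step has to be computable from an arbitrary
code of the preceding value. -/
theorem RatComputable.nat_rec {n : α → ℕ} {r : α → ℝ} {s : α → ℕ → ℝ → ℝ} (hn : Computable n)
    (hr : RatComputable r)
    (hs : RatComputable fun p : α × (ℕ × ℕ) => s p.1 p.2.1 ((ratOfNat p.2.2 : ℚ) : ℝ)) :
    RatComputable fun a => (Nat.rec (r a) (fun i y => s a i y) (n a) : ℝ) := by
  obtain ⟨f, hf, h⟩ := hr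
  obtain ⟨g, hg, h'⟩ := hs
  refine ⟨_, Computable.nat_rec hn hf hg.to₂, fun a => ?_⟩
  dsimp only
  induction n a with
  | zero => exact h a
  | succ k ih => exact (congrArg (s a k) ih).trans (h' (a, (k, _)))

theorem ratComputable_unitRat : RatComputable fun i : ℕ => ((unitRat i : unitInterval) : ℝ) := by
  have h1 : Computable fun i : ℕ => i.unpair.1 := computable_unpair_fst Computable.id
  have h2 : Computable fun i : ℕ => i.unpair.2 + 1 :=
    Computable.succ.comp (computable_unpair_snd Computable.id)
  exact (ratComputable_natCast (computable_min h1 h2)).div (ratComputable_natCast h2)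
    fun _ => Nat.cast_nonneg _

theorem ratComputable_posRat : RatComputable fun i : ℕ => ((posRatOfNat i : ℚ) : ℝ) := by
  have h1 : Computable fun i : ℕ => i.unpair.1 := computable_unpair_fst Computable.id
  have h2 : Computable fun i : ℕ => i.unpair.2 := computable_unpair_snd Computable.id
  refine ratComputable_iff.2 ⟨_, _, _, Computable.succ.comp h1, Computable.const 0, h2, fun i => ?_⟩
  simp [posRatOfNat]

theorem posRatOfNat_pair_zero (b : ℕ) : ((posRatOfNat (Nat.pair 0 b) : ℚ) : ℝ) = 1 / ((b : ℝ) + 1) := by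
  simp [posRatOfNat]

end RatComputable

/-! ### Semidecidability of strict inequalities along orbits -/

section UpperSemicomputability

theorem mem_idealBall_unit {x : unitInterval} {m : ℕ} :
    x ∈ unitIntervalMetric.idealBall m ↔
      |(x : ℝ) - unitRat m.unpair.1| < ((posRatOfNat m.unpair.2 : ℚ) : ℝ) :=
  Iff.rfl

theorem exists_idealBall_subset (y : unitInterval) {ε : ℝ} (hε : 0 < ε) :
    ∃ m, y ∈ unitIntervalMetric.idealBall m ∧
      |(y : ℝ) - unitRat m.unpair.1| + ((posRatOfNat m.unpair.2 : ℚ) : ℝ) < ε := by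
  obtain ⟨b, hb⟩ := exists_nat_one_div_lt (half_pos hε)
  obtain ⟨i, hi⟩ := denseRange_unitRat.exists_dist_lt y (Nat.one_div_pos_of_nat (α := ℝ) (n := b))
  rw [Subtype.dist_eq, Real.dist_eq] at hi
  refine ⟨Nat.pair i (Nat.pair 0 b), ?_, ?_⟩
  · rw [mem_idealBall_unit, Nat.unpair_pair, posRatOfNat_pair_zero]
    exact hi
  · rw [Nat.unpair_pair, posRatOfNat_pair_zero]
    linarith

theorem continuous_of_isComputableMap {f : unitInterval → unitInterval}
    (hf : IsComputableMap unitIntervalMetric unitIntervalMetric f) : Continuous f := by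
  obtain ⟨I, -, hI⟩ := hf
  rw [Metric.continuous_iff']
  intro x ε hε
  obtain ⟨m, hm, hmε⟩ := exists_idealBall_subset (f x) hε
  have hopen : IsOpen (f ⁻¹' unitIntervalMetric.idealBall m) := by
    rw [hI]
    exact isOpen_biUnion fun n _ => Metric.isOpen_ball
  filter_upwards [hopen.mem_nhds hm] with y hy
  rw [mem_preimage, mem_idealBall_unit] at hy
  rw [Subtype.dist_eq, Real.dist_eq]
  calc |((f y : unitInterval) : ℝ) - f x|
      ≤ |((f y : unitInterval) : ℝ) - unitRat m.unpair.1| +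
        |((unitRat m.unpair.1 : unitInterval) : ℝ) - f x| := abs_sub_le _ _ _
    _ < ε := by rw [abs_sub_comm ((unitRat m.unpair.1 : unitInterval) : ℝ)]; linarith

theorem computablePred_mem_idealBall :
    ComputablePred fun p : ℕ × ℕ => unitRat p.1 ∈ unitIntervalMetric.idealBall p.2 := by
  have h1 : RatComputable fun p : ℕ × ℕ => ((unitRat p.1 : unitInterval) : ℝ) :=
    ratComputable_unitRat.comp Computable.fst
  have h2 : RatComputable fun p : ℕ × ℕ => ((unitRat p.2.unpair.1 : unitInterval) : ℝ) :=
    ratComputable_unitRat.comp (computable_unpair_fst Computable.snd)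
  have h3 : RatComputable fun p : ℕ × ℕ => ((posRatOfNat p.2.unpair.2 : ℚ) : ℝ) :=
    ratComputable_posRat.comp (computable_unpair_snd Computable.snd)
  exact (h1.sub h2).abs.lt h3

/-- The list is a finite certificate: a chain of balls, each enumerated in the preimage of the one
before it, the last containing `x`. Missing entries read as `0`, itself the index of a ball, so no
condition on the length is needed. -/
theorem iterate_mem_idealBall_iff {f : unitInterval → unitInterval} {I : ℕ → Set ℕ}
    (hI : ∀ m, f ⁻¹' unitIntervalMetric.idealBall m = ⋃ n ∈ I m, unitIntervalMetric.idealBall n)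
    (N : ℕ) (x : unitInterval) (m : ℕ) :
    f^[N] x ∈ unitIntervalMetric.idealBall m ↔ ∃ L : List ℕ, L.getD 0 0 = m ∧
      (∀ k < N, L.getD (k + 1) 0 ∈ I (L.getD k 0)) ∧
      x ∈ unitIntervalMetric.idealBall (L.getD N 0) := by
  induction N generalizing m with
  | zero =>
    constructor
    · exact fun h => ⟨[m], rfl, by simp, h⟩
    · rintro ⟨L, rfl, -, h⟩
      exact h
  | succ N ih =>
    have h1 : f^[N + 1] x ∈ unitIntervalMetric.idealBall m ↔
        ∃ n ∈ I m, f^[N] x ∈ unitIntervalMetric.idealBall n := by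
      rw [Function.iterate_succ_apply', ← mem_preimage, hI]
      simp
    rw [h1]
    constructor
    · rintro ⟨n, hn, h⟩
      obtain ⟨L, rfl, hL, hx⟩ := (ih n).1 h
      refine ⟨m :: L, rfl, fun k hk => ?_, hx⟩
      cases k with
      | zero => exact hn
      | succ k => exact hL k (by omega)
    · rintro ⟨L, rfl, hL, hx⟩
      have h2 : ∀ k, L.tail.getD k 0 = L.getD (k + 1) 0 := by
        intro k
        cases L <;> simp
      refine ⟨_, hL 0 N.succ_pos, (ih _).2 ⟨L.tail, h2 0, fun k hk => ?_, ?_⟩⟩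
      · rw [h2, h2]
        exact hL (k + 1) (by omega)
      · rwa [h2]

theorem computable_getD {α : Type*} [Primcodable α] {L : α → List ℕ} {n : α → ℕ}
    (hL : Computable L) (hn : Computable n) : Computable fun a => (L a).getD (n a) 0 :=
  (Primrec.list_getD 0).to_comp.comp hL hn

theorem rePred_iterate_mem_idealBall {f : unitInterval → unitInterval}
    (hf : IsComputableMap unitIntervalMetric unitIntervalMetric f) :
    REPred fun p : (ℕ × ℕ) × ℕ => f^[p.1.1] (unitRat p.1.2) ∈ unitIntervalMetric.idealBall p.2 := by
  obtain ⟨I, hre, hI⟩ := hf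
  have h1 : REPred fun q : ((ℕ × ℕ) × ℕ) × List ℕ => q.2.getD 0 0 = q.1.2 ∧
      (∀ k < q.1.1.1, q.2.getD (k + 1) 0 ∈ I (q.2.getD k 0)) ∧
      unitRat q.1.1.2 ∈ unitIntervalMetric.idealBall (q.2.getD q.1.1.1 0) := by
    have hN : Computable fun q : ((ℕ × ℕ) × ℕ) × List ℕ => q.1.1.1 :=
      Computable.fst.comp (Computable.fst.comp Computable.fst)
    have hx : Computable fun q : ((ℕ × ℕ) × ℕ) × List ℕ => q.1.1.2 :=
      Computable.snd.comp (Computable.fst.comp Computable.fst)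
    have hm : Computable fun q : ((ℕ × ℕ) × ℕ) × List ℕ => q.1.2 :=
      Computable.snd.comp Computable.fst
    have h0 := computable_getD (Computable.snd (α := (ℕ × ℕ) × ℕ) (β := List ℕ))
      (Computable.const 0)
    refine rePred_and (ComputablePred.to_re ?_) (rePred_and (rePred_forall_lt
      (p := fun w : (((ℕ × ℕ) × ℕ) × List ℕ) × ℕ =>
        w.1.2.getD (w.2 + 1) 0 ∈ I (w.1.2.getD w.2 0)) ?_ hN) (ComputablePred.to_re ?_))
    · exact (computablePred_and (computablePred_nat_le h0 hm) (computablePred_nat_le hm h0)).of_eq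
        fun _ => le_antisymm_iff.symm
    · have hL : Computable fun w : (((ℕ × ℕ) × ℕ) × List ℕ) × ℕ => w.1.2 :=
        Computable.snd.comp Computable.fst
      have h1 := computable_getD hL Computable.snd
      have h2 := computable_getD hL (computable_add Computable.snd (Computable.const 1))
      exact (rePred_comp hre (h1.pair h2)).of_eq fun _ => Iff.rfl
    · exact (computablePred_comp computablePred_mem_idealBall
        (hx.pair (computable_getD Computable.snd hN))).of_eq fun _ => Iff.rfl
  exact (rePred_exists h1).of_eq fun p =>
    (iterate_mem_idealBall_iff hI p.1.1 (unitRat p.1.2) p.2).symm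

/-- A strict inequality is witnessed by a ball around `y` lying to the left of `z`; comparing its
right end with `z` only involves rationals when `z` is an ideal point. -/
theorem lt_iff_exists_idealBall (y z : unitInterval) :
    y < z ↔ ∃ m, y ∈ unitIntervalMetric.idealBall m ∧
      ((unitRat m.unpair.1 : unitInterval) : ℝ) + ((posRatOfNat m.unpair.2 : ℚ) : ℝ) ≤ z := by
  constructor
  · intro h
    have h' : (y : ℝ) < z := h
    obtain ⟨m, hm, hε⟩ := exists_idealBall_subset y (sub_pos.2 h')
    refine ⟨m, hm, ?_⟩
    have := neg_abs_le ((y : ℝ) - unitRat m.unpair.1)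
    linarith
  · rintro ⟨m, hm, hz⟩
    rw [mem_idealBall_unit, abs_lt] at hm
    have : (y : ℝ) < z := by linarith
    exact this

theorem gt_iff_exists_idealBall (y z : unitInterval) :
    z < y ↔ ∃ m, y ∈ unitIntervalMetric.idealBall m ∧
      (z : ℝ) ≤ ((unitRat m.unpair.1 : unitInterval) : ℝ) - ((posRatOfNat m.unpair.2 : ℚ) : ℝ) := by
  constructor
  · intro h
    have h' : (z : ℝ) < y := h
    obtain ⟨m, hm, hε⟩ := exists_idealBall_subset y (sub_pos.2 h')
    refine ⟨m, hm, ?_⟩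
    have := le_abs_self ((y : ℝ) - unitRat m.unpair.1)
    linarith
  · rintro ⟨m, hm, hz⟩
    rw [mem_idealBall_unit, abs_lt] at hm
    have : (z : ℝ) < y := by linarith
    exact this

theorem rePred_iterate_lt {f : unitInterval → unitInterval}
    (hf : IsComputableMap unitIntervalMetric unitIntervalMetric f) :
    REPred fun p : (ℕ × ℕ) × ℕ => f^[p.1.1] (unitRat p.1.2) < unitRat p.2 := by
  have h1 : REPred fun q : ((ℕ × ℕ) × ℕ) × ℕ =>
      f^[q.1.1.1] (unitRat q.1.1.2) ∈ unitIntervalMetric.idealBall q.2 ∧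
      ((unitRat q.2.unpair.1 : unitInterval) : ℝ) + ((posRatOfNat q.2.unpair.2 : ℚ) : ℝ) ≤
        (unitRat q.1.2 : unitInterval) :=
    rePred_and ((rePred_comp (rePred_iterate_mem_idealBall hf)
      ((Computable.fst.comp Computable.fst).pair Computable.snd)).of_eq fun _ => Iff.rfl)
      (((ratComputable_unitRat.comp (computable_unpair_fst Computable.snd)).add
        (ratComputable_posRat.comp (computable_unpair_snd Computable.snd))).le
        (ratComputable_unitRat.comp (Computable.snd.comp Computable.fst))).to_re
  exact (rePred_exists h1).of_eq fun p =>
    (lt_iff_exists_idealBall (f^[p.1.1] (unitRat p.1.2)) (unitRat p.2)).symm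

theorem rePred_lt_iterate {f : unitInterval → unitInterval}
    (hf : IsComputableMap unitIntervalMetric unitIntervalMetric f) :
    REPred fun p : (ℕ × ℕ) × ℕ => unitRat p.2 < f^[p.1.1] (unitRat p.1.2) := by
  have h1 : REPred fun q : ((ℕ × ℕ) × ℕ) × ℕ =>
      f^[q.1.1.1] (unitRat q.1.1.2) ∈ unitIntervalMetric.idealBall q.2 ∧
      ((unitRat q.1.2 : unitInterval) : ℝ) ≤
      ((unitRat q.2.unpair.1 : unitInterval) : ℝ) - ((posRatOfNat q.2.unpair.2 : ℚ) : ℝ) :=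
    rePred_and ((rePred_comp (rePred_iterate_mem_idealBall hf)
      ((Computable.fst.comp Computable.fst).pair Computable.snd)).of_eq fun _ => Iff.rfl)
      ((ratComputable_unitRat.comp (Computable.snd.comp Computable.fst)).le
        ((ratComputable_unitRat.comp (computable_unpair_fst Computable.snd)).sub
        (ratComputable_posRat.comp (computable_unpair_snd Computable.snd)))).to_re
  exact (rePred_exists h1).of_eq fun p =>
    (gt_iff_exists_idealBall (f^[p.1.1] (unitRat p.1.2)) (unitRat p.2)).symm

/-- The pair of rational points with codes at the positions `2 i` and `2 i + 1` of a list. -/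
noncomputable def codedPair (L : List ℕ) (i : ℕ) : unitInterval × unitInterval :=
  (unitRat (L.getD (2 * i) 0), unitRat (L.getD (2 * i + 1) 0))

theorem computablePred_unitRat_lt {α : Type*} [Primcodable α] {m n : α → ℕ} (hm : Computable m)
    (hn : Computable n) : ComputablePred fun a => unitRat (m a) < unitRat (n a) :=
  ((ratComputable_unitRat.comp hm).lt (ratComputable_unitRat.comp hn)).of_eq fun _ => Iff.rfl

/-- The order relations between endpoints are decidable, the inequalities on images are
semidecidable, and there are finitely many pairs of indices. -/
theorem rePred_isHorseshoe {f : unitInterval → unitInterval}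
    (hf : IsComputableMap unitIntervalMetric unitIntervalMetric f) :
    REPred fun a : (ℕ × ℕ) × List ℕ =>
      IsHorseshoe f a.1.1 fun i : Fin a.1.2 => codedPair a.2 i := by
  let A := (ℕ × ℕ) × List ℕ
  have hN : Computable fun w : (A × ℕ) × ℕ => w.1.1.1.1 :=
    Computable.fst.comp (Computable.fst.comp (Computable.fst.comp Computable.fst))
  have hL : Computable fun w : (A × ℕ) × ℕ => w.1.1.2 :=
    Computable.snd.comp (Computable.fst.comp Computable.fst)
  have hi : Computable fun w : (A × ℕ) × ℕ => w.1.2 := Computable.snd.comp Computable.fst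
  have hj : Computable fun w : (A × ℕ) × ℕ => w.2 := Computable.snd
  have hi1 := computable_getD hL (computable_mul (Computable.const 2) hi)
  have hi2 := computable_getD hL (Computable.succ.comp (computable_mul (Computable.const 2) hi))
  have hj1 := computable_getD hL (computable_mul (Computable.const 2) hj)
  have hj2 := computable_getD hL (Computable.succ.comp (computable_mul (Computable.const 2) hj))
  have hlt := fun {m n : (A × ℕ) × ℕ → ℕ} (hm : Computable m) (hn : Computable n) =>
    computablePred_unitRat_lt hm hn
  have h1 : REPred fun w : (A × ℕ) × ℕ =>
      (w.1.2 = w.2 ∨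
        max (codedPair w.1.1.2 w.1.2).1 (codedPair w.1.1.2 w.1.2).2 <
          min (codedPair w.1.1.2 w.2).1 (codedPair w.1.1.2 w.2).2 ∨
        max (codedPair w.1.1.2 w.2).1 (codedPair w.1.1.2 w.2).2 <
          min (codedPair w.1.1.2 w.1.2).1 (codedPair w.1.1.2 w.1.2).2) ∧
      f^[w.1.1.1.1] (codedPair w.1.1.2 w.1.2).1 <
        min (codedPair w.1.1.2 w.2).1 (codedPair w.1.1.2 w.2).2 ∧
      max (codedPair w.1.1.2 w.2).1 (codedPair w.1.1.2 w.2).2 <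
        f^[w.1.1.1.1] (codedPair w.1.1.2 w.1.2).2 := by
    simp only [codedPair, max_lt_iff, lt_min_iff]
    refine rePred_and (ComputablePred.to_re (computablePred_or ?_ (computablePred_or ?_ ?_)))
      (rePred_and (rePred_and ?_ ?_) (rePred_and ?_ ?_))
    · exact (computablePred_and (computablePred_nat_le hi hj) (computablePred_nat_le hj hi)).of_eq
        fun _ => le_antisymm_iff.symm
    · exact computablePred_and (computablePred_and (hlt hi1 hj1) (hlt hi2 hj1))
        (computablePred_and (hlt hi1 hj2) (hlt hi2 hj2))
    · exact computablePred_and (computablePred_and (hlt hj1 hi1) (hlt hj2 hi1))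
        (computablePred_and (hlt hj1 hi2) (hlt hj2 hi2))
    · exact (rePred_comp (rePred_iterate_lt hf) ((hN.pair hi1).pair hj1)).of_eq fun _ => Iff.rfl
    · exact (rePred_comp (rePred_iterate_lt hf) ((hN.pair hi1).pair hj2)).of_eq fun _ => Iff.rfl
    · exact (rePred_comp (rePred_lt_iterate hf) ((hN.pair hi2).pair hj1)).of_eq fun _ => Iff.rfl
    · exact (rePred_comp (rePred_lt_iterate hf) ((hN.pair hi2).pair hj2)).of_eq fun _ => Iff.rfl
  have hs : Computable fun a : A => a.1.2 := Computable.snd.comp Computable.fst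
  have h2 := rePred_forall_lt (rePred_forall_lt h1
    (hs.comp (Computable.fst (α := A) (β := ℕ)))) hs
  refine h2.of_eq fun a => ⟨fun h i j => ?_, fun h i hi j hj => ?_⟩
  · have h3 := h i i.2 j j.2
    rw [← Fin.ext_iff] at h3
    exact h3
  · have h3 := h ⟨i, hi⟩ ⟨j, hj⟩
    rw [Fin.ext_iff] at h3
    exact h3

end UpperSemicomputability

/-! ### The entropy of a computable map is lower computable -/

section LowerComputable

theorem ratOfNat_pair_zero (p q : ℕ) :
    ((ratOfNat (Nat.pair p (Nat.pair 0 q)) : ℚ) : ℝ) = (p : ℝ) / ((q : ℝ) + 1) := by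
  simp [ratOfNat]

theorem exists_rat_between_of_nonneg {a b : ℝ} (ha : 0 ≤ a) (hab : a < b) :
    ∃ p q : ℕ, a < (p : ℝ) / ((q : ℝ) + 1) ∧ (p : ℝ) / ((q : ℝ) + 1) < b := by
  obtain ⟨r, har, hrb⟩ := exists_rat_btwn hab
  have hr : 0 ≤ r := by exact_mod_cast ha.trans har.le
  have h1 : (r : ℝ) = (r.num.toNat : ℝ) / (((r.den - 1 : ℕ) : ℝ) + 1) := by
    rw [Nat.cast_sub r.den_pos]
    have h2 : ((r.num.toNat : ℤ) : ℝ) = (r.num : ℝ) := by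
      rw [Int.toNat_of_nonneg (Rat.num_nonneg.2 hr)]
    rw [Int.cast_natCast] at h2
    rw [h2, Rat.cast_def]
    simp
  exact ⟨_, _, h1 ▸ har, h1 ▸ hrb⟩

/-- The sequence lists the non-negative rationals below `log₂ s / N` for some rational horseshoe,
each once a search has confirmed it. Horseshoes bound the entropy from below, and by Misiurewicz's
theorem they approach it. -/
theorem isLowerComputable_topEntropy {f : unitInterval → unitInterval}
    (hf : IsComputableMap unitIntervalMetric unitIntervalMetric f) :
    IsLowerComputable (topEntropy univ f) := by
  have hcont := continuous_of_isComputableMap hf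
  -- The pair `a` stands for `a.1 / (a.2 + 1)`. The inequality between powers says that this is at
  -- most `log₂ s / N`, without logarithms.
  have hre : REPred fun a : ℕ × ℕ => ∃ c : (ℕ × ℕ) × List ℕ, (1 ≤ c.1.1 ∧
      2 ^ (a.1 * c.1.1) ≤ c.1.2 ^ (a.2 + 1)) ∧
        IsHorseshoe f c.1.1 fun i : Fin c.1.2 => codedPair c.2 i := by
    have hN : Computable fun w : (ℕ × ℕ) × ((ℕ × ℕ) × List ℕ) => w.2.1.1 :=
      Computable.fst.comp (Computable.fst.comp Computable.snd)
    have hs : Computable fun w : (ℕ × ℕ) × ((ℕ × ℕ) × List ℕ) => w.2.1.2 :=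
      Computable.snd.comp (Computable.fst.comp Computable.snd)
    have hp : Computable fun w : (ℕ × ℕ) × ((ℕ × ℕ) × List ℕ) => w.1.1 :=
      Computable.fst.comp Computable.fst
    have hq : Computable fun w : (ℕ × ℕ) × ((ℕ × ℕ) × List ℕ) => w.1.2 :=
      Computable.snd.comp Computable.fst
    refine rePred_exists (p := fun w : (ℕ × ℕ) × ((ℕ × ℕ) × List ℕ) => (1 ≤ w.2.1.1 ∧
      2 ^ (w.1.1 * w.2.1.1) ≤ w.2.1.2 ^ (w.1.2 + 1)) ∧
        IsHorseshoe f w.2.1.1 fun i : Fin w.2.1.2 => codedPair w.2.2 i) ?_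
    refine rePred_and (ComputablePred.to_re (computablePred_and ?_ ?_)) ?_
    · exact computablePred_nat_le (Computable.const 1) hN
    · exact computablePred_nat_le (computable_pow (Computable.const 2) (computable_mul hp hN))
        (computable_pow hs (computable_add hq (Computable.const 1)))
    · exact rePred_comp (rePred_isHorseshoe hf) Computable.snd
  obtain ⟨b, hb, -, hbC⟩ := exists_stages hre
  -- Unconfirmed candidates output `0`, which is harmless because the entropy is non-negative.
  let g : ℕ → ℕ := fun n => cond (b ((n.unpair.1.unpair.1, n.unpair.1.unpair.2), n.unpair.2))
    (Nat.pair n.unpair.1.unpair.1 (Nat.pair 0 n.unpair.1.unpair.2)) (Nat.pair 0 (Nat.pair 0 0))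
  have hg : Computable g := by
    have h1 : Computable fun n : ℕ => n.unpair.1 := computable_unpair_fst Computable.id
    have h2 : Computable fun n : ℕ => n.unpair.2 := computable_unpair_snd Computable.id
    exact Computable.cond
      (hb.comp (((computable_unpair_fst h1).pair (computable_unpair_snd h1)).pair h2))
      (computable_natPair (computable_unpair_fst h1)
        (computable_natPair (Computable.const 0) (computable_unpair_snd h1))) (Computable.const _)
  have hgval : ∀ p q k, b ((p, q), k) = true →
      ((ratOfNat (g (Nat.pair (Nat.pair p q) k)) : ℚ) : ℝ) = (p : ℝ) / ((q : ℝ) + 1) := by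
    intro p q k hk
    rw [← ratOfNat_pair_zero]
    simp [g, hk]
  have hgcases : ∀ n, ((ratOfNat (g n) : ℚ) : ℝ) = 0 ∨ ∃ p q k, b ((p, q), k) = true ∧
      ((ratOfNat (g n) : ℚ) : ℝ) = (p : ℝ) / ((q : ℝ) + 1) := by
    intro n
    cases hk : b ((n.unpair.1.unpair.1, n.unpair.1.unpair.2), n.unpair.2) with
    | false =>
      left
      have : g n = Nat.pair 0 (Nat.pair 0 0) := by simp [g, hk]
      rw [this, ratOfNat_pair_zero]
      simp
    | true =>
      refine Or.inr ⟨_, _, _, hk, ?_⟩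
      rw [← ratOfNat_pair_zero]
      simp [g, hk]
  refine ⟨fun n => ratOfNat (g n), ⟨g, hg, fun _ => rfl⟩, le_antisymm ?_ (iSup_le fun n => ?_)⟩
  · set S : EReal := ⨆ n, (((ratOfNat (g n) : ℚ) : ℝ) : EReal) with hS
    have hle : ∀ n, (((ratOfNat (g n) : ℚ) : ℝ) : EReal) ≤ S := fun n =>
      le_iSup (fun n => (((ratOfNat (g n) : ℚ) : ℝ) : EReal)) n
    have hS0 : 0 ≤ S := by
      refine le_trans ?_ (hle 0)
      rcases hgcases 0 with h | ⟨p, q, k, -, h⟩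
      · rw [h]; exact le_rfl
      · rw [h]; exact_mod_cast (by positivity : (0 : ℝ) ≤ (p : ℝ) / ((q : ℝ) + 1))
    refine iSup₂_le fun 𝒰 h𝒰 => ?_
    by_contra! hlt
    have hSbot : S ≠ ⊥ := fun h => by rw [h] at hS0; exact absurd hS0 (by simp)
    have hStop : S ≠ ⊤ := ne_top_of_lt hlt
    lift S to ℝ using ⟨hStop, hSbot⟩ with σ
    rw [EReal.coe_lt_coe_iff] at hlt
    have hσ : 0 ≤ σ := by exact_mod_cast hS0
    obtain ⟨N, s, p, hN, hp, hlog⟩ := exists_isHorseshoe hcont h𝒰.1 h𝒰.2.1 h𝒰.2.2 hσ hlt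
    have hN0 : (0 : ℝ) < N := by exact_mod_cast hN
    rw [← lt_div_iff₀ hN0] at hlog
    obtain ⟨P, Q, h1, h2⟩ := exists_rat_between_of_nonneg hσ hlog
    obtain ⟨k, hk⟩ := hp.exists_unitRat hcont
    have hs : 0 < s := by
      rcases Nat.eq_zero_or_pos s with rfl | h
      · have h3 : (0 : ℝ) < 0 := by simpa using hσ.trans_lt hlog
        exact absurd h3 (lt_irrefl _)
      · exact h
    -- The list interleaves the codes of the endpoints, in the order in which `codedPair` reads
    -- them.
    have hC := (hbC (P, Q)).1 ⟨((N, s), (List.range (2 * s)).map fun i =>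
      if h : i / 2 < s then (if i % 2 = 0 then (k ⟨i / 2, h⟩).1 else (k ⟨i / 2, h⟩).2) else 0),
      ⟨hN, ?_⟩, ?_⟩
    · obtain ⟨l, hl⟩ := hC
      have h3 := hle (Nat.pair (Nat.pair P Q) l)
      rw [hgval P Q l hl, EReal.coe_le_coe_iff] at h3
      exact absurd h1 (not_lt.2 h3)
    · have h3 : ((2 : ℝ) ^ (P * N)) ≤ (s : ℝ) ^ (Q + 1) := by
        rw [div_lt_div_iff₀ (by positivity) hN0] at h2
        have h4 : Real.logb 2 ((2 : ℝ) ^ (P * N)) ≤ Real.logb 2 ((s : ℝ) ^ (Q + 1)) := by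
          rw [Real.logb_pow, Real.logb_pow, Real.logb_self_eq_one one_lt_two]
          push_cast
          linarith
        exact (Real.logb_le_logb one_lt_two (by positivity)
          (pow_pos (by exact_mod_cast hs) _)).1 h4
      exact_mod_cast h3
    · convert hk using 2 with i
      have hi : (i : ℕ) < s := i.2
      have e2 : (2 * (i : ℕ) + 1) / 2 = i := by omega
      have e3 : (2 * (i : ℕ) + 1) % 2 = 1 := by omega
      have e4 : 2 * (i : ℕ) < 2 * s := by omega
      have e5 : 2 * (i : ℕ) + 1 < 2 * s := by omega
      simp [codedPair, List.getD_eq_getElem?_getD, e2, e3, e4, e5]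
  · rcases hgcases n with h | ⟨p, q, k, hk, h⟩
    · rw [h]
      exact topEntropy_nonneg _ _
    · obtain ⟨⟨⟨N, s⟩, L⟩, ⟨hN, hps⟩, hL⟩ := (hbC (p, q)).2 ⟨k, hk⟩
      refine le_trans ?_ (hL.le_topEntropy hcont hN)
      rw [h, EReal.coe_le_coe_iff]
      dsimp only at hN hps ⊢
      have hN0 : (0 : ℝ) < N := by exact_mod_cast hN
      have h1 : ((2 : ℝ) ^ (p * N)) ≤ (s : ℝ) ^ (q + 1) := by exact_mod_cast hps
      have h2 := Real.logb_le_logb_of_le one_lt_two (by positivity) h1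
      rw [Real.logb_pow, Real.logb_pow, Real.logb_self_eq_one one_lt_two] at h2
      push_cast at h2
      rw [div_le_div_iff₀ (by positivity) hN0]
      linarith

end LowerComputable

/-! ### Upper bounds for entropy through growth of orbit complexity -/

section Growth

/-- `A` is covered by at most `N` sets of points whose orbits under `f` stay `δ`-close for `n`
steps. -/
def CoverBound (f : ℝ → ℝ) (A : Set ℝ) (δ : ℝ) (n : ℕ) (N : ℝ) : Prop :=
  ∃ F : Finset (Set ℝ), (F.card : ℝ) ≤ N ∧ A ⊆ ⋃₀ (F : Set (Set ℝ)) ∧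
    ∀ S ∈ F, ∀ x ∈ S, ∀ y ∈ S, ∀ k < n, |f^[k] x - f^[k] y| < δ

variable {f g : ℝ → ℝ} {A B : Set ℝ} {δ δ' : ℝ} {n n' : ℕ} {N N' : ℝ}

theorem CoverBound.mono (h : CoverBound f A δ n N) (hN : N ≤ N') : CoverBound f A δ n N' := by
  obtain ⟨F, hF, h⟩ := h
  exact ⟨F, hF.trans hN, h⟩

theorem CoverBound.union (hA : CoverBound f A δ n N) (hB : CoverBound f B δ n N') :
    CoverBound f (A ∪ B) δ n (N + N') := by
  classical
  obtain ⟨F, hF, hAF, hFδ⟩ := hA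
  obtain ⟨G, hG, hBG, hGδ⟩ := hB
  refine ⟨F ∪ G, ?_, ?_, ?_⟩
  · have h1 : ((F ∪ G).card : ℝ) ≤ F.card + G.card := by exact_mod_cast Finset.card_union_le F G
    linarith
  · rw [Finset.coe_union, sUnion_union]
    exact union_subset_union hAF hBG
  · intro S hS
    rcases Finset.mem_union.1 hS with h | h
    · exact hFδ S h
    · exact hGδ S h

/-- The cover of `B` is pulled back by `φ`; all later comparisons of complexity are instances. -/
theorem CoverBound.transfer {φ : ℝ → ℝ} (hB : CoverBound g B δ' n' N) (hφ : MapsTo φ A B)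
    (h : ∀ x ∈ A, ∀ y ∈ A, (∀ j < n', |g^[j] (φ x) - g^[j] (φ y)| < δ') →
      ∀ k < n, |f^[k] x - f^[k] y| < δ) : CoverBound f A δ n N := by
  classical
  obtain ⟨F, hF, hBF, hFδ⟩ := hB
  refine ⟨F.image fun S => A ∩ φ ⁻¹' S, ?_, ?_, ?_⟩
  · exact le_trans (by exact_mod_cast Finset.card_image_le) hF
  · intro x hx
    obtain ⟨S, hS, hxS⟩ := hBF (hφ hx)
    exact ⟨_, Finset.mem_coe.2 (Finset.mem_image_of_mem _ hS), hx, hxS⟩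
  · intro S hS x hx y hy
    obtain ⟨S, hS', rfl⟩ := Finset.mem_image.1 hS
    exact h x hx.1 y hy.1 fun j hj => hFδ S hS' _ hx.2 _ hy.2 j hj

theorem CoverBound.mono_set (hB : CoverBound f B δ n N) (hAB : A ⊆ B) : CoverBound f A δ n N :=
  hB.transfer (φ := id) hAB fun _ _ _ _ h => h

theorem coverBound_Icc_one (f : ℝ → ℝ) {a b : ℝ} (hab : a ≤ b) (hδ : 0 < δ) :
    CoverBound f (Icc a b) δ 1 ((b - a) / δ + 1) := by
  classical
  refine ⟨(Finset.range (⌊(b - a) / δ⌋₊ + 1)).image fun i =>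
    {x | a ≤ x ∧ ⌊(x - a) / δ⌋₊ = i}, ?_, ?_, ?_⟩
  · refine le_trans (Nat.cast_le.2 Finset.card_image_le) ?_
    rw [Finset.card_range]
    push_cast
    have := Nat.floor_le (div_nonneg (sub_nonneg.2 hab) hδ.le)
    linarith
  · intro x hx
    refine ⟨_, Finset.mem_coe.2 (Finset.mem_image_of_mem _ (Finset.mem_range.2
      (Nat.lt_succ_of_le (Nat.floor_le_floor (a := (x - a) / δ) ?_)))), hx.1, rfl⟩
    have := hx.2
    gcongr
  · intro S hS x hx y hy k hk
    obtain ⟨i, -, rfl⟩ := Finset.mem_image.1 hS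
    obtain rfl : k = 0 := by omega
    have h1 := Nat.floor_le (div_nonneg (sub_nonneg.2 hx.1) hδ.le)
    have h2 := Nat.lt_floor_add_one ((x - a) / δ)
    have h3 := Nat.floor_le (div_nonneg (sub_nonneg.2 hy.1) hδ.le)
    have h4 := Nat.lt_floor_add_one ((y - a) / δ)
    rw [hx.2] at h1 h2
    rw [hy.2] at h3 h4
    rw [le_div_iff₀ hδ] at h1 h3
    rw [div_lt_iff₀ hδ] at h2 h4
    simp only [Function.iterate_zero, id]
    rw [abs_lt]
    constructor <;> linarith

/-- Orbit segments of length `n` starting in `A` have complexity at most `μ ^ n`, up to a polynomial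
factor, at every scale. -/
def Grows (f : ℝ → ℝ) (A : Set ℝ) (μ : ℝ) : Prop :=
  ∀ δ > 0, ∃ C : ℝ, 0 ≤ C ∧ ∃ d : ℕ, ∀ n : ℕ, CoverBound f A δ n (C * (n + 1) ^ d * μ ^ n)

variable {μ μ' : ℝ}

theorem Grows.mono_rate (h : Grows f A μ) (h0 : 0 ≤ μ) (hμ : μ ≤ μ') : Grows f A μ' := by
  intro δ hδ
  obtain ⟨C, hC, d, h⟩ := h δ hδ
  exact ⟨C, hC, d, fun n => (h n).mono (by gcongr)⟩

theorem Grows.mono_set (h : Grows f B μ) (hAB : A ⊆ B) : Grows f A μ := by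
  intro δ hδ
  obtain ⟨C, hC, d, h⟩ := h δ hδ
  exact ⟨C, hC, d, fun n => (h n).mono_set hAB⟩

theorem Grows.union (hA : Grows f A μ) (hB : Grows f B μ) (hμ : 0 ≤ μ) : Grows f (A ∪ B) μ := by
  intro δ hδ
  obtain ⟨C, hC, d, hA⟩ := hA δ hδ
  obtain ⟨C', hC', d', hB⟩ := hB δ hδ
  refine ⟨C + C', add_nonneg hC hC', max d d', fun n => ((hA n).union (hB n)).mono ?_⟩
  have hn : (1 : ℝ) ≤ (n : ℝ) + 1 := by linarith [Nat.cast_nonneg (α := ℝ) n]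
  have h1 : ((n : ℝ) + 1) ^ d ≤ ((n : ℝ) + 1) ^ max d d' := pow_le_pow_right₀ hn (le_max_left _ _)
  have h2 : ((n : ℝ) + 1) ^ d' ≤ ((n : ℝ) + 1) ^ max d d' := pow_le_pow_right₀ hn (le_max_right _ _)
  rw [add_mul, add_mul]
  gcongr

/-- Comparison along a map that does not shrink the distances between orbits. -/
theorem Grows.of_dist_le {φ : ℝ → ℝ} (hB : Grows g B μ) (hφ : MapsTo φ A B)
    (h : ∀ x ∈ A, ∀ y ∈ A, ∀ k, |f^[k] x - f^[k] y| ≤ |g^[k] (φ x) - g^[k] (φ y)|) :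
    Grows f A μ := by
  intro δ hδ
  obtain ⟨C, hC, d, hB⟩ := hB δ hδ
  exact ⟨C, hC, d, fun n => (hB n).transfer hφ fun x hx y hy hj k hk =>
    (h x hx y hy k).trans_lt (hj k hk)⟩

/-- Comparison with a map that runs at half the speed. -/
theorem Grows.of_dist_le_half {φ : ℝ → ℝ} (hB : Grows g B (μ ^ 2)) (hμ : 1 ≤ μ) (hφ : MapsTo φ A B)
    (h : ∀ x ∈ A, ∀ y ∈ A, ∀ k,
      |f^[k] x - f^[k] y| ≤ |g^[(k + 1) / 2] (φ x) - g^[(k + 1) / 2] (φ y)|) :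
    Grows f A μ := by
  intro δ hδ
  obtain ⟨C, hC, d, hB⟩ := hB δ hδ
  -- The times `(k + 1) / 2` with `k < n` are less than `n / 2 + 1`, so `n / 2 + 1` steps of `g`
  -- suffice. The factor `μ ^ 2` absorbs the rounding and `2 ^ d` the shift in the polynomial.
  refine ⟨C * 2 ^ d * μ ^ 2, by positivity, d, fun n => ?_⟩
  refine ((hB (n / 2 + 1)).transfer hφ fun x hx y hy hj k hk =>
    (h x hx y hy k).trans_lt (hj _ (by omega))).mono ?_
  have h1 : (((n / 2 + 1 : ℕ) : ℝ) + 1) ≤ 2 * ((n : ℝ) + 1) := by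
    have : n / 2 + 1 + 1 ≤ 2 * (n + 1) := by omega
    exact_mod_cast this
  calc C * (((n / 2 + 1 : ℕ) : ℝ) + 1) ^ d * (μ ^ 2) ^ (n / 2 + 1)
      ≤ C * (2 * ((n : ℝ) + 1)) ^ d * (μ ^ 2) ^ (n / 2 + 1) := by gcongr
    _ = C * (2 * ((n : ℝ) + 1)) ^ d * μ ^ (2 * (n / 2 + 1)) := by rw [pow_mul]
    _ ≤ C * (2 * ((n : ℝ) + 1)) ^ d * μ ^ (n + 2) := by
        gcongr
        omega
    _ = _ := by rw [mul_pow, pow_add]; ring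

/-- Orbits that linger in a set on which the map expands contribute only a polynomial factor. -/
theorem Grows.of_expanding {a b : ℝ} (hab : a ≤ b) (hB : Grows f B μ) (hμ : 1 ≤ μ)
    (hmaps : MapsTo f (Icc a b) (Icc a b ∪ B))
    (hexp : ∀ x ∈ Icc a b, ∀ y ∈ Icc a b, |x - y| ≤ |f x - f y|) : Grows f (Icc a b) μ := by
  intro δ hδ
  obtain ⟨C, hC, d, hB⟩ := hB δ hδ
  set C₀ := (b - a) / δ + 1 with hC₀
  have hC₀0 : 0 ≤ C₀ := by
    have := div_nonneg (sub_nonneg.2 hab) hδ.le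
    linarith
  -- The induction starts at length `1`, because pulling back needs closeness of the images for at
  -- least one step.
  have key : ∀ n, CoverBound f (Icc a b) δ (n + 1)
      ((C₀ + C) * (((n + 1 : ℕ) : ℝ) + 1) ^ (d + 1) * μ ^ (n + 1)) := by
    intro n
    induction n with
    | zero =>
      refine (coverBound_Icc_one f hab hδ).mono ?_
      have h1 : (1 : ℝ) ≤ (((0 + 1 : ℕ) : ℝ) + 1) ^ (d + 1) := one_le_pow₀ (by norm_num)
      have h2 : (1 : ℝ) ≤ μ ^ (0 + 1) := one_le_pow₀ hμ
      calc C₀ ≤ (C₀ + C) * 1 * 1 := by linarith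
        _ ≤ _ := by gcongr
    | succ n ih =>
      have h1 := ih.union (hB (n + 1))
      -- Images lie in `[a, b]` or in `B`, whose covers are pulled back by `f`; expansion yields
      -- closeness at time `0` from closeness at time `1`. Each further step thus adds one cover of
      -- `B`, which raises the degree by one.
      refine (h1.transfer (n := n + 1 + 1) hmaps fun x hx y hy hj k hk => ?_).mono ?_
      · cases k with
        | zero => exact (hexp x hx y hy).trans_lt (hj 0 n.succ_pos)
        | succ k => exact hj k (by omega)
      · set t : ℝ := ((n + 1 : ℕ) : ℝ) + 1 with ht
        have ht1 : (((n + 1 + 1 : ℕ) : ℝ) + 1) = t + 1 := by rw [ht]; push_cast; ring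
        have ht0 : 0 ≤ t := by positivity
        rw [ht1]
        have h2 : 1 ≤ μ ^ (n + 1) := one_le_pow₀ hμ
        calc (C₀ + C) * t ^ (d + 1) * μ ^ (n + 1) + C * t ^ d * μ ^ (n + 1)
            ≤ (C₀ + C) * t ^ (d + 1) * μ ^ (n + 1) + (C₀ + C) * t ^ d * μ ^ (n + 1) := by
              gcongr; linarith
          _ = (C₀ + C) * (t ^ d * (t + 1)) * μ ^ (n + 1) := by ring
          _ ≤ (C₀ + C) * ((t + 1) ^ d * (t + 1)) * μ ^ (n + 1 + 1) := by
              gcongr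
              · linarith
              · omega
          _ = _ := by ring
  refine ⟨C₀ + C, by positivity, d + 1, fun n => ?_⟩
  cases n with
  | zero =>
    refine ((coverBound_Icc_one f hab hδ).transfer (φ := id) (n := 0) (fun _ h => h)
      fun x _ y _ _ k hk => absurd hk (Nat.not_lt_zero k)).mono ?_
    simp
    linarith
  | succ n => exact key n

theorem abs_iterate_sub_le {K : ℝ} (hK : 0 ≤ K) (hf : ∀ x y, |f x - f y| ≤ K * |x - y|) (k : ℕ)
    (x y : ℝ) : |f^[k] x - f^[k] y| ≤ K ^ k * |x - y| := by
  induction k with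
  | zero => simp
  | succ k ih =>
    rw [Function.iterate_succ_apply', Function.iterate_succ_apply']
    calc _ ≤ K * |f^[k] x - f^[k] y| := hf _ _
      _ ≤ K * (K ^ k * |x - y|) := by gcongr
      _ = _ := by ring

/-- Points within `δ / K ^ n` of each other stay `δ`-close for `n` steps. -/
theorem grows_Icc_of_lipschitz {K a b : ℝ} (hab : a ≤ b) (hK : 1 ≤ K)
    (hf : ∀ x y, |f x - f y| ≤ K * |x - y|) : Grows f (Icc a b) K := by
  intro δ hδ
  have h0 : 0 ≤ (b - a) / δ := div_nonneg (sub_nonneg.2 hab) hδ.le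
  refine ⟨(b - a) / δ + 1, by positivity, 0, fun n => ?_⟩
  have hKn : 0 < K ^ n := by positivity
  refine ((coverBound_Icc_one f hab (div_pos hδ hKn)).transfer (φ := id) (fun _ h => h)
    fun x _ y _ hj k hk => ?_).mono ?_
  · have h1 := hj 0 one_pos
    simp only [Function.iterate_zero, id] at h1
    rw [lt_div_iff₀ hKn] at h1
    calc |f^[k] x - f^[k] y| ≤ K ^ k * |x - y| := abs_iterate_sub_le (by linarith) hf k x y
      _ ≤ K ^ n * |x - y| := by
        gcongr
      _ < δ := by linarith
  · have h1 : (1 : ℝ) ≤ K ^ n := one_le_pow₀ hK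
    rw [div_div_eq_mul_div, pow_zero, mul_one, add_mul]
    have h2 : (b - a) * K ^ n / δ = (b - a) / δ * K ^ n := by ring
    rw [h2]
    linarith

/-- With `δ` a Lebesgue number of the cover, a set of `δ`-close orbit segments lies in one member of
the join. An entropy above `log₂ μ` would then force an exponential below a polynomial. -/
theorem topEntropy_le_of_grows {φ : unitInterval → unitInterval}
    (hφ : ∀ x : unitInterval, (φ x : ℝ) = f x) (hμ : 1 ≤ μ) (h : Grows f (Icc 0 1) μ) :
    topEntropy univ φ ≤ ((Real.logb 2 μ : ℝ) : EReal) := by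
  classical
  refine iSup₂_le fun 𝒰 h𝒰 => ?_
  rw [EReal.coe_le_coe_iff]
  obtain ⟨δ, hδ, hball⟩ := lebesgue_number_lemma_of_metric_sUnion isCompact_univ h𝒰.2.1 h𝒰.2.2
  obtain ⟨C, hC, d, hcov⟩ := h δ hδ
  have hiter : ∀ k (x : unitInterval), ((φ^[k] x : unitInterval) : ℝ) = f^[k] x := by
    intro k x
    induction k with
    | zero => rfl
    | succ k ih => rw [Function.iterate_succ_apply', Function.iterate_succ_apply', hφ, ih]
  have hN : ∀ n : ℕ, (minCoverCard univ (iterJoin φ 𝒰 n) : ℝ) ≤ C * (n + 1) ^ d * μ ^ n := by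
    intro n
    obtain ⟨F, hF, hcover, hFδ⟩ := hcov n
    refine le_trans (Nat.cast_le.2 ?_) hF
    refine (minCoverCard_le (F.image fun S => ((↑) : unitInterval → ℝ) ⁻¹' S) ?_ ?_).trans
      Finset.card_image_le
    · intro x _
      obtain ⟨S, hS, hxS⟩ := hcover x.2
      exact ⟨_, Finset.mem_coe.2 (Finset.mem_image_of_mem _ hS), hxS⟩
    · intro S hS
      obtain ⟨S, hS', rfl⟩ := Finset.mem_image.1 hS
      have hU : ∀ k : Fin n, ∃ U ∈ 𝒰, ∀ x : unitInterval, (x : ℝ) ∈ S → φ^[(k : ℕ)] x ∈ U := by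
        intro k
        by_cases hne : ∃ x₀ : unitInterval, (x₀ : ℝ) ∈ S
        · obtain ⟨x₀, hx₀⟩ := hne
          obtain ⟨U, hU, hsub⟩ := hball (φ^[(k : ℕ)] x₀) (mem_univ _)
          refine ⟨U, hU, fun x hx => hsub ?_⟩
          rw [Metric.mem_ball, Subtype.dist_eq, Real.dist_eq, hiter, hiter]
          exact hFδ S hS' _ hx _ hx₀ k k.2
        · obtain ⟨U, hU, -⟩ := h𝒰.2.2 (mem_univ (0 : unitInterval))
          exact ⟨U, hU, fun x hx => absurd ⟨x, hx⟩ hne⟩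
      choose U hU hSU using hU
      exact ⟨_, ⟨U, hU, rfl⟩, fun x hx => mem_iInter.2 fun k => hSU k x hx⟩
  by_contra! hlt
  set H := entropyOfCover univ φ 𝒰 with hH
  have hμ0 : 0 < μ := by linarith
  set r : ℝ := 2 ^ H / μ with hr
  have hr1 : 1 < r := by
    rw [hr, one_lt_div hμ0]
    exact (Real.logb_lt_iff_lt_rpow one_lt_two hμ0).1 hlt
  have hbound : ∀ n : ℕ, r ^ (n + 1) ≤ C * 2 ^ d * ((n + 1 : ℕ) : ℝ) ^ d := by
    intro n
    have h2 := rpow_le_minCoverCard φ h𝒰.1 h𝒰.2.2 (M := n + 1) n.succ_pos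
    rw [← hH, Real.rpow_mul zero_le_two, Real.rpow_natCast] at h2
    rw [hr, div_pow, div_le_iff₀ (by positivity)]
    calc _ ≤ C * (((n + 1 : ℕ) : ℝ) + 1) ^ d * μ ^ (n + 1) := h2.trans (hN _)
      _ ≤ C * (2 * ((n + 1 : ℕ) : ℝ)) ^ d * μ ^ (n + 1) := by
        gcongr
        push_cast
        linarith [Nat.cast_nonneg (α := ℝ) n]
      _ = _ := by rw [mul_pow]; ring
  have hlim := ((tendsto_pow_const_div_const_pow_of_one_lt d hr1).const_mul (C * 2 ^ d)).comp
    (Filter.tendsto_add_atTop_nat 1)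
  rw [mul_zero] at hlim
  obtain ⟨n, hn⟩ := (hlim.eventually (gt_mem_nhds one_pos)).exists
  have h1 := hbound n
  have h2 : 0 < r ^ (n + 1) := by positivity
  simp only [Function.comp] at hn
  rw [← mul_div_assoc, div_lt_one h2] at hn
  exact absurd h1 (not_le.2 hn)

end Growth

/-! ### Iterated square roots of a zigzag -/

section Roots

/-- The triangle wave: the distance to the nearest even integer. -/
noncomputable def triangle (y : ℝ) : ℝ := |y - 2 * round (y / 2)|

theorem triangle_nonneg (y : ℝ) : 0 ≤ triangle y := abs_nonneg _

theorem triangle_le_abs (y : ℝ) (k : ℤ) : triangle y ≤ |y - 2 * k| := by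
  have h := round_le (y / 2) k
  have h1 : ∀ t : ℝ, |y - 2 * t| = 2 * |y / 2 - t| := by
    intro t
    rw [← abs_of_pos (two_pos (α := ℝ)), ← abs_mul, abs_of_pos (two_pos (α := ℝ))]
    congr 1
    ring
  rw [triangle, h1, h1]
  linarith

theorem triangle_le_one (y : ℝ) : triangle y ≤ 1 := by
  have h := abs_sub_round (y / 2)
  rw [triangle]
  rw [abs_le] at h ⊢
  constructor <;> linarith

theorem abs_triangle_sub_le (x y : ℝ) : |triangle x - triangle y| ≤ |x - y| := by
  have key : ∀ x y : ℝ, triangle x - triangle y ≤ |x - y| := by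
    intro x y
    have h1 := triangle_le_abs x (round (y / 2))
    have h2 := abs_sub_le x y (2 * round (y / 2))
    have h3 : triangle y = |y - 2 * round (y / 2)| := rfl
    linarith
  rw [abs_le]
  have h1 := key x y
  have h2 := key y x
  rw [abs_sub_comm] at h2
  constructor <;> linarith

theorem triangle_two_mul_sub (k : ℤ) {u : ℝ} (h0 : 0 ≤ u) (h1 : u ≤ 1) :
    triangle (2 * k - u) = u := by
  have h2 : round ((2 * (k : ℝ) - u) / 2) = k := by
    rw [round_eq, Int.floor_eq_iff]
    constructor <;> linarith
  rw [triangle, h2, show 2 * (k : ℝ) - u - 2 * k = -u by ring, abs_neg, abs_of_nonneg h0]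

/-- The piecewise linear map with `2 ^ p` full branches on `[0, 1]` that vanishes at `1`. -/
noncomputable def zigzag (p : ℕ) (x : ℝ) : ℝ := triangle (2 ^ p * (1 - x))

/-- The `2 ^ j`-th root of `zigzag p`: on `[0, 1 / 3]` the second iterate of each root is a scaled
copy of the preceding one. -/
noncomputable def root (p : ℕ) : ℕ → ℝ → ℝ
  | 0, x => zigzag p x
  | j + 1, x => if x ≤ 1 / 3 then 1 - root p j (3 * x) / 3 else max (5 / 3 - 2 * x) (1 - x)

variable (p j : ℕ)

/-- Vanishing at `1` makes the two formulas for the next root agree at `1 / 3`, and later joins the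
outer branches of `block` at `-1` and `1`. -/
theorem root_one : root p j 1 = 0 := by
  cases j with
  | zero =>
    have := triangle_two_mul_sub 0 le_rfl zero_le_one
    simpa [root, zigzag] using this
  | succ j =>
    rw [root, if_neg (by norm_num)]
    norm_num

theorem root_succ_left {x : ℝ} (hx : x ≤ 1 / 3) : root p (j + 1) x = 1 - root p j (3 * x) / 3 := by
  rw [root, if_pos hx]

theorem root_succ_right {x : ℝ} (hx : 1 / 3 ≤ x) :
    root p (j + 1) x = max (5 / 3 - 2 * x) (1 - x) := by
  rcases hx.eq_or_lt with rfl | hx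
  · rw [root_succ_left p j le_rfl]
    norm_num [root_one]
  · rw [root, if_neg (not_le.2 hx)]

theorem root_mem_Icc {x : ℝ} (hx : x ∈ Icc (0 : ℝ) 1) : root p j x ∈ Icc (0 : ℝ) 1 := by
  induction j generalizing x with
  | zero => exact ⟨triangle_nonneg _, triangle_le_one _⟩
  | succ j ih =>
    rcases le_total x (1 / 3) with h | h
    · rw [root_succ_left p j h]
      have := ih (x := 3 * x) ⟨by linarith [hx.1], by linarith⟩
      constructor <;> linarith [this.1, this.2]
    · rw [root_succ_right p j h]
      exact ⟨le_max_of_le_right (by linarith [hx.2]), max_le (by linarith) (by linarith)⟩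

theorem abs_sub_le_of_glue {f : ℝ → ℝ} {s : Set ℝ} {K c : ℝ} (hc : c ∈ s)
    (h1 : ∀ x ∈ s, ∀ y ∈ s, x ≤ c → y ≤ c → |f x - f y| ≤ K * |x - y|)
    (h2 : ∀ x ∈ s, ∀ y ∈ s, c ≤ x → c ≤ y → |f x - f y| ≤ K * |x - y|) :
    ∀ x ∈ s, ∀ y ∈ s, |f x - f y| ≤ K * |x - y| := by
  have key : ∀ x ∈ s, ∀ y ∈ s, x ≤ c → c ≤ y → |f x - f y| ≤ K * |x - y| := by
    intro x hx y hy hxc hcy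
    have h3 := h1 x hx c hc hxc le_rfl
    have h4 := h2 c hc y hy le_rfl hcy
    rw [abs_of_nonpos (sub_nonpos.2 hxc)] at h3
    rw [abs_of_nonpos (sub_nonpos.2 hcy)] at h4
    rw [abs_of_nonpos (sub_nonpos.2 (hxc.trans hcy))]
    calc _ ≤ |f x - f c| + |f c - f y| := abs_sub_le _ _ _
      _ ≤ K * -(x - c) + K * -(c - y) := add_le_add h3 h4
      _ = _ := by ring
  intro x hx y hy
  rcases le_total x c with h | h <;> rcases le_total y c with h' | h'
  · exact h1 x hx y hy h h'
  · exact key x hx y hy h h'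
  · rw [abs_sub_comm, abs_sub_comm x]
    exact key y hy x hx h' h
  · exact h2 x hx y hy h h'

theorem two_le_two_pow_add_one : (2 : ℝ) ≤ 2 ^ p + 1 := by
  have : (1 : ℝ) ≤ 2 ^ p := one_le_pow₀ one_le_two
  linarith

theorem abs_zigzag_sub_le (x y : ℝ) : |zigzag p x - zigzag p y| ≤ 2 ^ p * |x - y| := by
  refine (abs_triangle_sub_le _ _).trans_eq ?_
  rw [← mul_sub, abs_mul, abs_of_pos (by positivity : (0 : ℝ) < 2 ^ p),
    show 1 - x - (1 - y) = -(x - y) by ring, abs_neg]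

/-- The rescaled left branch keeps the constant, so it does not depend on `j`. The summand `1` makes
room for the slope `2` of the middle branch when `p = 0`. -/
theorem abs_root_sub_le (x y : ℝ) : |root p j x - root p j y| ≤ (2 ^ p + 1) * |x - y| := by
  induction j generalizing x y with
  | zero =>
    refine (abs_zigzag_sub_le p x y).trans ?_
    gcongr
    linarith
  | succ j ih =>
    refine abs_sub_le_of_glue (s := univ) (c := 1 / 3) (mem_univ _) ?_ ?_ x (mem_univ _) y
      (mem_univ _)
    · intro x _ y _ hx hy
      rw [root_succ_left p j hx, root_succ_left p j hy]
      have h := ih (3 * x) (3 * y)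
      rw [← mul_sub, abs_mul, abs_of_pos (by norm_num : (0 : ℝ) < 3)] at h
      rw [show 1 - root p j (3 * x) / 3 - (1 - root p j (3 * y) / 3) =
        -((root p j (3 * x) - root p j (3 * y)) / 3) by ring, abs_neg, abs_div,
        abs_of_pos (by norm_num : (0 : ℝ) < 3)]
      linarith
    · intro x _ y _ hx hy
      rw [root_succ_right p j hx, root_succ_right p j hy]
      refine (abs_max_sub_max_le_max _ _ _ _).trans ?_
      have h1 : |5 / 3 - 2 * x - (5 / 3 - 2 * y)| = 2 * |x - y| := by
        rw [show 5 / 3 - 2 * x - (5 / 3 - 2 * y) = -(2 * (x - y)) by ring, abs_neg, abs_mul,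
          abs_of_pos (two_pos (α := ℝ))]
      have h2 : |1 - x - (1 - y)| = |x - y| := by
        rw [show 1 - x - (1 - y) = -(x - y) by ring, abs_neg]
      rw [h1, h2]
      have h3 := abs_nonneg (x - y)
      have h4 := mul_le_mul_of_nonneg_right (two_le_two_pow_add_one p) h3
      exact max_le h4 (by linarith)

/-- The left third is sent into the right third and comes back by the reflection `1 - x`; two steps
perform one step of the preceding root. -/
theorem root_succ_root_succ {x : ℝ} (hx : x ∈ Icc (0 : ℝ) 1) :
    root p (j + 1) (root p (j + 1) (x / 3)) = root p j x / 3 := by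
  have h := root_mem_Icc p j hx
  rw [root_succ_left p j (x := x / 3) (by linarith [hx.2]), show 3 * (x / 3) = x by ring,
    root_succ_right p j (by linarith [h.2]), max_eq_right (by linarith [h.2])]
  ring

theorem iterate_root_mem_Icc (k : ℕ) {x : ℝ} (hx : x ∈ Icc (0 : ℝ) 1) :
    (root p j)^[k] x ∈ Icc (0 : ℝ) 1 := by
  induction k with
  | zero => exact hx
  | succ k ih =>
    rw [Function.iterate_succ_apply']
    exact root_mem_Icc p j ih

theorem iterate_two_mul_root_succ (k : ℕ) {x : ℝ} (hx : x ∈ Icc (0 : ℝ) 1) :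
    (root p (j + 1))^[2 * k] (x / 3) = (root p j)^[k] x / 3 := by
  induction k with
  | zero => rfl
  | succ k ih =>
    rw [show 2 * (k + 1) = 2 * k + 1 + 1 by ring, Function.iterate_succ_apply',
      Function.iterate_succ_apply', ih, root_succ_root_succ p j (iterate_root_mem_Icc p j k hx),
      Function.iterate_succ_apply']

theorem iterate_two_mul_add_one_root_succ (k : ℕ) {x : ℝ} (hx : x ∈ Icc (0 : ℝ) 1) :
    (root p (j + 1))^[2 * k + 1] (x / 3) = 1 - (root p j)^[k + 1] x / 3 := by
  have h := iterate_root_mem_Icc p j k hx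
  rw [Function.iterate_succ_apply', iterate_two_mul_root_succ p j k hx,
    root_succ_left p j (by linarith [h.2]), Function.iterate_succ_apply']
  congr 3
  ring

theorem iterate_two_pow_root {x : ℝ} (hx : x ∈ Icc (0 : ℝ) 1) :
    (root p j)^[2 ^ j] (x / 3 ^ j) = zigzag p x / 3 ^ j := by
  induction j with
  | zero => simp [root]
  | succ j ih =>
    have h1 : x / 3 ^ j ∈ Icc (0 : ℝ) 1 := by
      have h3 : (1 : ℝ) ≤ 3 ^ j := one_le_pow₀ (by norm_num)
      exact ⟨div_nonneg hx.1 (by positivity), (div_le_one (by positivity)).2 (hx.2.trans h3)⟩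
    rw [pow_succ' 2, pow_succ 3, ← div_div, iterate_two_mul_root_succ p j _ h1, ih, div_div]

/-- Each root halves the speed, so the rate `μ` at level `j + 1` comes from the rate `μ ^ 2` at
level `j`. The remaining two thirds of the interval feed into the slow part. -/
theorem root_grows {μ : ℝ} (hμ : 1 ≤ μ) (hpow : μ ^ 2 ^ j = 2 ^ p) :
    Grows (root p j) (Icc 0 1) μ := by
  induction j generalizing μ with
  | zero =>
    rw [pow_zero, pow_one] at hpow
    rw [hpow]
    exact grows_Icc_of_lipschitz zero_le_one (by rw [← hpow]; exact hμ) (abs_zigzag_sub_le p)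
  | succ j ih =>
    have hμ2 : Grows (root p j) (Icc 0 1) (μ ^ 2) := by
      refine ih (one_le_pow₀ hμ) ?_
      rw [← pow_mul, ← pow_succ', hpow]
    have hμ0 : 0 ≤ μ := by linarith
    -- Orbits alternate between the left and the right third, and the state at time `k` is
    -- determined by `(k + 1) / 2` steps of the preceding root.
    have hL : Grows (root p (j + 1)) (Icc 0 (1 / 3)) μ := by
      have hmem : ∀ x ∈ Icc (0 : ℝ) (1 / 3), 3 * x ∈ Icc (0 : ℝ) 1 := fun x hx =>
        ⟨by linarith [hx.1], by linarith [hx.2]⟩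
      refine hμ2.of_dist_le_half hμ (φ := fun x => 3 * x) hmem fun x hx y hy k => ?_
      have h3 : ∀ a b : ℝ, |a / 3 - b / 3| ≤ |a - b| := by
        intro a b
        rw [← sub_div, abs_div, abs_of_pos (by norm_num : (0 : ℝ) < 3)]
        linarith [abs_nonneg (a - b)]
      have e : ∀ z : ℝ, z = 3 * z / 3 := fun z => by ring
      obtain ⟨i, rfl | rfl⟩ := Nat.even_or_odd' k
      · rw [show (2 * i + 1) / 2 = i by omega]
        nth_rewrite 1 [e x, e y]
        rw [iterate_two_mul_root_succ p j i (hmem x hx), iterate_two_mul_root_succ p j i (hmem y hy)]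
        exact h3 _ _
      · rw [show (2 * i + 1 + 1) / 2 = i + 1 by omega]
        nth_rewrite 1 [e x, e y]
        rw [iterate_two_mul_add_one_root_succ p j i (hmem x hx),
          iterate_two_mul_add_one_root_succ p j i (hmem y hy), sub_sub_sub_cancel_left, abs_sub_comm]
        exact h3 _ _
    -- The right third is reflected isometrically into the left third.
    have hR : Grows (root p (j + 1)) (Icc (2 / 3) 1) μ := by
      have hval : ∀ x ∈ Icc (2 / 3 : ℝ) 1, root p (j + 1) x = 1 - x := fun x hx => by
        rw [root_succ_right p j (by linarith [hx.1]), max_eq_right (by linarith [hx.1])]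
      refine hL.of_expanding (by norm_num) hμ (fun x hx => Or.inr ?_) fun x hx y hy => ?_
      · rw [hval x hx]
        exact ⟨by linarith [hx.2], by linarith [hx.1]⟩
      · rw [hval x hx, hval y hy, sub_sub_sub_cancel_left, abs_sub_comm]
    -- The middle third is doubled over itself and the right third, so an orbit may linger there but
    -- only a polynomial factor is lost.
    have hM : Grows (root p (j + 1)) (Icc (1 / 3) (2 / 3)) μ := by
      have hval : ∀ x ∈ Icc (1 / 3 : ℝ) (2 / 3), root p (j + 1) x = 5 / 3 - 2 * x := fun x hx => by
        rw [root_succ_right p j hx.1, max_eq_left (by linarith [hx.2])]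
      refine hR.of_expanding (by norm_num) hμ (fun x hx => ?_) fun x hx y hy => ?_
      · rw [hval x hx, Icc_union_Icc_eq_Icc (by norm_num) (by norm_num)]
        exact ⟨by linarith [hx.2], by linarith [hx.1]⟩
      · rw [hval x hx, hval y hy, sub_sub_sub_cancel_left, ← mul_sub, abs_mul,
          abs_of_pos (two_pos (α := ℝ)), abs_sub_comm]
        linarith [abs_nonneg (y - x)]
    have h := (hL.union hM hμ0).union hR hμ0
    rwa [Icc_union_Icc_eq_Icc (by norm_num) (by norm_num),
      Icc_union_Icc_eq_Icc (by norm_num) (by norm_num)] at h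

end Roots

/-! ### Extension to a map with fixed endpoints -/

section Block

/-- The map `root p j ∘ |·|` on `[-1, 1]`, extended to `[-2, 2]` by two expanding branches that fix
the endpoints. -/
noncomputable def block (p j : ℕ) (s : ℝ) : ℝ :=
  if s < -1 then 2 * (s + 1) else if s ≤ 1 then root p j |s| else 2 * (s - 1)

variable (p j : ℕ)

theorem block_left {s : ℝ} (hs : s ≤ -1) : block p j s = 2 * (s + 1) := by
  rcases hs.eq_or_lt with rfl | hs
  · rw [block, if_neg (lt_irrefl _), if_pos (by norm_num), abs_neg, abs_one, root_one]
    norm_num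
  · rw [block, if_pos hs]

theorem block_middle {s : ℝ} (h1 : -1 ≤ s) (h2 : s ≤ 1) : block p j s = root p j |s| := by
  rw [block, if_neg (not_lt.2 h1), if_pos h2]

theorem block_right {s : ℝ} (hs : 1 ≤ s) : block p j s = 2 * (s - 1) := by
  rcases hs.eq_or_lt with rfl | hs
  · rw [block_middle p j (by norm_num) le_rfl, abs_one, root_one]
    norm_num
  · rw [block, if_neg (by linarith), if_neg (not_le.2 hs)]

/-- Both endpoints being fixed, rescaled blocks on adjacent intervals fit together continuously. -/
theorem block_two : block p j 2 = 2 := by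
  rw [block_right p j one_le_two]
  norm_num

theorem block_neg_two : block p j (-2) = -2 := by
  rw [block_left p j (by norm_num)]
  norm_num

theorem abs_block_sub_le (x y : ℝ) : |block p j x - block p j y| ≤ (2 ^ p + 1) * |x - y| := by
  have hK := two_le_two_pow_add_one p
  refine abs_sub_le_of_glue (s := univ) (c := -1) (mem_univ _) ?_ ?_ x (mem_univ _) y (mem_univ _)
  · intro x _ y _ hx hy
    rw [block_left p j hx, block_left p j hy, ← mul_sub, add_sub_add_right_eq_sub, abs_mul,
      abs_of_pos (two_pos (α := ℝ))]
    gcongr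
  · intro x hx y hy hx1 hy1
    refine abs_sub_le_of_glue (s := Ici (-1)) (c := 1) (by norm_num) ?_ ?_ x hx1 y hy1
    · intro x hx y hy hx1 hy1
      rw [block_middle p j hx hx1, block_middle p j hy hy1]
      refine (abs_root_sub_le p j _ _).trans ?_
      exact mul_le_mul_of_nonneg_left (abs_abs_sub_abs_le x y) (by positivity)
    · intro x _ y _ hx hy
      rw [block_right p j hx, block_right p j hy, ← mul_sub, sub_sub_sub_cancel_right, abs_mul,
        abs_of_pos (two_pos (α := ℝ))]
      gcongr

theorem block_mem_Icc {s : ℝ} (hs : s ∈ Icc (-2 : ℝ) 2) : block p j s ∈ Icc (-2 : ℝ) 2 := by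
  rcases le_total s (-1) with h | h
  · rw [block_left p j h]
    constructor <;> linarith [hs.1]
  rcases le_total s 1 with h' | h'
  · rw [block_middle p j h h']
    have := root_mem_Icc p j ⟨abs_nonneg s, abs_le.2 ⟨h, h'⟩⟩
    constructor <;> linarith [this.1, this.2]
  · rw [block_right p j h']
    constructor <;> linarith [hs.2]

theorem iterate_block_mem_Icc (k : ℕ) {s : ℝ} (hs : s ∈ Icc (-2 : ℝ) 2) :
    (block p j)^[k] s ∈ Icc (-2 : ℝ) 2 := by
  induction k with
  | zero => exact hs
  | succ k ih =>
    rw [Function.iterate_succ_apply']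
    exact block_mem_Icc p j ih

theorem iterate_block_of_nonneg (k : ℕ) {s : ℝ} (hs : s ∈ Icc (0 : ℝ) 1) :
    (block p j)^[k] s = (root p j)^[k] s := by
  induction k with
  | zero => rfl
  | succ k ih =>
    have h := iterate_root_mem_Icc p j k hs
    rw [Function.iterate_succ_apply', Function.iterate_succ_apply', ih,
      block_middle p j (by linarith [h.1]) h.2, abs_of_nonneg h.1]

theorem iterate_succ_block_of_nonpos (k : ℕ) {s : ℝ} (hs : s ∈ Icc (-1 : ℝ) 0) :
    (block p j)^[k + 1] s = (root p j)^[k + 1] (-s) := by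
  have h : -s ∈ Icc (0 : ℝ) 1 := ⟨by linarith [hs.2], by linarith [hs.1]⟩
  rw [Function.iterate_succ_apply, Function.iterate_succ_apply,
    block_middle p j hs.1 (by linarith [hs.2]), abs_of_nonpos hs.2,
    iterate_block_of_nonneg p j k (root_mem_Icc p j h)]

/-- The map folds `[-1, 0]` onto the root on `[0, 1]` after one step, and each outer branch doubles
its interval over itself and the inner interval next to it. -/
theorem block_grows {μ : ℝ} (hμ : 1 ≤ μ) (hroot : Grows (root p j) (Icc 0 1) μ) :
    Grows (block p j) (Icc (-2) 2) μ := by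
  have hμ0 : 0 ≤ μ := by linarith
  have h1 : Grows (block p j) (Icc 0 1) μ :=
    hroot.of_dist_le (φ := id) (fun _ h => h) fun x hx y hy k => by
      rw [iterate_block_of_nonneg p j k hx, iterate_block_of_nonneg p j k hy, id, id]
  have h2 : Grows (block p j) (Icc (-1) 0) μ := by
    refine hroot.of_dist_le (φ := fun x => -x)
      (fun x hx => ⟨by linarith [hx.2], by linarith [hx.1]⟩) fun x hx y hy k => ?_
    cases k with
    | zero =>
      rw [Function.iterate_zero, Function.iterate_zero, id, id, id, id, neg_sub_neg, abs_sub_comm]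
    | succ k => rw [iterate_succ_block_of_nonpos p j k hx, iterate_succ_block_of_nonpos p j k hy]
  have h3 : Grows (block p j) (Icc 1 2) μ := by
    refine h1.of_expanding one_le_two hμ (fun x hx => ?_) fun x hx y hy => ?_
    · rw [block_right p j hx.1, union_comm, Icc_union_Icc_eq_Icc zero_le_one one_le_two]
      constructor <;> linarith [hx.1, hx.2]
    · rw [block_right p j hx.1, block_right p j hy.1, ← mul_sub, sub_sub_sub_cancel_right, abs_mul,
        abs_of_pos (two_pos (α := ℝ))]
      linarith [abs_nonneg (x - y)]
  have h4 : Grows (block p j) (Icc (-2) (-1)) μ := by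
    refine h2.of_expanding (by norm_num) hμ (fun x hx => ?_) fun x hx y hy => ?_
    · rw [block_left p j hx.2, Icc_union_Icc_eq_Icc (by norm_num) (by norm_num)]
      constructor <;> linarith [hx.1, hx.2]
    · rw [block_left p j hx.2, block_left p j hy.2, ← mul_sub, add_sub_add_right_eq_sub, abs_mul,
        abs_of_pos (two_pos (α := ℝ))]
      linarith [abs_nonneg (x - y)]
  have h := ((h4.union h2 hμ0).union h1 hμ0).union h3 hμ0
  rwa [Icc_union_Icc_eq_Icc (by norm_num) (by norm_num),
    Icc_union_Icc_eq_Icc (by norm_num) (by norm_num),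
    Icc_union_Icc_eq_Icc (by norm_num) (by norm_num)] at h

end Block

/-! ### Gluing infinitely many blocks that accumulate at zero -/

section Tower

/-- The affine bijection from `[-2, 2]` onto `[1 / (n + 2), 1 / (n + 1)]`. -/
noncomputable def cell (n : ℕ) (s : ℝ) : ℝ := 1 / (n + 2) + (s + 2) / (4 * (n + 1) * (n + 2))

/-- The inverse of `cell n`. -/
noncomputable def cellCoord (n : ℕ) (x : ℝ) : ℝ := 4 * ((n + 2) * x - 1) * (n + 1) - 2

theorem cell_cellCoord (n : ℕ) (x : ℝ) : cell n (cellCoord n x) = x := by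
  have h1 : (n : ℝ) + 1 ≠ 0 := by positivity
  have h2 : (n : ℝ) + 2 ≠ 0 := by positivity
  rw [cell, cellCoord]
  field_simp
  ring

theorem cellCoord_cell (n : ℕ) (s : ℝ) : cellCoord n (cell n s) = s := by
  have h1 : (n : ℝ) + 1 ≠ 0 := by positivity
  have h2 : (n : ℝ) + 2 ≠ 0 := by positivity
  rw [cell, cellCoord]
  field_simp
  ring

theorem cell_two (n : ℕ) : cell n 2 = 1 / (n + 1) := by
  have h1 : (n : ℝ) + 1 ≠ 0 := by positivity
  have h2 : (n : ℝ) + 2 ≠ 0 := by positivity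
  rw [cell]
  field_simp
  ring

theorem cell_neg_two (n : ℕ) : cell n (-2) = 1 / (n + 2) := by
  rw [cell]
  norm_num

theorem cell_sub (n : ℕ) (s t : ℝ) : cell n s - cell n t = (s - t) / (4 * (n + 1) * (n + 2)) := by
  rw [cell, cell]
  ring

theorem strictMono_cell (n : ℕ) : StrictMono (cell n) := by
  intro s t h
  rw [← sub_pos, cell_sub]
  exact div_pos (sub_pos.2 h) (by positivity)

theorem abs_cell_sub (n : ℕ) (s t : ℝ) :
    |cell n s - cell n t| = |s - t| / (4 * (n + 1) * (n + 2)) := by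
  rw [cell_sub, abs_div, abs_of_pos (by positivity : (0 : ℝ) < 4 * (n + 1) * (n + 2))]

theorem abs_cell_sub_le (n : ℕ) (s t : ℝ) : |cell n s - cell n t| ≤ |s - t| := by
  rw [abs_cell_sub]
  refine div_le_self (abs_nonneg _) ?_
  have h := Nat.cast_nonneg (α := ℝ) n
  nlinarith

theorem cell_mem_Icc {n : ℕ} {s : ℝ} (hs : s ∈ Icc (-2 : ℝ) 2) :
    cell n s ∈ Icc (1 / ((n : ℝ) + 2)) (1 / ((n : ℝ) + 1)) := by
  rw [← cell_two, ← cell_neg_two]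
  exact ⟨(strictMono_cell n).monotone hs.1, (strictMono_cell n).monotone hs.2⟩

theorem cellCoord_mem_Icc {n : ℕ} {x : ℝ}
    (hx : x ∈ Icc (1 / ((n : ℝ) + 2)) (1 / ((n : ℝ) + 1))) : cellCoord n x ∈ Icc (-2 : ℝ) 2 := by
  rw [← cell_two, ← cell_neg_two, ← cell_cellCoord n x] at hx
  exact ⟨(strictMono_cell n).le_iff_le.1 hx.1, (strictMono_cell n).le_iff_le.1 hx.2⟩

/-- The map of `[0, 1]` that acts on `[1 / (n + 2), 1 / (n + 1)]` as `block (P n) (J n)`. -/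
noncomputable def tower (P J : ℕ → ℕ) (x : ℝ) : ℝ :=
  if x ≤ 0 then 0 else
    cell (⌊1 / x⌋₊ - 1) (block (P (⌊1 / x⌋₊ - 1)) (J (⌊1 / x⌋₊ - 1)) (cellCoord (⌊1 / x⌋₊ - 1) x))

variable (P J : ℕ → ℕ)

theorem tower_zero : tower P J 0 = 0 := if_pos le_rfl

theorem floor_one_div_sub_one {n : ℕ} {x : ℝ} (h1 : 1 / ((n : ℝ) + 2) < x)
    (h2 : x ≤ 1 / ((n : ℝ) + 1)) : ⌊1 / x⌋₊ - 1 = n := by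
  have h0 : 0 < x := lt_trans (by positivity) h1
  have h : ⌊1 / x⌋₊ = n + 1 := by
    rw [Nat.floor_eq_iff (by positivity)]
    push_cast
    constructor
    · rwa [le_one_div (by positivity) h0]
    · rw [one_div_lt (by positivity) h0] at h1
      linarith
  rw [h, Nat.add_sub_cancel]

theorem tower_cell (n : ℕ) {s : ℝ} (hs : s ∈ Icc (-2 : ℝ) 2) :
    tower P J (cell n s) = cell n (block (P n) (J n) s) := by
  have key : ∀ n : ℕ, ∀ s ∈ Ioc (-2 : ℝ) 2, tower P J (cell n s) =
      cell n (block (P n) (J n) s) := by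
    intro n s hs
    have h1 : 1 / ((n : ℝ) + 2) < cell n s := by
      rw [← cell_neg_two]
      exact strictMono_cell n hs.1
    have h2 := (cell_mem_Icc (n := n) (Ioc_subset_Icc_self hs)).2
    rw [tower, if_neg (not_le.2 (lt_trans (by positivity) h1)), floor_one_div_sub_one h1 h2,
      cellCoord_cell]
  rcases hs.1.eq_or_lt with rfl | h
  · have h1 : cell n (-2) = cell (n + 1) 2 := by
      rw [cell_two, cell_neg_two]
      push_cast
      ring
    rw [block_neg_two, h1, key (n + 1) 2 (by norm_num), block_two]
  · exact key n s ⟨h, hs.2⟩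

theorem iterate_tower_cell (n k : ℕ) {s : ℝ} (hs : s ∈ Icc (-2 : ℝ) 2) :
    (tower P J)^[k] (cell n s) = cell n ((block (P n) (J n))^[k] s) := by
  induction k with
  | zero => rfl
  | succ k ih =>
    rw [Function.iterate_succ_apply', Function.iterate_succ_apply', ih,
      tower_cell P J n (iterate_block_mem_Icc _ _ k hs)]

theorem exists_cell {x : ℝ} (h0 : 0 < x) (h1 : x ≤ 1) :
    ∃ n : ℕ, ∃ s ∈ Icc (-2 : ℝ) 2, cell n s = x := by
  have h2 : 1 ≤ 1 / x := by rwa [one_le_div h0]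
  have h3 : 1 ≤ ⌊1 / x⌋₊ := Nat.le_floor (by simpa using h2)
  obtain ⟨n, hn⟩ := Nat.exists_eq_add_of_le' h3
  refine ⟨n, cellCoord n x, cellCoord_mem_Icc ?_, cell_cellCoord n x⟩
  have h4 := Nat.floor_le (zero_le_one.trans h2)
  have h5 := Nat.lt_floor_add_one (1 / x)
  rw [hn] at h4 h5
  push_cast at h4 h5
  constructor
  · rw [one_div_le (by positivity) h0]
    linarith
  · rwa [le_one_div h0 (by positivity)]

theorem tower_mem_Icc (N : ℕ) {x : ℝ} (hx : x ∈ Icc 0 (1 / ((N : ℝ) + 1))) :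
    tower P J x ∈ Icc 0 (1 / ((N : ℝ) + 1)) := by
  rcases hx.1.eq_or_lt with rfl | h0
  · rw [tower_zero]
    exact hx
  have h1 : 1 / ((N : ℝ) + 1) ≤ 1 := by
    rw [div_le_one (by positivity)]
    linarith [Nat.cast_nonneg (α := ℝ) N]
  obtain ⟨n, s, hs, rfl⟩ := exists_cell h0 (hx.2.trans h1)
  rw [tower_cell P J n hs]
  have hb := block_mem_Icc (P n) (J n) hs
  have h2 := cell_mem_Icc (n := n) hb
  refine ⟨le_trans (by positivity) h2.1, ?_⟩
  -- A cell with `n < N` meets `[0, 1 / (N + 1)]` at most in its left endpoint, which is fixed.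
  rcases lt_or_ge n N with hnN | hnN
  · have h3 : 1 / ((N : ℝ) + 1) ≤ 1 / ((n : ℝ) + 2) := by
      have : (n : ℝ) + 1 ≤ N := by exact_mod_cast hnN
      exact one_div_le_one_div_of_le (by positivity) (by linarith)
    have h4 := (cell_mem_Icc (n := n) hs).1
    have h5 : cell n s = cell n (-2) := by
      rw [cell_neg_two]
      linarith [hx.2]
    rw [(strictMono_cell n).injective h5, block_neg_two, cell_neg_two]
    linarith [hx.2]
  · refine h2.2.trans (one_div_le_one_div_of_le (by positivity) ?_)
    have : (N : ℝ) ≤ n := by exact_mod_cast hnN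
    linarith

theorem iterate_tower_mem_Icc (N k : ℕ) {x : ℝ} (hx : x ∈ Icc 0 (1 / ((N : ℝ) + 1))) :
    (tower P J)^[k] x ∈ Icc 0 (1 / ((N : ℝ) + 1)) := by
  induction k with
  | zero => exact hx
  | succ k ih =>
    rw [Function.iterate_succ_apply']
    exact tower_mem_Icc P J N ih

theorem Icc_one_div_succ (N : ℕ) : Icc (1 / ((N : ℝ) + 2)) 1 =
    Icc (1 / ((N : ℝ) + 2)) (1 / ((N : ℝ) + 1)) ∪ Icc (1 / ((N : ℝ) + 1)) 1 := by
  have h := Nat.cast_nonneg (α := ℝ) N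
  rw [Icc_union_Icc_eq_Icc]
  · exact one_div_le_one_div_of_le (by positivity) (by linarith)
  · rw [div_le_one (by positivity)]
    linarith

/-- At scale `δ` the invariant interval `[0, 1 / (N + 1)]` with `1 / (N + 1) < δ` counts as a single
piece, and finitely many invariant cells remain. The constant and the degree depend on `N`, hence on
`δ`, as `Grows` permits. -/
theorem tower_grows {μ : ℝ} (hμ : 1 ≤ μ)
    (h : ∀ n, Grows (block (P n) (J n)) (Icc (-2) 2) μ) : Grows (tower P J) (Icc 0 1) μ := by
  have hμ0 : 0 ≤ μ := by linarith
  have hcell : ∀ n : ℕ, Grows (tower P J) (Icc (1 / ((n : ℝ) + 2)) (1 / ((n : ℝ) + 1))) μ := by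
    intro n
    refine (h n).of_dist_le (φ := cellCoord n) (fun x hx => cellCoord_mem_Icc hx)
      fun x hx y hy k => ?_
    have e : ∀ x ∈ Icc (1 / ((n : ℝ) + 2)) (1 / ((n : ℝ) + 1)), (tower P J)^[k] x =
        cell n ((block (P n) (J n))^[k] (cellCoord n x)) := fun x hx => by
      rw [← iterate_tower_cell P J n k (cellCoord_mem_Icc hx), cell_cellCoord]
    rw [e x hx, e y hy]
    exact abs_cell_sub_le _ _ _
  have hIcc : ∀ N : ℕ, Grows (tower P J) (Icc (1 / ((N : ℝ) + 1)) 1) μ := by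
    intro N
    induction N with
    | zero =>
      refine (hcell 0).mono_set fun x hx => ?_
      norm_num at hx ⊢
      constructor <;> linarith
    | succ N ih =>
      have := (hcell N).union ih hμ0
      rw [← Icc_one_div_succ] at this
      rwa [Nat.cast_succ, add_assoc, one_add_one_eq_two]
  intro δ hδ
  obtain ⟨N, hN⟩ := exists_nat_one_div_lt hδ
  obtain ⟨C, hC, d, hgr⟩ := hIcc N δ hδ
  refine ⟨C + 1, by positivity, d, fun n => ?_⟩
  have hsmall : CoverBound (tower P J) (Icc 0 (1 / ((N : ℝ) + 1))) δ n 1 := by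
    refine ⟨{Icc 0 (1 / ((N : ℝ) + 1))}, by simp, by simp, fun S hS x hx y hy k _ => ?_⟩
    rw [Finset.mem_singleton.1 hS] at hx hy
    have hx := iterate_tower_mem_Icc P J N k hx
    have hy := iterate_tower_mem_Icc P J N k hy
    rw [abs_lt]
    constructor <;> linarith [hx.1, hx.2, hy.1, hy.2]
  refine ((hsmall.union (hgr n)).mono_set fun x hx => ?_).mono ?_
  · rcases le_total x (1 / ((N : ℝ) + 1)) with h | h
    · exact Or.inl ⟨hx.1, h⟩
    · exact Or.inr ⟨h, hx.2⟩
  · have h1 : (1 : ℝ) ≤ ((n : ℝ) + 1) ^ d :=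
      one_le_pow₀ (by linarith [Nat.cast_nonneg (α := ℝ) n])
    have h2 := one_le_mul_of_one_le_of_one_le h1 (one_le_pow₀ hμ (n := n))
    linarith

end Tower

/-! ### Modulus of continuity and entropy of the tower -/

section Tower

variable (P J : ℕ → ℕ)

/-- A Lipschitz constant of `tower P J` on `[1 / (N + 1), 1]`. -/
noncomputable def towerLip (N : ℕ) : ℝ := N.rec 1 fun n y => y + (2 ^ P n + 1)

theorem towerLip_pos (N : ℕ) : 0 < towerLip P N := by
  induction N with
  | zero => exact one_pos
  | succ N ih =>
    show 0 < towerLip P N + _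
    positivity

theorem one_div_add_one_le_one (N : ℕ) : 1 / ((N : ℝ) + 1) ≤ 1 := by
  rw [div_le_one (by positivity)]
  linarith [Nat.cast_nonneg (α := ℝ) N]

theorem tower_one_div (N : ℕ) : tower P J (1 / ((N : ℝ) + 1)) = 1 / ((N : ℝ) + 1) := by
  rw [← cell_two, tower_cell P J N (by norm_num), block_two]

theorem abs_tower_sub_le_of_cell (n : ℕ) {x y : ℝ}
    (hx : x ∈ Icc (1 / ((n : ℝ) + 2)) (1 / ((n : ℝ) + 1)))
    (hy : y ∈ Icc (1 / ((n : ℝ) + 2)) (1 / ((n : ℝ) + 1))) :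
    |tower P J x - tower P J y| ≤ (2 ^ P n + 1) * |x - y| := by
  rw [← cell_cellCoord n x, ← cell_cellCoord n y, tower_cell P J n (cellCoord_mem_Icc hx),
    tower_cell P J n (cellCoord_mem_Icc hy), abs_cell_sub, abs_cell_sub, ← mul_div_assoc]
  gcongr
  exact abs_block_sub_le _ _ _ _

theorem abs_tower_sub_le_of_Icc (N : ℕ) : ∀ x ∈ Icc (1 / ((N : ℝ) + 1)) 1,
    ∀ y ∈ Icc (1 / ((N : ℝ) + 1)) 1, |tower P J x - tower P J y| ≤ towerLip P N * |x - y| := by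
  induction N with
  | zero =>
    intro x hx y hy
    have e : ∀ z ∈ Icc (1 / (((0 : ℕ) : ℝ) + 1)) 1, z = 1 := fun z hz =>
      le_antisymm hz.2 (by simpa using hz.1)
    rw [e x hx, e y hy]
    simp
  | succ N ih =>
    have hl : towerLip P (N + 1) = towerLip P N + (2 ^ P N + 1) := rfl
    have h0 := towerLip_pos P N
    rw [Nat.cast_succ, add_assoc, one_add_one_eq_two]
    have hN := Nat.cast_nonneg (α := ℝ) N
    refine abs_sub_le_of_glue (c := 1 / ((N : ℝ) + 1))
      ⟨one_div_le_one_div_of_le (by positivity) (by linarith), one_div_add_one_le_one N⟩ ?_ ?_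
    · intro x hx y hy hxN hyN
      refine (abs_tower_sub_le_of_cell P J N ⟨hx.1, hxN⟩ ⟨hy.1, hyN⟩).trans ?_
      gcongr
      linarith
    · intro x hx y hy hxN hyN
      refine (ih x ⟨hxN, hx.2⟩ y ⟨hyN, hy.2⟩).trans ?_
      gcongr
      rw [hl]
      linarith [pow_pos (two_pos (α := ℝ)) (P N)]

/-- No Lipschitz constant need work near `0`, but there the values stay within the invariant
interval `[0, 1 / (N + 1)]`, which costs an additive error. -/
theorem abs_tower_sub_le (N : ℕ) {x y : ℝ} (hx : x ∈ Icc (0 : ℝ) 1) (hy : y ∈ Icc (0 : ℝ) 1) :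
    |tower P J x - tower P J y| ≤ towerLip P N * |x - y| + 1 / ((N : ℝ) + 1) := by
  have hN : (0 : ℝ) < 1 / ((N : ℝ) + 1) := by positivity
  have key : ∀ x ∈ Icc (0 : ℝ) 1, ∀ y ∈ Icc (0 : ℝ) 1, x ≤ 1 / ((N : ℝ) + 1) →
      |tower P J x - tower P J y| ≤ towerLip P N * |x - y| + 1 / ((N : ℝ) + 1) := by
    intro x hx y hy hxN
    have h1 := tower_mem_Icc P J N ⟨hx.1, hxN⟩
    have h0 := mul_nonneg (towerLip_pos P N).le (abs_nonneg (x - y))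
    rcases le_total y (1 / ((N : ℝ) + 1)) with hyN | hyN
    · have h2 := tower_mem_Icc P J N ⟨hy.1, hyN⟩
      rw [abs_le]
      constructor <;> linarith [h1.1, h1.2, h2.1, h2.2]
    · have h2 := abs_tower_sub_le_of_Icc P J N _ ⟨le_rfl, one_div_add_one_le_one N⟩ y ⟨hyN, hy.2⟩
      rw [tower_one_div] at h2
      have h3 := abs_sub_le (tower P J x) (1 / ((N : ℝ) + 1)) (tower P J y)
      have h4 : |tower P J x - 1 / ((N : ℝ) + 1)| ≤ 1 / ((N : ℝ) + 1) := by
        rw [abs_le]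
        constructor <;> linarith [h1.1, h1.2]
      have h5 : |1 / ((N : ℝ) + 1) - y| ≤ |x - y| := by
        rw [abs_of_nonpos (by linarith), abs_of_nonpos (by linarith)]
        linarith
      have h6 := mul_le_mul_of_nonneg_left h5 (towerLip_pos P N).le
      linarith
  rcases le_total x (1 / ((N : ℝ) + 1)) with hxN | hxN
  · exact key x hx y hy hxN
  rcases le_total y (1 / ((N : ℝ) + 1)) with hyN | hyN
  · rw [abs_sub_comm, abs_sub_comm x]
    exact key y hy x hx hyN
  · linarith [abs_tower_sub_le_of_Icc P J N x ⟨hxN, hx.2⟩ y ⟨hyN, hy.2⟩]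

/-- The map `tower P J` of the unit interval. -/
noncomputable def towerMap (x : unitInterval) : unitInterval :=
  ⟨tower P J x, by simpa using tower_mem_Icc P J 0 (x := x) (by simp)⟩

theorem coe_towerMap_iterate (k : ℕ) (x : unitInterval) :
    (((towerMap P J)^[k] x : unitInterval) : ℝ) = (tower P J)^[k] x := by
  induction k with
  | zero => rfl
  | succ k ih =>
    rw [Function.iterate_succ_apply', Function.iterate_succ_apply', ← ih]
    rfl

theorem topEntropy_towerMap_le {h : ℝ} (hh : 0 ≤ h) (hP : ∀ n, (P n : ℝ) / 2 ^ J n ≤ h) :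
    topEntropy univ (towerMap P J) ≤ (h : EReal) := by
  have h2 : ∀ t : ℝ, 0 ≤ t → 1 ≤ (2 : ℝ) ^ t := fun t ht => Real.one_le_rpow one_le_two ht
  have hgr : Grows (tower P J) (Icc 0 1) ((2 : ℝ) ^ h) := by
    refine tower_grows P J (h2 h hh) fun n => ?_
    have h0 : (0 : ℝ) ≤ (P n : ℝ) / 2 ^ J n := by positivity
    have hroot : Grows (root (P n) (J n)) (Icc 0 1) ((2 : ℝ) ^ ((P n : ℝ) / 2 ^ J n)) := by
      refine root_grows _ _ (h2 _ h0) ?_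
      rw [← Real.rpow_mul_natCast two_pos.le, Nat.cast_pow, Nat.cast_two,
        div_mul_cancel₀ _ (by positivity), Real.rpow_natCast]
    exact block_grows _ _ (h2 h hh) (hroot.mono_rate (by positivity)
      (Real.rpow_le_rpow_of_exponent_le one_le_two (hP n)))
  have := topEntropy_le_of_grows (φ := towerMap P J) (fun _ => rfl) (h2 h hh) hgr
  rwa [Real.logb_rpow two_pos (by norm_num)] at this

theorem div_pow_mem_Icc (j : ℕ) {u : ℝ} (hu : u ∈ Icc (0 : ℝ) 1) : u / 3 ^ j ∈ Icc (0 : ℝ) 1 := by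
  have h3 : (1 : ℝ) ≤ 3 ^ j := one_le_pow₀ (by norm_num)
  exact ⟨div_nonneg hu.1 (by positivity), (div_le_one (by positivity)).2 (hu.2.trans h3)⟩

theorem iterate_tower_cell_div (n : ℕ) {u : ℝ} (hu : u ∈ Icc (0 : ℝ) 1) :
    (tower P J)^[2 ^ J n] (cell n (u / 3 ^ J n)) = cell n (zigzag (P n) u / 3 ^ J n) := by
  have h := div_pow_mem_Icc (J n) hu
  rw [iterate_tower_cell P J n _ ⟨by linarith [h.1], by linarith [h.2]⟩,
    iterate_block_of_nonneg _ _ _ h, iterate_two_pow_root _ _ hu]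

/-- Every second branch of the zigzag, each with an explicit right inverse. Skipping the others
makes the chosen closed branches disjoint, at the price of halving their number. -/
theorem zigzag_succ_eq {p : ℕ} (i : Fin (2 ^ p)) {v : ℝ} (hv : v ∈ Icc (0 : ℝ) 1) :
    zigzag (p + 1) ((2 * i + v) / 2 ^ (p + 1)) = v := by
  have h := triangle_two_mul_sub ((2 : ℤ) ^ p - (i : ℕ)) hv.1 hv.2
  rw [zigzag]
  convert h using 2
  push_cast
  field_simp
  ring

/-- Inside cell `n`, the iterate of order `2 ^ J n` contains a scaled zigzag with `2 ^ P n`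
branches; half of them are disjoint and each covers all the others, whence `P n - 1`. -/
theorem le_topEntropy_towerMap (n : ℕ) :
    ((((P n : ℝ) - 1) / 2 ^ J n : ℝ) : EReal) ≤ topEntropy univ (towerMap P J) := by
  rcases Nat.eq_zero_or_pos (P n) with hp | hp
  · refine le_trans ?_ (topEntropy_nonneg univ (towerMap P J))
    rw [hp, ← EReal.coe_zero, EReal.coe_le_coe_iff]
    exact div_nonpos_of_nonpos_of_nonneg (by norm_num) (by positivity)
  obtain ⟨p, hp⟩ := Nat.exists_eq_add_of_le' hp
  have hmem : ∀ u : unitInterval, cell n ((u : ℝ) / 3 ^ J n) ∈ unitInterval := by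
    intro u
    have h := div_pow_mem_Icc (J n) u.2
    have h1 := cell_mem_Icc (n := n) (s := (u : ℝ) / 3 ^ J n) ⟨by linarith [h.1], by linarith [h.2]⟩
    exact ⟨le_trans (by positivity) h1.1, h1.2.trans (one_div_add_one_le_one n)⟩
  let θ : unitInterval → unitInterval := fun u => ⟨cell n ((u : ℝ) / 3 ^ J n), hmem u⟩
  have hθc : Continuous θ := by
    refine Continuous.subtype_mk ?_ _
    unfold cell
    fun_prop
  have hθi : Function.Injective θ := by
    intro u v huv
    have h := (strictMono_cell n).injective (Subtype.ext_iff.1 huv)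
    exact Subtype.ext ((div_left_inj' (by positivity)).1 h)
  have hpow : (0 : ℝ) < 2 ^ (p + 1) := by positivity
  let I : Fin (2 ^ p) → Set unitInterval := fun i =>
    {u | (2 * i : ℝ) / 2 ^ (p + 1) ≤ u ∧ (u : ℝ) ≤ (2 * i + 1) / 2 ^ (p + 1)}
  have hI : ∀ i : Fin (2 ^ p), ∀ v : unitInterval,
      ((2 * i : ℝ) + v) / 2 ^ (p + 1) ∈ unitInterval := by
    intro i v
    have hi : ((i : ℕ) : ℝ) + 1 ≤ 2 ^ p := by exact_mod_cast i.2
    refine ⟨div_nonneg (add_nonneg (by positivity) v.2.1) hpow.le, ?_⟩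
    rw [div_le_one hpow, pow_succ]
    linarith [v.2.2]
  have hmemI : ∀ i v, (⟨_, hI i v⟩ : unitInterval) ∈ I i := by
    intro i v
    constructor
    · show _ / _ ≤ _ / _
      gcongr
      linarith [v.2.1]
    · show _ / _ ≤ _ / _
      gcongr
      exact v.2.2
  have h := le_topEntropy_of_covering (f := towerMap P J) (n := 2 ^ J n) (s := 2 ^ p)
    Nat.one_le_two_pow (K := fun i => θ '' I i) ?_ ?_ ?_ ?_
  · refine le_trans (le_of_eq ?_) h
    rw [hp]
    push_cast
    rw [Real.logb_pow, Real.logb_self_eq_one one_lt_two, add_sub_cancel_right, mul_one]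
  · intro i
    refine (IsClosed.isCompact ?_).image hθc |>.isClosed
    exact (isClosed_le continuous_const continuous_subtype_val).inter
      (isClosed_le continuous_subtype_val continuous_const)
  · intro i
    exact ⟨_, mem_image_of_mem θ (hmemI i 0)⟩
  · intro i k hik
    refine (disjoint_image_iff hθi).2 (disjoint_left.2 fun u hu hu' => ?_)
    have key : ∀ i k : Fin (2 ^ p), u ∈ I i → u ∈ I k → k ≤ i := by
      intro i k hu hu'
      have h1 := (div_le_div_iff_of_pos_right hpow).1 (hu'.1.trans hu.2)
      by_contra hlt
      have h2 : ((i : ℕ) : ℝ) + 1 ≤ (k : ℕ) := by exact_mod_cast not_le.1 hlt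
      linarith
    exact hik (le_antisymm (key k i hu' hu) (key i k hu hu'))
  · rintro i k _ ⟨v, -, rfl⟩
    refine ⟨_, mem_image_of_mem θ (hmemI i v), Subtype.ext ?_⟩
    rw [coe_towerMap_iterate]
    show (tower P J)^[2 ^ J n] (cell n (_ / 3 ^ J n)) = cell n (_ / 3 ^ J n)
    rw [iterate_tower_cell_div P J n (hI i v), hp, zigzag_succ_eq i v.2]

end Tower

/-! ### Computability from a modulus of continuity -/

section Modulus

/-- A ball is listed in the preimage when, for some `N`, the value at its centre together with the
modulus keeps its image inside the target. Exact rational values at ideal points make this test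
decidable for each `N`. -/
theorem isComputableMap_of_modulus {f : unitInterval → unitInterval} {L : ℕ → ℝ}
    (hf : RatComputable fun i => ((f (unitRat i) : unitInterval) : ℝ)) (hL : RatComputable L)
    (hL0 : ∀ N, 0 ≤ L N)
    (h : ∀ N x y, |(f x : ℝ) - f y| ≤ L N * |(x : ℝ) - y| + 1 / ((N : ℝ) + 1)) :
    IsComputableMap unitIntervalMetric unitIntervalMetric f := by
  refine ⟨fun m => {n | ∃ N : ℕ, |(f (unitRat n.unpair.1) : ℝ) - unitRat m.unpair.1| +
    L N * ((posRatOfNat n.unpair.2 : ℚ) : ℝ) + 1 / ((N : ℝ) + 1) <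
      ((posRatOfNat m.unpair.2 : ℚ) : ℝ)}, ?_, fun m => ?_⟩
  · have h1 : RatComputable fun q : (ℕ × ℕ) × ℕ => ((f (unitRat q.1.2.unpair.1) : unitInterval) : ℝ) :=
      hf.comp (computable_unpair_fst (Computable.snd.comp Computable.fst))
    have h2 : RatComputable fun q : (ℕ × ℕ) × ℕ => ((unitRat q.1.1.unpair.1 : unitInterval) : ℝ) :=
      ratComputable_unitRat.comp (computable_unpair_fst (Computable.fst.comp Computable.fst))
    have h3 : RatComputable fun q : (ℕ × ℕ) × ℕ => ((posRatOfNat q.1.2.unpair.2 : ℚ) : ℝ) :=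
      ratComputable_posRat.comp (computable_unpair_snd (Computable.snd.comp Computable.fst))
    have h4 : RatComputable fun q : (ℕ × ℕ) × ℕ => ((posRatOfNat q.1.1.unpair.2 : ℚ) : ℝ) :=
      ratComputable_posRat.comp (computable_unpair_snd (Computable.fst.comp Computable.fst))
    have h5 : RatComputable fun q : (ℕ × ℕ) × ℕ => (q.2 : ℝ) + 1 :=
      (ratComputable_natCast Computable.snd).add ratComputable_one
    have h6 : RatComputable fun q : (ℕ × ℕ) × ℕ => 1 / ((q.2 : ℝ) + 1) :=
      ratComputable_one.div h5 fun q => by positivity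
    have h7 := (((h1.sub h2).abs.add ((hL.comp Computable.snd).mul h3)).add h6).lt h4
    exact (rePred_exists h7.to_re).of_eq fun _ => Iff.rfl
  · ext x
    simp only [mem_preimage, mem_iUnion, mem_idealBall_unit, exists_prop, mem_ofPred_eq]
    set r := ((posRatOfNat m.unpair.2 : ℚ) : ℝ)
    constructor
    · intro hx
      -- The slack `ε` is split in four: the additive error `1 / (N + 1)` enters twice, the offset
      -- and radius of the ball together use one quarter, and one quarter is left over.
      obtain ⟨N, hN⟩ := exists_nat_one_div_lt (by linarith :
        0 < (r - |(f x : ℝ) - unitRat m.unpair.1|) / 4)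
      have hLN := hL0 N
      set ε := r - |(f x : ℝ) - unitRat m.unpair.1| with hε
      have hε0 : 0 < ε := by linarith
      obtain ⟨n, hn, hnε⟩ := exists_idealBall_subset x (ε := ε / (4 * (L N + 1))) (by positivity)
      rw [mem_idealBall_unit] at hn
      refine ⟨n, ⟨N, ?_⟩, hn⟩
      have h1 := h N (unitRat n.unpair.1) x
      have h2 := abs_sub_le (f (unitRat n.unpair.1) : ℝ) (f x) (unitRat m.unpair.1)
      rw [abs_sub_comm (unitRat n.unpair.1 : ℝ)] at h1
      have h3 := mul_le_mul_of_nonneg_left hnε.le hLN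
      have h4 : L N * (ε / (4 * (L N + 1))) ≤ ε / 4 := by
        rw [mul_div_assoc', div_le_div_iff₀ (by positivity) (by positivity)]
        nlinarith
      linarith
    · rintro ⟨n, ⟨N, hN⟩, hn⟩
      have h1 := h N x (unitRat n.unpair.1)
      have h2 := abs_sub_le (f x : ℝ) (f (unitRat n.unpair.1)) (unitRat m.unpair.1)
      have h3 := mul_le_mul_of_nonneg_left hn.le (hL0 N)
      linarith

end Modulus

/-! ### Computability of the tower -/

section Computability

theorem triangle_abs (y : ℝ) : triangle |y| = triangle y := by
  have key : ∀ y : ℝ, triangle (-y) ≤ triangle y := by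
    intro y
    refine (triangle_le_abs (-y) (-round (y / 2))).trans_eq ?_
    rw [triangle, ← abs_neg]
    push_cast
    congr 1
    ring
  rcases abs_choice y with h | h
  · rw [h]
  · rw [h]
    refine le_antisymm (key y) ?_
    simpa using key (-y)

/-- By evenness the argument may be taken non-negative, where rounding is a floor of natural
numbers. -/
theorem triangle_eq_nat_floor (y : ℝ) :
    triangle y = |(|y|) - 2 * (⌊|y| / 2 + 1 / 2⌋₊ : ℝ)| := by
  rw [← triangle_abs, triangle, round_eq, ← natCast_floor_eq_intCast_floor (by positivity)]

/-- The definition of `root` changes its argument at each level. With the innermost argument `X`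
fixed, the levels are evaluated from the inside outwards, by a recursion that carries only a value.
-/
theorem root_eq_rec (p j : ℕ) (X : ℝ) : root p j (X / 3 ^ j) =
    Nat.rec (zigzag p X) (fun i y => if X / 3 ^ (i + 1) ≤ 1 / 3 then 1 - y / 3 else
      max (5 / 3 - 2 * (X / 3 ^ (i + 1))) (1 - X / 3 ^ (i + 1))) j := by
  induction j with
  | zero => simp [root]
  | succ j ih =>
    dsimp only
    rw [← ih, root, show 3 * (X / 3 ^ (j + 1)) = X / 3 ^ j by rw [pow_succ]; field_simp]

variable {α : Type*} [Primcodable α]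

theorem ratComputable_two_pow {n : α → ℕ} (hn : Computable n) :
    RatComputable fun a => (2 : ℝ) ^ n a :=
  (ratComputable_natCast (computable_pow (Computable.const 2) hn)).of_eq fun a => by push_cast; rfl

theorem ratComputable_three_pow {n : α → ℕ} (hn : Computable n) :
    RatComputable fun a => (3 : ℝ) ^ n a :=
  (ratComputable_natCast (computable_pow (Computable.const 3) hn)).of_eq fun a => by push_cast; rfl

variable {r : α → ℝ} {p j : α → ℕ}

theorem RatComputable.zigzag (hr : RatComputable r) (hp : Computable p) :
    RatComputable fun a => zigzag (p a) (r a) := by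
  have hy := ((ratComputable_two_pow hp).mul (ratComputable_one.sub hr)).abs
  have h2 := ratComputable_ofNat (α := α) 2
  have hfl := ((hy.div h2 fun _ => zero_le_two).add
    (ratComputable_one.div h2 fun _ => zero_le_two)).nat_floor
  exact (hy.sub (h2.mul (ratComputable_natCast hfl))).abs.of_eq fun a =>
    (triangle_eq_nat_floor _).symm

theorem RatComputable.root (hr : RatComputable r) (hp : Computable p) (hj : Computable j) :
    RatComputable fun a => root (p a) (j a) (r a) := by
  have hX := (ratComputable_three_pow hj).mul hr
  have h3 : RatComputable fun _ : α × (ℕ × ℕ) => (3 : ℝ) := ratComputable_ofNat 3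
  have hx : RatComputable fun q : α × (ℕ × ℕ) => 3 ^ j q.1 * r q.1 / 3 ^ (q.2.1 + 1) :=
    (hX.comp Computable.fst).div (ratComputable_three_pow
      (Computable.succ.comp (Computable.fst.comp Computable.snd))) fun _ => by positivity
  have hy : RatComputable fun q : α × (ℕ × ℕ) => ((ratOfNat q.2.2 : ℚ) : ℝ) :=
    ratComputable_code (Computable.snd.comp Computable.snd)
  have hc := hx.le (ratComputable_one.div h3 fun _ => by norm_num)
  have hs := RatComputable.ite hc (ratComputable_one.sub (hy.div h3 fun _ => by norm_num))
    ((((ratComputable_ofNat 5).div h3 fun _ => by norm_num).sub ((ratComputable_ofNat 2).mul hx)).max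
      (ratComputable_one.sub hx))
  refine (RatComputable.nat_rec (s := fun a i y => if 3 ^ j a * r a / 3 ^ (i + 1) ≤ 1 / 3 then
    1 - y / 3 else Max.max (5 / 3 - 2 * (3 ^ j a * r a / 3 ^ (i + 1)))
      (1 - 3 ^ j a * r a / 3 ^ (i + 1))) hj (hX.zigzag hp) hs).of_eq fun a => ?_
  rw [← root_eq_rec, mul_div_cancel_left₀ _ (by positivity)]

theorem RatComputable.block (hr : RatComputable r) (hp : Computable p) (hj : Computable j) :
    RatComputable fun a => block (p a) (j a) (r a) := by
  have h1 : RatComputable fun _ : α => (1 : ℝ) := ratComputable_one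
  have h2 : RatComputable fun _ : α => (2 : ℝ) := ratComputable_ofNat 2
  exact (RatComputable.ite (hr.lt h1.neg) (h2.mul (hr.add h1))
    (RatComputable.ite (hr.le h1) (hr.abs.root hp hj) (h2.mul (hr.sub h1)))).of_eq fun _ => rfl

theorem RatComputable.tower {P J : ℕ → ℕ} (hP : Computable P) (hJ : Computable J)
    (hr : RatComputable r) (h0 : ∀ a, 0 ≤ r a) : RatComputable fun a => tower P J (r a) := by
  have h1 : RatComputable fun _ : α => (1 : ℝ) := ratComputable_one
  have h2 : RatComputable fun _ : α => (2 : ℝ) := ratComputable_ofNat 2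
  have h4 : RatComputable fun _ : α => (4 : ℝ) := ratComputable_ofNat 4
  have hn : Computable fun a => ⌊1 / r a⌋₊ - 1 :=
    computable_sub (h1.div hr h0).nat_floor (Computable.const 1)
  have hn' := ratComputable_natCast hn
  have hn1 := hn'.add h1
  have hn2 := hn'.add h2
  have hs := ((h4.mul ((hn2.mul hr).sub h1)).mul hn1).sub h2
  have hb := hs.block (hP.comp hn) (hJ.comp hn)
  have hc := (h1.div hn2 fun _ => by positivity).add
    ((hb.add h2).div ((h4.mul hn1).mul hn2) fun _ => by positivity)
  have hz : RatComputable fun _ : α => (0 : ℝ) := (ratComputable_nat 0).of_eq fun _ => Nat.cast_zero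
  exact (RatComputable.ite (hr.le hz) hz hc).of_eq fun _ => rfl

theorem ratComputable_towerLip {P : ℕ → ℕ} (hP : Computable P) : RatComputable (towerLip P) := by
  have hs : RatComputable fun q : ℕ × (ℕ × ℕ) =>
      ((ratOfNat q.2.2 : ℚ) : ℝ) + ((2 : ℝ) ^ P q.2.1 + 1) :=
    (ratComputable_code (Computable.snd.comp Computable.snd)).add
      ((ratComputable_two_pow (hP.comp (Computable.fst.comp Computable.snd))).add ratComputable_one)
  exact (RatComputable.nat_rec (s := fun _ n y => y + (2 ^ P n + 1)) Computable.id
    ratComputable_one hs).of_eq fun _ => rfl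

theorem isComputableMap_towerMap {P J : ℕ → ℕ} (hP : Computable P) (hJ : Computable J) :
    IsComputableMap unitIntervalMetric unitIntervalMetric (towerMap P J) :=
  isComputableMap_of_modulus (RatComputable.tower hP hJ ratComputable_unitRat fun i => (unitRat i).2.1)
    (ratComputable_towerLip hP) (fun N => (towerLip_pos P N).le)
    fun N x y => abs_tower_sub_le P J N x.2 y.2

end Computability

/-! ### Realizing every non-negative lower-computable number -/

section Realization

/-- Every term `q i` is rounded down to multiples of `2⁻ʲ` for all `j` at once. Negative terms
become `0`, and large `j` make the loss of `1` in the numerator negligible. -/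
theorem exists_computable_dyadic {q : ℕ → ℚ} (hq : IsComputableRatSeq q) :
    ∃ P J : ℕ → ℕ, Computable P ∧ Computable J ∧
      (∀ n, ∃ i, (P n : ℝ) / 2 ^ J n ≤ max 0 (q i : ℝ)) ∧
      ∀ i, ∀ ε > 0, ∃ n, (q i : ℝ) - ε ≤ ((P n : ℝ) - 1) / 2 ^ J n := by
  obtain ⟨g, hg, h⟩ := hq
  have hr : RatComputable fun n : ℕ => ((q n.unpair.1 : ℚ) : ℝ) * 2 ^ n.unpair.2 :=
    (RatComputable.mul (r := fun n : ℕ => ((q n.unpair.1 : ℚ) : ℝ))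
      ⟨_, hg.comp (computable_unpair_fst Computable.id), fun n => by dsimp only; rw [h]; rfl⟩
      (ratComputable_two_pow (computable_unpair_snd Computable.id)))
  refine ⟨fun n => ⌊((q n.unpair.1 : ℚ) : ℝ) * 2 ^ n.unpair.2⌋₊, fun n => n.unpair.2,
    hr.nat_floor, computable_unpair_snd Computable.id, fun n => ⟨n.unpair.1, ?_⟩, ?_⟩
  · dsimp only
    rw [div_le_iff₀ (by positivity)]
    rcases le_total 0 ((q n.unpair.1 : ℚ) : ℝ) with h0 | h0
    · rw [max_eq_right h0]
      exact Nat.floor_le (by positivity)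
    · rw [Nat.floor_of_nonpos (mul_nonpos_of_nonpos_of_nonneg h0 (by positivity)), max_eq_left h0]
      simp
  · intro i ε hε
    -- Rounding down and the loss in the numerator cost at most `2⁻ʲ` each, so `2⁻ʲ < ε / 2`
    -- suffices.
    obtain ⟨j, hj⟩ := exists_pow_lt_of_lt_one (half_pos hε) (by norm_num : (1 / 2 : ℝ) < 1)
    refine ⟨Nat.pair i j, ?_⟩
    simp only [Nat.unpair_pair]
    rw [le_div_iff₀ (by positivity)]
    have h1 := Nat.lt_floor_add_one ((q i : ℝ) * 2 ^ j)
    rw [one_div, inv_pow, inv_lt_iff_one_lt_mul₀ (by positivity)] at hj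
    linarith

theorem exists_isComputableMap_topEntropy_eq {h : EReal} (h0 : 0 ≤ h) (hh : IsLowerComputable h) :
    ∃ f : unitInterval → unitInterval,
      IsComputableMap unitIntervalMetric unitIntervalMetric f ∧ topEntropy univ f = h := by
  obtain ⟨q, hq, rfl⟩ := hh
  obtain ⟨P, J, hP, hJ, hle, hge⟩ := exists_computable_dyadic hq
  refine ⟨towerMap P J, isComputableMap_towerMap hP hJ, le_antisymm ?_ (iSup_le fun i => ?_)⟩
  · set h := ⨆ n, (((q n : ℚ) : ℝ) : EReal) with hh
    have hqh : ∀ i, (((q i : ℚ) : ℝ) : EReal) ≤ h := le_iSup fun n => (((q n : ℚ) : ℝ) : EReal)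
    clear_value h
    induction h with
    | bot => simp at h0
    | top => exact le_top
    | coe t =>
      have ht := EReal.coe_nonneg.1 h0
      refine topEntropy_towerMap_le P J ht fun n => ?_
      obtain ⟨i, hi⟩ := hle n
      exact hi.trans (max_le ht (EReal.coe_le_coe_iff.1 (hqh i)))
  · refine EReal.ge_of_forall_gt_iff_ge.1 fun z hz => ?_
    rw [EReal.coe_lt_coe_iff] at hz
    obtain ⟨n, hn⟩ := hge i _ (sub_pos.2 hz)
    refine le_trans ?_ (le_topEntropy_towerMap P J n)
    rw [EReal.coe_le_coe_iff]
    linarith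

end Realization

end CompEntropy

theorem theoremC (h : EReal) :
    (∃ f : unitInterval → unitInterval,
      CompEntropy.IsComputableMap CompEntropy.unitIntervalMetric CompEntropy.unitIntervalMetric f ∧
        CompEntropy.topEntropy Set.univ f = h) ↔
      0 ≤ h ∧ CompEntropy.IsLowerComputable h := by
  refine ⟨?_, fun hh =>
    CompEntropy.exists_isComputableMap_topEntropy_eq hh.1 hh.2⟩
  rintro ⟨f, hf, rfl⟩
  exact ⟨CompEntropy.topEntropy_nonneg _ _, CompEntropy.isLowerComputable_topEntropy hf⟩
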